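/- Let $\mathbf Z_+=\{0,1,2,\dots\}$, $\mathbf N=\{1,2,\dots\}$, $q=e^{h/2}\in\mathbf C[[h]]$, $[x]=\frac{q^x-q^{-x}}{q-q^{-1}}$ (where $q^x=e^{hx/2}$), $\theta(i)=1$ for $i\ge0$ and $\theta(i)=0$ for $i<0$. Let $\xi_0,\xi_1\in\mathbf C[h]$ and let $\{M_i\}_{i\in\mathbf Z}$ be a sequence in $\mathbf C[h]$ with $M_i-M_j\in\mathbf Z_+$ for all $i<j$. A $C$-pattern $|M)$ is a collection of polynomials $M_{i,2k+\vartheta-1}\in\mathbf C[h]$ ($k\in\mathbf N$, $\vartheta\in\{0,1\}$, $1-\vartheta-k\le i\le k-1$) such that (i) there is an integer $N>1$ with $M_{i,p}=M_i$ for every position $(i,p)$ with $p\ge N$; (ii) $M_{i+\vartheta-1,2k+\vartheta}-M_{i,2k+\vartheta-1}\in\mathbf Z_+$ and $M_{i,2k+\vartheta-1}-M_{i+\vartheta,2k+\vartheta}\in\mathbf Z_+$ for all such $k,\vartheta,i$. Let $V$ be the $h$-adic completion of the free $\mathbf C[[h]]$-module with basis the set of all $C$-patterns. Put $L_{i,p}=M_{i,p}-i$,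 and let $S(j,l;\nu)=(-1)^\nu$ if $j=l$, $1$ if $j<l$, $-1$ if $j>l$. Write $|M)_{\pm\{j,p\}}$ (and likewise $|M)^{\pm\{j,p\}}$) for the result of replacing $M_{j,p}$ by $M_{j,p}\pm1$, and put $e_i^0=f_i$, $e_i^1=e_i$. Define continuous $\mathbf C[[h]]$-endomorphisms $\rho(e_i),\rho(f_i),\rho(h_i)$ $(i\in\mathbf Z)$ and $\rho(c)$ of $V$ on the basis by $$\rho(e_{-1}^{1-\mu})|M)=\big([L_{-1,2}-L_{0,1}-\mu][L_{0,1}-L_{0,2}+\mu]\big)^{1/2}|M)_{-(-1)^\mu\{0,1\}},\qquad \mu=0,1,$$ and, for $i\in\mathbf N$ and $\mu,\nu\in\{0,1\}$, $$\rho(e^{\mu}_{(-1)^\nu i-1})|M)=-\sum_{j=1-i-\nu}^{i-1}\ \sum_{l=-i}^{i+\nu-1}S(j,l;\nu)\,(-A_{j,l}B_{j,l})^{1/2}\,|M)^{-(-1)^{\mu+\nu}\{l,2i+\nu\}}_{-(-1)^{\mu+\nu}\{j,2i-1+\nu\}},$$ $$A_{j,l}=\frac{\prod_{k\ne l,\,k=-i}^{i+\nu-1}[L_{k,2i+\nu}-L_{j,2i+\nu-1}-(-1)^\nu\mu]\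 \prod_{k=1-i}^{i+\nu-2}[L_{k,2i+\nu-2}-L_{j,2i+\nu-1}-(-1)^\nu\mu]}{\prod_{k\ne j,\,k=1-i-\nu}^{i-1}[L_{k,2i+\nu-1}-L_{j,2i+\nu-1}][L_{k,2i+\nu-1}-L_{j,2i+\nu-1}+(-1)^{\mu+\nu}]},$$ $$B_{j,l}=\frac{\prod_{k=-i-\nu}^{i}[L_{k,2i+\nu+1}-L_{l,2i+\nu}+(-1)^\nu(1-\mu)]\ \prod_{k\ne j,\,k=1-i-\nu}^{i-1}[L_{k,2i+\nu-1}-L_{l,2i+\nu}+(-1)^\nu(1-\mu)]}{\prod_{k\ne l,\,k=-i}^{i+\nu-1}[L_{k,2i+\nu}-L_{l,2i+\nu}][L_{k,2i+\nu}-L_{l,2i+\nu}+(-1)^{\mu+\nu}]},$$ while $\rho(c)|M)=(\xi_0-\xi_1)|M)$ and, for $i\in\mathbf Z$, $$\rho(h_i)|M)=\Big(\sum_{j=-|i|}^{|i|+\theta(i)-1}M_{j,2|i|+\theta(i)}-\sum_{j=-|i|+1-\theta(i)}^{|i|-1}M_{j,2|i|+\theta(i)-1}+(\xi_1-\xi_0)\theta(-i)-\xi_1\Big)|M).$$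 Terms in which the array on the right is not a $C$-pattern are deleted, and $(\cdot)^{1/2}$ denotes the square root in $\mathbf C[[h]]$ with positive constant term. **Proposition.** All coefficients of the remaining terms are well defined in $\mathbf C[[h]]$ (the denominators are invertible and the radicands have a square root with positive constant term). The endomorphisms $e_i=\rho(e_i)$, $f_i=\rho(f_i)$, $h_i=\rho(h_i)$, $c=\rho(c)$ of $V$ satisfy the defining relations of $U_h(a_\infty)$ for all $i,j\in\mathbf Z$: 1. (Cartan relations) $[c,h_i]=[c,e_i]=[c,f_i]=0$; $[h_i,h_j]=0$; $[h_i,e_j]=(\delta_{ij}-\delta_{i,j+1})e_j$; $[h_i,f_j]=-(\delta_{ij}-\delta_{i,j+1})f_j$; $e_if_i-f_ie_i=\big[h_i-h_{i+1}+(\theta(-i)-\theta(-i-1))c\big]$, where the right side is the $q$-number $\frac{q^a-q^{-a}}{q-q^{-1}}$ of the endomorphism $a=h_i-h_{i+1}+(\theta(-i)-\theta(-i-1))c$, an $h$-adically convergent series; $[e_i,f_j]=0$ for $i\ne j$. 2. ($e$-Serre relations) $[e_i,e_j]=0$ if $|i-j|\ne1$; $e_i^2e_{i+1}-(q+q^{-1})e_ie_{i+1}e_i+e_{i+1}e_i^2=0$;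 $e_{i+1}^2e_i-(q+q^{-1})e_{i+1}e_ie_{i+1}+e_ie_{i+1}^2=0$. 3. ($f$-Serre relations) the same relations with every $e$ replaced by $f$. -/

import Mathlib

open scoped Polynomial PowerSeries

noncomputable section

namespace UhAInf

/-! ### The base ring `ℂ[[h]]` (with `h = PowerSeries.X`) and `q`-numbers -/

/-- The formal variable `h` of `ℂ[[h]]`. -/
abbrev hh : ℂ⟦X⟧ := PowerSeries.X

/-- `q ^ x = exp (h x / 2)` for `x ∈ ℂ[[h]]`; in particular `q = qPow 1`, `q⁻¹ = qPow (-1)`. -/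
def qPow (x : ℂ⟦X⟧) : ℂ⟦X⟧ :=
  (PowerSeries.exp ℂ).subst (PowerSeries.C (1 / 2 : ℂ) * hh * x)

/-- `f ↦ (f - f(0)) / h`. -/
def divH (f : ℂ⟦X⟧) : ℂ⟦X⟧ := PowerSeries.mk fun n => PowerSeries.coeff (n + 1) f

/-- The unit `(q - q⁻¹) / h` of `ℂ[[h]]`. -/
def qUnit : ℂ⟦X⟧ := divH (qPow 1 - qPow (-1))

/-- The `q`-number `[x] = (q ^ x - q ^ (-x)) / (q - q⁻¹) ∈ ℂ[[h]]`. Numerator and denominator are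
both divisible by `h`, and the quotient is taken after cancelling `h`
(see `bracket_mul` below). -/
def bracket (x : ℂ⟦X⟧) : ℂ⟦X⟧ := divH (qPow x - qPow (-x)) * qUnit⁻¹

theorem hh_mul_divH (f : ℂ⟦X⟧) (hf : PowerSeries.constantCoeff f = 0) : hh * divH f = f := by
  ext n
  cases n with
  | zero => simp [hf]
  | succ n => simp [divH, PowerSeries.coeff_succ_X_mul]

theorem hasSubst_qPow (x : ℂ⟦X⟧) :
    PowerSeries.HasSubst (PowerSeries.C (1 / 2 : ℂ) * hh * x) := by
  apply PowerSeries.HasSubst.of_constantCoeff_zero'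
  simp

theorem coeff_qPow (x : ℂ⟦X⟧) (n : ℕ) : PowerSeries.coeff n (qPow x) =
    ∑ k ∈ Finset.range (n + 1), (1 / 2 : ℂ) ^ k / (k.factorial : ℂ) *
      PowerSeries.coeff n (hh ^ k * x ^ k) := by
  unfold qPow
  rw [PowerSeries.coeff_subst' (hasSubst_qPow x),
    finsum_eq_sum_of_support_subset (s := Finset.range (n + 1))]
  · refine Finset.sum_congr rfl fun k _ => ?_
    rw [mul_pow, mul_pow, ← map_pow, mul_assoc, PowerSeries.coeff_C_mul, PowerSeries.coeff_exp]
    simp only [one_div, eq_ratCast, Rat.cast_inv, Rat.cast_natCast, smul_eq_mul]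
    ring
  · intro k hk
    by_contra hlt
    apply hk
    have hkn : n < k := by simpa using hlt
    have h0 : PowerSeries.coeff n ((PowerSeries.C (1 / 2 : ℂ) * hh * x) ^ k) = 0 := by
      rw [mul_comm (PowerSeries.C (1 / 2 : ℂ)) hh, mul_assoc, mul_pow,
        PowerSeries.coeff_X_pow_mul', if_neg (by omega)]
    simp only [h0, smul_zero]

theorem constantCoeff_qPow (x : ℂ⟦X⟧) : PowerSeries.constantCoeff (qPow x) = 1 := by
  rw [← PowerSeries.coeff_zero_eq_constantCoeff_apply, coeff_qPow]
  simp

theorem hh_mul_qUnit : hh * qUnit = qPow 1 - qPow (-1) :=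
  hh_mul_divH _ (by simp [constantCoeff_qPow])

theorem constantCoeff_qUnit : PowerSeries.constantCoeff qUnit = 1 := by
  have h1 : PowerSeries.constantCoeff qUnit = PowerSeries.coeff 1 (qPow 1 - qPow (-1)) := by
    rw [← PowerSeries.coeff_zero_eq_constantCoeff_apply, qUnit, divH, PowerSeries.coeff_mk]
  rw [h1, map_sub, coeff_qPow, coeff_qPow]
  simp [Finset.sum_range_succ, PowerSeries.coeff_one_X]
  norm_num

/-- `[x]` is characterized by `[x] (q - q⁻¹) = q ^ x - q ^ (-x)`. -/
theorem bracket_mul (x : ℂ⟦X⟧) :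
    bracket x * (qPow 1 - qPow (-1)) = qPow x - qPow (-x) := by
  have hu : qUnit⁻¹ * qUnit = 1 :=
    PowerSeries.inv_mul_cancel _ (by rw [constantCoeff_qUnit]; exact one_ne_zero)
  have h1 := hh_mul_divH (qPow x - qPow (-x)) (by simp [constantCoeff_qPow])
  rw [← hh_mul_qUnit, bracket]
  linear_combination (hh * divH (qPow x - qPow (-x))) * hu + h1

/-- `g` is the square root of `f` in `ℂ[[h]]` with positive constant term. -/
def IsPosSqrt (f g : ℂ⟦X⟧) : Prop :=
  g ^ 2 = f ∧ ∃ r : ℝ, 0 < r ∧ PowerSeries.constantCoeff g = (r : ℂ)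

open Classical in
/-- `f ^ (1/2)`: the square root of `f` in `ℂ[[h]]` with positive constant term (and `0` if
there is none). -/
def sqrtSeries (f : ℂ⟦X⟧) : ℂ⟦X⟧ :=
  if H : ∃ g, IsPosSqrt f g then H.choose else 0

theorem IsPosSqrt.unique {f g g' : ℂ⟦X⟧} (h : IsPosSqrt f g) (h' : IsPosSqrt f g') : g = g' := by
  obtain ⟨h1, r, hr, hg⟩ := h
  obtain ⟨h2, s, hs, hg'⟩ := h'
  rcases sq_eq_sq_iff_eq_or_eq_neg.mp (h1.trans h2.symm) with e | e
  · exact e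
  · exfalso
    have := congrArg PowerSeries.constantCoeff e
    rw [map_neg, hg, hg'] at this
    have : r = -s := by exact_mod_cast this
    linarith

theorem IsPosSqrt.sqrtSeries_eq {f g : ℂ⟦X⟧} (h : IsPosSqrt f g) : sqrtSeries f = g := by
  have H : ∃ g, IsPosSqrt f g := ⟨g, h⟩
  rw [sqrtSeries, dif_pos H]
  exact H.choose_spec.unique h

/-! ### `C`-patterns -/

/-- The positions `(i, p)` of a pattern (column `i`, row `p`):
`p = 2k + θ - 1` with `k ≥ 1`, `θ ∈ {0, 1}`, and `1 - θ - k ≤ i ≤ k - 1`. -/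
def IsSlot (i p : ℤ) : Prop :=
  ∃ k θ : ℤ, 1 ≤ k ∧ (θ = 0 ∨ θ = 1) ∧ p = 2 * k + θ - 1 ∧ 1 - θ - k ≤ i ∧ i ≤ k - 1

/-- `x ∈ ℤ₊` for a polynomial `x ∈ ℂ[h]`. -/
def IsNonnegInt (x : ℂ[X]) : Prop := ∃ n : ℕ, x = (n : ℂ[X])

/-- The array `m i p = M_{i,p}` is a `C`-pattern with signature `M`. Entries at places `(i, p)` that
are not positions of the pattern carry no information and are set to `0`. -/
structure IsCPattern (M : ℤ → ℂ[X]) (m : ℤ → ℤ → ℂ[X]) : Prop where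
  off_slot : ∀ i p, ¬ IsSlot i p → m i p = 0
  stable : ∃ N : ℤ, 1 < N ∧ ∀ i p, IsSlot i p → N ≤ p → m i p = M i
  between : ∀ k θ i : ℤ, 1 ≤ k → (θ = 0 ∨ θ = 1) → 1 - θ - k ≤ i → i ≤ k - 1 →
    IsNonnegInt (m (i + θ - 1) (2 * k + θ) - m i (2 * k + θ - 1)) ∧
    IsNonnegInt (m i (2 * k + θ - 1) - m (i + θ) (2 * k + θ))

/-- `Γ({M})`, the set of `C`-patterns with signature `M`. -/
def CPattern (M : ℤ → ℂ[X]) : Type := {m : ℤ → ℤ → ℂ[X] // IsCPattern M m}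

/-- The array obtained by the replacement `M_{j,p} → M_{j,p} + d`. -/
def shift (m : ℤ → ℤ → ℂ[X]) (j p d : ℤ) : ℤ → ℤ → ℂ[X] :=
  fun i r => if i = j ∧ r = p then m i r + (d : ℂ[X]) else m i r

/-- `L_{i,p} = M_{i,p} - i`. -/
def L (m : ℤ → ℤ → ℂ[X]) (i p : ℤ) : ℂ[X] := m i p - (i : ℂ[X])

/-- The `q`-number `[x]` of a polynomial `x ∈ ℂ[h]`. -/
def br (x : ℂ[X]) : ℂ⟦X⟧ := bracket (x : ℂ⟦X⟧)

/-! ### The topologically free module -/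

/-- The ideal `(h)` of `ℂ[[h]]`. -/
abbrev hIdeal : Ideal ℂ⟦X⟧ := Ideal.span {hh}

/-- The free `ℂ[[h]]`-module on the `C`-patterns. -/
abbrev VHat (M : ℤ → ℂ[X]) : Type := CPattern M →₀ ℂ⟦X⟧

/-- Its completion in the `h`-adic topology. -/
abbrev V (M : ℤ → ℂ[X]) : Type := AdicCompletion hIdeal (VHat M)

/-- The `ℂ[[h]]`-linear endomorphisms of the completed module. -/
abbrev EndV (M : ℤ → ℂ[X]) : Type := Module.End ℂ⟦X⟧ (V M)

instance instCompleteV (M : ℤ → ℂ[X]) : IsAdicComplete hIdeal (V M) :=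
  AdicCompletion.isAdicComplete (I := hIdeal) (M := VHat M) ⟨{hh}, by simp⟩

/-- The continuous endomorphism of the completed module determined by its values on the basis. -/
def extend (M : ℤ → ℂ[X]) (T : CPattern M → VHat M) : EndV M :=
  (AdicCompletion.map hIdeal (Finsupp.linearCombination ℂ⟦X⟧ T)).restrictScalars ℂ⟦X⟧

open Classical in
/-- `a • |m)` if the array `m` is a `C`-pattern; otherwise the term is deleted. -/
def term (M : ℤ → ℂ[X]) (a : ℂ⟦X⟧) (m : ℤ → ℤ → ℂ[X]) : VHat M :=
  if H : IsCPattern M m then Finsupp.single ⟨m, H⟩ a else 0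

/-! ### Convergent series of endomorphisms, and the `q`-number of an endomorphism -/

theorem opSeries_compat {W : Type*} [AddCommGroup W] [Module ℂ⟦X⟧ W]
    (c : ℕ → ℂ⟦X⟧) (hc : ∀ n, hh ^ n ∣ c (n + 1)) (a : Module.End ℂ⟦X⟧ W) {m n : ℕ} (hle : m ≤ n) :
    Submodule.factorPow hIdeal W hle ∘ₗ
      ((hIdeal ^ n • ⊤ : Submodule ℂ⟦X⟧ W).mkQ ∘ₗ ∑ k ∈ Finset.range (n + 1), c k • a ^ k) =
      (hIdeal ^ m • ⊤ : Submodule ℂ⟦X⟧ W).mkQ ∘ₗ ∑ k ∈ Finset.range (m + 1), c k • a ^ k := by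
  ext w
  simp only [LinearMap.comp_apply, Submodule.mkQ_apply]
  rw [← Finset.sum_range_add_sum_Ico _ (Nat.succ_le_succ hle), LinearMap.add_apply]
  change Submodule.Quotient.mk _ = Submodule.Quotient.mk _
  rw [Submodule.Quotient.eq, LinearMap.id_apply, add_sub_cancel_left, LinearMap.sum_apply]
  refine Submodule.sum_mem _ fun k hk => ?_
  obtain ⟨j, rfl⟩ : ∃ j, k = j + 1 := ⟨k - 1, by have := (Finset.mem_Ico.mp hk).1; omega⟩
  rw [LinearMap.smul_apply]
  refine Submodule.smul_mem_smul ?_ trivial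
  rw [Ideal.span_singleton_pow, Ideal.mem_span_singleton]
  exact (pow_dvd_pow _ (by have := (Finset.mem_Ico.mp hk).1; omega)).trans (hc j)

/-- The `h`-adically convergent series `∑ₙ cₙ aⁿ` in the endomorphisms of a complete module, where
`h ^ n` divides `c (n + 1)`. -/
def opSeries {W : Type*} [AddCommGroup W] [Module ℂ⟦X⟧ W] [IsAdicComplete hIdeal W]
    (c : ℕ → ℂ⟦X⟧) (hc : ∀ n, hh ^ n ∣ c (n + 1)) (a : Module.End ℂ⟦X⟧ W) : Module.End ℂ⟦X⟧ W :=
  IsAdicComplete.lift hIdeal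
    (fun n => (hIdeal ^ n • ⊤ : Submodule ℂ⟦X⟧ W).mkQ ∘ₗ ∑ k ∈ Finset.range (n + 1), c k • a ^ k)
    (fun hle => opSeries_compat c hc a hle)

/-- The coefficient `(h/2)ⁿ / n!` of `xⁿ` in `q ^ x = exp (h x / 2)`. -/
def expCoeff (n : ℕ) : ℂ⟦X⟧ := PowerSeries.C ((1 / 2 : ℂ) ^ n / (n.factorial : ℂ)) * hh ^ n

/-- The coefficient of `xⁿ` in `[x] = (q ^ x - q ^ (-x)) / (q - q⁻¹)`. -/
def bracketCoeff (n : ℕ) : ℂ⟦X⟧ := divH (expCoeff n - (-1) ^ n * expCoeff n) * qUnit⁻¹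

theorem expCoeff_dvd (n : ℕ) : hh ^ n ∣ expCoeff (n + 1) :=
  (pow_dvd_pow _ (Nat.le_succ n)).trans (Dvd.intro_left _ rfl)

theorem bracketCoeff_mul (n : ℕ) :
    bracketCoeff n * (qPow 1 - qPow (-1)) = expCoeff n - (-1) ^ n * expCoeff n := by
  have hu : qUnit⁻¹ * qUnit = 1 :=
    PowerSeries.inv_mul_cancel _ (by rw [constantCoeff_qUnit]; exact one_ne_zero)
  have h0 : PowerSeries.constantCoeff (expCoeff n - (-1) ^ n * expCoeff n) = 0 := by
    cases n <;> simp [expCoeff]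
  have h1 := hh_mul_divH _ h0
  rw [← hh_mul_qUnit, bracketCoeff]
  linear_combination (hh * divH (expCoeff n - (-1) ^ n * expCoeff n)) * hu + h1

theorem bracketCoeff_dvd (n : ℕ) : hh ^ n ∣ bracketCoeff (n + 1) := by
  have h1 : hh * bracketCoeff (n + 1) =
      (expCoeff (n + 1) - (-1) ^ (n + 1) * expCoeff (n + 1)) * qUnit⁻¹ := by
    rw [bracketCoeff, ← mul_assoc, hh_mul_divH _ (by simp [expCoeff])]
  have h2 : hh * hh ^ n ∣ hh * bracketCoeff (n + 1) := by
    rw [h1, ← pow_succ']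
    have h3 : hh ^ (n + 1) ∣ expCoeff (n + 1) := Dvd.intro_left _ rfl
    exact ((h3.sub (h3.mul_left _))).mul_right _
  exact (mul_dvd_mul_iff_left PowerSeries.X_ne_zero).mp h2

/-- `q ^ a = exp (h a / 2)` for an endomorphism `a` of a complete module. -/
def qPowOp {W : Type*} [AddCommGroup W] [Module ℂ⟦X⟧ W] [IsAdicComplete hIdeal W]
    (a : Module.End ℂ⟦X⟧ W) : Module.End ℂ⟦X⟧ W := opSeries expCoeff expCoeff_dvd a

/-- The `q`-number `[a] = (q ^ a - q ^ (-a)) / (q - q⁻¹)` of an endomorphism `a` of a complete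
module, as a convergent power series in `a` (see `bracketOp_smul` below). -/
def bracketOp {W : Type*} [AddCommGroup W] [Module ℂ⟦X⟧ W] [IsAdicComplete hIdeal W]
    (a : Module.End ℂ⟦X⟧ W) : Module.End ℂ⟦X⟧ W := opSeries bracketCoeff bracketCoeff_dvd a

/-- `(q - q⁻¹) [a] = q ^ a - q ^ (-a)`. -/
theorem bracketOp_smul {W : Type*} [AddCommGroup W] [Module ℂ⟦X⟧ W] [IsAdicComplete hIdeal W]
    (a : Module.End ℂ⟦X⟧ W) :
    (qPow 1 - qPow (-1)) • bracketOp a = qPowOp a - qPowOp (-a) := by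
  ext w
  rw [← sub_eq_zero]
  refine IsHausdorff.haus (I := hIdeal) inferInstance _ fun n => ?_
  rw [SModEq.zero, ← Submodule.Quotient.mk_eq_zero]
  simp only [LinearMap.smul_apply, LinearMap.sub_apply, Submodule.Quotient.mk_sub,
    Submodule.Quotient.mk_smul, bracketOp, qPowOp, opSeries, IsAdicComplete.mk_lift]
  simp only [LinearMap.comp_apply, Submodule.mkQ_apply, ← Submodule.Quotient.mk_sub,
    ← Submodule.Quotient.mk_smul]
  rw [Submodule.Quotient.mk_eq_zero]
  convert Submodule.zero_mem _
  simp only [LinearMap.sum_apply, LinearMap.smul_apply, Finset.smul_sum, ← Finset.sum_sub_distrib]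
  refine Finset.sum_eq_zero fun k _ => ?_
  have h1 : ((-a) ^ k) w = ((-1 : ℂ⟦X⟧) ^ k) • (a ^ k) w := by
    rw [neg_pow]
    rcases Nat.even_or_odd k with hk | hk <;> simp [hk.neg_one_pow]
  rw [h1, smul_smul, smul_smul, mul_comm, bracketCoeff_mul, sub_smul, mul_comm]
  abel

/-! ### The endomorphisms `ρ(e_i)`, `ρ(f_i)`, `ρ(h_i)`, `ρ(c)` -/

/-- `S(j, l; ν)`. -/
def S (j l : ℤ) (ν : ℕ) : ℂ⟦X⟧ := if j = l then (-1) ^ ν else if j < l then 1 else -1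

/-- `θ(i) = 1` for `i ≥ 0` and `θ(i) = 0` for `i < 0`. -/
def theta (i : ℤ) : ℤ := if 0 ≤ i then 1 else 0

/-- The radicand of the action of `e_{-1}` (`μ = 0`) and `f_{-1}` (`μ = 1`). -/
def radicand₀ (m : ℤ → ℤ → ℂ[X]) (μ : ℕ) : ℂ⟦X⟧ :=
  br (L m (-1) 2 - L m 0 1 - (μ : ℂ[X])) * br (L m 0 1 - L m 0 2 + (μ : ℂ[X]))

/-- The pattern occurring in the action of `e_{-1}` (`μ = 0`) and `f_{-1}` (`μ = 1`). -/
def target₀ (m : ℤ → ℤ → ℂ[X]) (μ : ℕ) : ℤ → ℤ → ℂ[X] := shift m 0 1 (-(-1) ^ μ)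

/-- The action of `e_{-1}` (`μ = 0`) and `f_{-1}` (`μ = 1`) on a `C`-pattern. -/
def act₀ (M : ℤ → ℂ[X]) (μ : ℕ) (m : CPattern M) : VHat M :=
  term M (sqrtSeries (radicand₀ m.1 μ)) (target₀ m.1 μ)

/-- The product of the two denominators in the `(j, l)` term of the action of the generator with
index `(-1) ^ ν * i - 1`. -/
def denom (m : ℤ → ℤ → ℂ[X]) (μ ν : ℕ) (i j l : ℤ) : ℂ⟦X⟧ :=
  (∏ k ∈ (Finset.Icc (1 - i - ν) (i - 1)).erase j,
    br (L m k (2 * i + ν - 1) - L m j (2 * i + ν - 1)) *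
    br (L m k (2 * i + ν - 1) - L m j (2 * i + ν - 1) + (-1) ^ (μ + ν))) *
  (∏ k ∈ (Finset.Icc (-i) (i + ν - 1)).erase l,
    br (L m k (2 * i + ν) - L m l (2 * i + ν)) *
    br (L m k (2 * i + ν) - L m l (2 * i + ν) + (-1) ^ (μ + ν)))

/-- The product of the two numerators in the `(j, l)` term of the action of the generator with
index `(-1) ^ ν * i - 1`. -/
def numer (m : ℤ → ℤ → ℂ[X]) (μ ν : ℕ) (i j l : ℤ) : ℂ⟦X⟧ :=
  ((∏ k ∈ (Finset.Icc (-i) (i + ν - 1)).erase l,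
      br (L m k (2 * i + ν) - L m j (2 * i + ν - 1) - (-1) ^ ν * (μ : ℂ[X]))) *
    (∏ k ∈ Finset.Icc (1 - i) (i + ν - 2),
      br (L m k (2 * i + ν - 2) - L m j (2 * i + ν - 1) - (-1) ^ ν * (μ : ℂ[X])))) *
  ((∏ k ∈ Finset.Icc (-i - ν) i,
      br (L m k (2 * i + ν + 1) - L m l (2 * i + ν) + (-1) ^ ν * (1 - (μ : ℂ[X])))) *
    (∏ k ∈ (Finset.Icc (1 - i - ν) (i - 1)).erase j,
      br (L m k (2 * i + ν - 1) - L m l (2 * i + ν) + (-1) ^ ν * (1 - (μ : ℂ[X])))))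

/-- The radicand of the `(j, l)` term. -/
def radicand (m : ℤ → ℤ → ℂ[X]) (μ ν : ℕ) (i j l : ℤ) : ℂ⟦X⟧ :=
  -(numer m μ ν i j l * (denom m μ ν i j l)⁻¹)

/-- The pattern in the `(j, l)` term. -/
def target (m : ℤ → ℤ → ℂ[X]) (μ ν : ℕ) (i j l : ℤ) : ℤ → ℤ → ℂ[X] :=
  shift (shift m j (2 * i - 1 + ν) (-(-1) ^ (μ + ν))) l (2 * i + ν) (-(-1) ^ (μ + ν))

/-- The action of `e_n` (`μ = 1`) and `f_n` (`μ = 0`), where `n = (-1) ^ ν * i - 1` with `i ≥ 1` and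
`ν ∈ {0, 1}`, on a `C`-pattern. -/
def act (M : ℤ → ℂ[X]) (μ ν : ℕ) (i : ℤ) (m : CPattern M) : VHat M :=
  -∑ j ∈ Finset.Icc (1 - i - ν) (i - 1), ∑ l ∈ Finset.Icc (-i) (i + ν - 1),
    term M (S j l ν * sqrtSeries (radicand m.1 μ ν i j l)) (target m.1 μ ν i j l)

/-- `ρ(e_n)` for `μ = 1` and `ρ(f_n)` for `μ = 0`. -/
def rhoGen (M : ℤ → ℂ[X]) (μ : ℕ) (n : ℤ) : EndV M :=
  if n = -1 then extend M (act₀ M (1 - μ))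
  else if 0 ≤ n then extend M (act M μ 0 (n + 1))
  else extend M (act M μ 1 (-n - 1))

/-- `ρ(e_n)`. -/
def rhoE (M : ℤ → ℂ[X]) (n : ℤ) : EndV M := rhoGen M 1 n

/-- `ρ(f_n)`. -/
def rhoF (M : ℤ → ℂ[X]) (n : ℤ) : EndV M := rhoGen M 0 n

/-- The eigenvalue of `ρ(h_i)` on a `C`-pattern. -/
def weight (ξ₀ ξ₁ : ℂ[X]) (m : ℤ → ℤ → ℂ[X]) (i : ℤ) : ℂ[X] :=
  ∑ j ∈ Finset.Icc (-|i|) (|i| + theta i - 1), m j (2 * |i| + theta i) -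
  ∑ j ∈ Finset.Icc (-|i| + 1 - theta i) (|i| - 1), m j (2 * |i| + theta i - 1) +
  (ξ₁ - ξ₀) * (theta (-i) : ℂ[X]) - ξ₁

/-- `ρ(h_i)`. -/
def rhoH (M : ℤ → ℂ[X]) (ξ₀ ξ₁ : ℂ[X]) (i : ℤ) : EndV M :=
  extend M fun m => Finsupp.single m ((weight ξ₀ ξ₁ m.1 i : ℂ[X]) : ℂ⟦X⟧)

/-- `ρ(c)`. -/
def rhoC (M : ℤ → ℂ[X]) (ξ₀ ξ₁ : ℂ[X]) : EndV M :=
  extend M fun m => Finsupp.single m ((ξ₀ - ξ₁ : ℂ[X]) : ℂ⟦X⟧)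

/-- The coefficients of the action are well defined in `ℂ[[h]]`: for each term that is not deleted,
the denominators are invertible and the radicand has a square root with positive constant term. -/
def CoefficientsWellDefined (M : ℤ → ℂ[X]) : Prop :=
  ∀ m : CPattern M, ∀ μ ∈ ({0, 1} : Set ℕ),
    (IsCPattern M (target₀ m.1 μ) → ∃ g, IsPosSqrt (radicand₀ m.1 μ) g) ∧
    ∀ ν ∈ ({0, 1} : Set ℕ), ∀ i : ℤ, 1 ≤ i →
      ∀ j ∈ Finset.Icc (1 - i - ν) (i - 1), ∀ l ∈ Finset.Icc (-i) (i + ν - 1),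
        IsCPattern M (target m.1 μ ν i j l) →
          IsUnit (denom m.1 μ ν i j l) ∧ ∃ g, IsPosSqrt (radicand m.1 μ ν i j l) g

/-- The Cartan relations for a family of endomorphisms of a complete `ℂ[[h]]`-module; the bracket
`⁅x, y⁆` is the commutator `x y - y x`. -/
structure CartanRelations {W : Type*} [AddCommGroup W] [Module ℂ⟦X⟧ W] [IsAdicComplete hIdeal W]
    (e f h : ℤ → Module.End ℂ⟦X⟧ W) (c : Module.End ℂ⟦X⟧ W) : Prop where
  c_h : ∀ i, ⁅c, h i⁆ = 0
  c_e : ∀ i, ⁅c, e i⁆ = 0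
  c_f : ∀ i, ⁅c, f i⁆ = 0
  h_h : ∀ i j, ⁅h i, h j⁆ = 0
  h_e : ∀ i j, ⁅h i, e j⁆ - ((if i = j then 1 else 0) - (if i = j + 1 then 1 else 0) : ℤ) • e j = 0
  h_f : ∀ i j, ⁅h i, f j⁆ + ((if i = j then 1 else 0) - (if i = j + 1 then 1 else 0) : ℤ) • f j = 0
  e_f_same : ∀ i, ⁅e i, f i⁆ - bracketOp (h i - h (i + 1) + (theta (-i) - theta (-i - 1)) • c) = 0
  e_f_ne : ∀ i j, i ≠ j → ⁅e i, f j⁆ = 0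

/-- The Serre relations for a sequence `e` of endomorphisms of a `ℂ[[h]]`-module. -/
structure SerreRelations {W : Type*} [AddCommGroup W] [Module ℂ⟦X⟧ W]
    (e : ℤ → Module.End ℂ⟦X⟧ W) : Prop where
  comm : ∀ i j, |i - j| ≠ 1 → ⁅e i, e j⁆ = 0
  serre : ∀ i, e i ^ 2 * e (i + 1) - (qPow 1 + qPow (-1)) • (e i * e (i + 1) * e i) +
    e (i + 1) * e i ^ 2 = 0
  serre' : ∀ i, e (i + 1) ^ 2 * e i - (qPow 1 + qPow (-1)) • (e (i + 1) * e i * e (i + 1)) +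
    e i * e (i + 1) ^ 2 = 0

end UhAInf

end

/-! The proof transports the relations to a space where they have no square roots, proves them there
for the generators of a one-sided chain, and builds the two-sided algebra out of `q`-commutators.

Arrays. Row `p` of a `C`-pattern has `p` entries, all differing from `M 0` by integers. After
recentring the columns and subtracting the place in the row, a pattern becomes an integer array
whose rows decrease strictly and interlace (`IsPre.isCPattern_iff`), that is, a Gelfand–Tsetlin
array with infinitely many rows.

One-sided chain. Over the fraction field `FracK`, let `moveOp` move one entry of a row, with the
rational Gelfand–Tsetlin coefficient `raw`: the product of brackets to all entries of a neighbouring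
row, divided by the product of brackets to the other entries of the same row. Raising the entries of
row `n + 1` is measured against row `n + 2`, lowering them against row `n`. These operators satisfy
the relations of type `A` on the nodes `0, 1, 2, …` (`isSystem`). Each relation is checked on the
paths between two interlaced arrays. If such a path passes through an array that is not interlaced,
then two entries coincide and some `raw` on the path vanishes, so deleting illegal arrays costs
nothing. What remains are identities between a few `q`-numbers for the Serre relations
(`serrePoly_moveOp`, `serrePoly_moveOp'`) and a partial fraction identity for `[e, f]`
(`sum_prodDiff_sub_eq_qInt`).

Folding. The line `ℤ` is folded onto the half-line: `n ≥ 0` goes to the place `2n + 1` and `n < 0`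
to `-2n - 2`, with `e` and `f` exchanged on the negative side. At place `p ≥ 1` stands the
`q`-commutator of the generators `p - 1` and `p`, with parameter `q` or `q⁻¹` according to parity,
and at place `0` the generator `0` twisted by a power of `q`. The alternation makes places of
different parity commute, except for opposite directions at the places `0` and `1`. These
exceptional pairs, and places at distance two in the same direction, satisfy the Serre relations.
All this is formal in an associative algebra (`IsSystem`).

Square roots. The matrix coefficient of a `q`-commutator of two adjacent moves is a single product
times a power of `q` (`qComm_moveOp_single`). A diagonal change of basis removes the power of `q`
(`qGauge`), and a product of quantum gamma values (`gauge`) makes raising and lowering transposes of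
each other. Then each coefficient squared is the radicand of the given action, and positivity of
constant terms fixes the sign (`norm_mul_raise`, `norm_mul_lower`). The change of basis is a product
over rows, so it is cut off at a row `P`; an operator that touches finitely many rows does not
notice a large `P` (`Corresponds`).

Descent. The comparison map `phi` is injective, so the identities hold on the free `ℂ[[h]]`-module,
and the algebra homomorphism `complete` carries them to the completion. The Cartan part is diagonal,
where `[a]` acts through the brackets of the eigenvalues (`bracketOp_complete`). -/

namespace UhAInf

/-! ### Quantum Serre relations and `q`-commutators in an associative algebra -/

section Algebra

set_option linter.unusedSimpArgs false

variable {K A : Type*} [Field K] [Ring A] [Algebra K A]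

/-- The `t`-commutator `ab - t ba`. -/
def qComm (t : K) (a b : A) : A := a * b - t • (b * a)

/-- The quantum Serre polynomial `a²b - s aba + ba²`. -/
def serrePoly (s : K) (a b : A) : A := a ^ 2 * b - s • (a * b * a) + b * a ^ 2

theorem qComm_flip {t : K} (ht : t ≠ 0) (a b : A) : qComm t a b = (-t) • qComm t⁻¹ b a := by
  simp only [qComm, smul_sub, smul_smul]
  match_scalars <;> field_simp

theorem commute_qComm {x a b : A} (t : K) (ha : Commute x a) (hb : Commute x b) :
    Commute x (qComm t a b) :=
  ((ha.mul_right hb).sub_right ((hb.mul_right ha).smul_right t))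

theorem serrePoly_smul_smul (s u v : K) (a b : A) :
    serrePoly s (u • a) (v • b) = (u ^ 2 * v) • serrePoly s a b := by
  simp only [serrePoly, smul_pow, smul_mul_assoc, mul_smul_comm, smul_smul, smul_add, smul_sub]
  module

/-- Since `c` commutes with `a`, taking the `t`-commutator with `c` passes through the
multiplications by `a`, hence through the whole Serre polynomial. -/
theorem serrePoly_qComm_right (s t : K) {a b c : A} (hc : Commute a c)
    (h : serrePoly s a b = 0) : serrePoly s a (qComm t b c) = 0 := by
  have hc' : a * c = c * a := hc
  have e : serrePoly s a (qComm t b c) = qComm t (serrePoly s a b) c := by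
    rw [← sub_eq_zero]
    unfold serrePoly qComm
    linear_combination (norm := skip) s • (a * b * hc') - b * a * hc' - b * hc' * a
      - t • (hc' * a * b) - t • (a * hc' * b) + (t * s) • (hc' * b * a)
    simp only [mul_add, add_mul, mul_sub, sub_mul, mul_neg, neg_mul, smul_add, smul_sub, smul_neg,
    smul_mul_assoc, mul_smul_comm, smul_smul, mul_assoc, pow_two, zero_mul, mul_zero, smul_zero]
    module
  rw [e, h]; simp [qComm]

/-- For a path `a – b – c` the two Serre relations at the middle node `b` give the commutation. The
inverse parameters matter: the terms `bacb` and `bcab` of the commutator then have opposite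
coefficients and cancel. -/
theorem commute_qComm_qComm {t : K} (ht : t ≠ 0) (hs : t + t⁻¹ ≠ 0) {a b c : A}
    (hac : Commute a c) (h1 : serrePoly (t + t⁻¹) b a = 0) (h2 : serrePoly (t + t⁻¹) b c = 0) :
    Commute (qComm t a b) (qComm t⁻¹ b c) := by
  have hac' : a * c = c * a := hac
  unfold serrePoly at h1 h2
  -- The terms with `b²` inside or outside cancel between the Serre relations multiplied by `a` and
  -- by `c`, leaving a multiple of `t + t⁻¹`, which must be invertible.
  have key : (t + t⁻¹) • (a * b * c * b - b * a * b * c + b * c * b * a - c * b * a * b) = 0 := by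
    linear_combination (norm := skip) (-(a * h2) + h1 * c - h2 * a + c * h1)
      - b * b * hac' + hac' * b * b
    simp only [mul_add, add_mul, mul_sub, sub_mul, mul_neg, neg_mul, smul_add, smul_sub, smul_neg,
    smul_mul_assoc, mul_smul_comm, smul_smul, mul_assoc, pow_two, zero_mul, mul_zero, smul_zero]
    module
  have key' := (smul_eq_zero.mp key).resolve_left hs
  unfold qComm
  show _ * _ = _ * _
  linear_combination (norm := skip) t • key' + a * h2 - c * h1
     + b * hac' * b - hac' * b * b
  simp only [mul_add, add_mul, mul_sub, sub_mul, mul_neg, neg_mul, smul_add, smul_sub, smul_neg,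
    smul_mul_assoc, mul_smul_comm, smul_smul, mul_assoc, pow_two, zero_mul, mul_zero, smul_zero]
  match_scalars <;> field_simp <;> ring

/-- The Serre polynomial of `a, b` factors as `a x - t⁻¹ x a` with `x = qComm t a b`. -/
theorem mul_qComm_left {t : K} (ht : t ≠ 0) {a b : A} (h : serrePoly (t + t⁻¹) a b = 0) :
    a * qComm t a b = t⁻¹ • (qComm t a b * a) := by
  unfold serrePoly at h
  unfold qComm
  linear_combination (norm := skip) h
  simp only [mul_add, add_mul, mul_sub, sub_mul, mul_neg, neg_mul, smul_add, smul_sub, smul_neg,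
    smul_mul_assoc, mul_smul_comm, smul_smul, mul_assoc, pow_two, zero_mul, mul_zero, smul_zero]
  match_scalars <;> field_simp <;> ring

/-- With `x = [a, b]` and `w = [b, c]`, both `[x, c]` and `[a, w]` are the same iterated commutator
`y`. As `x` commutes with `w` and `t`-commutes with `a`, it satisfies `x y = t y x`, and this is the
Serre relation of `x` and `c` in factored form. -/
theorem serrePoly_qComm_left {t : K} (ht : t ≠ 0) (hs : t + t⁻¹ ≠ 0) {a b c : A}
    (hac : Commute a c) (h1 : serrePoly (t + t⁻¹) b a = 0) (h2 : serrePoly (t + t⁻¹) b c = 0)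
    (h3 : serrePoly (t + t⁻¹) a b = 0) : serrePoly (t + t⁻¹) (qComm t a b) c = 0 := by
  have hac' : a * c = c * a := hac
  have e1 : _ * _ = _ * _ := commute_qComm_qComm ht hs hac h1 h2
  have e2 := mul_qComm_left ht h3
  set x := qComm t a b with hx
  set w := qComm t⁻¹ b c with hw
  have e3 : x * c - t⁻¹ • (c * x) = a * w - t • (w * a) := by
    simp only [hx, hw, qComm]
    linear_combination (norm := skip) (-t) • (b * hac') + t⁻¹ • (hac' * b)
    simp only [mul_add, add_mul, mul_sub, sub_mul, mul_neg, neg_mul, smul_add, smul_sub, smul_neg,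
    smul_mul_assoc, mul_smul_comm, smul_smul, mul_assoc, pow_two, zero_mul, mul_zero, smul_zero]
    match_scalars <;> field_simp <;> ring
  have e4 : x * (a * w - t • (w * a)) = t • ((a * w - t • (w * a)) * x) := by
    linear_combination (norm := skip) (-t) • (e2 * w) + t • (a * e1) - t • (e1 * a)
      + (t * t) • (w * e2)
    simp only [mul_add, add_mul, mul_sub, sub_mul, mul_neg, neg_mul, smul_add, smul_sub, smul_neg,
    smul_mul_assoc, mul_smul_comm, smul_smul, mul_assoc, pow_two, zero_mul, mul_zero, smul_zero]
    match_scalars <;> field_simp <;> ring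
  rw [← e3] at e4
  unfold serrePoly
  linear_combination (norm := skip) e4
  simp only [mul_add, add_mul, mul_sub, sub_mul, mul_neg, neg_mul, smul_add, smul_sub, smul_neg,
    smul_mul_assoc, mul_smul_comm, smul_smul, mul_assoc, pow_two, zero_mul, mul_zero, smul_zero]
  match_scalars <;> field_simp <;> ring

/-- The relations of a rank one triple `e, f, k, k'` with `(t - t⁻¹) [e, f] = k - k'`. -/
structure IsTriple (t : K) (e f k k' : A) : Prop where
  ef : (t - t⁻¹) • (e * f - f * e) = k - k'
  ke : k * e = t ^ 2 • (e * k)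
  kf : k * f = (t ^ 2)⁻¹ • (f * k)
  ke' : k' * e = (t ^ 2)⁻¹ • (e * k')
  kf' : k' * f = t ^ 2 • (f * k')

theorem IsTriple.swap {t : K} {e f k k' : A} (h : IsTriple t e f k k') :
    IsTriple t f e k' k where
  ef := by
    rw [← neg_sub (e * f), smul_neg, h.ef, neg_sub]
  ke := h.kf'
  kf := h.ke'
  ke' := h.kf
  kf' := h.ke

/-- Inverting `t` changes the sign of `t - t⁻¹` and so exchanges `k` and `k'`. Places of the chain
whose `q`-commutator has parameter `q⁻¹` thereby reuse the computations for `q`. -/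
theorem IsTriple.inv {t : K} {e f k k' : A} (h : IsTriple t e f k k') :
    IsTriple t⁻¹ e f k' k where
  ef := by
    rw [inv_inv, ← neg_sub t, neg_smul, h.ef, neg_sub]
  ke := by rw [h.ke', inv_pow]
  kf := by rw [h.kf', inv_pow, inv_inv]
  ke' := by rw [h.ke, inv_pow, inv_inv]
  kf' := by rw [h.kf, inv_pow]

/-- The interaction of two adjacent triples. -/
structure IsLink (t : K) (e₁ f₁ k₁ k₁' e₂ f₂ : A) : Prop where
  ef : Commute e₁ f₂
  fe : Commute f₁ e₂
  ke : k₁ * e₂ = t⁻¹ • (e₂ * k₁)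
  kf : k₁ * f₂ = t • (f₂ * k₁)
  ke' : k₁' * e₂ = t • (e₂ * k₁')
  kf' : k₁' * f₂ = t⁻¹ • (f₂ * k₁')

theorem IsLink.swap {t : K} {e₁ f₁ k₁ k₁' e₂ f₂ : A} (h : IsLink t e₁ f₁ k₁ k₁' e₂ f₂) :
    IsLink t f₁ e₁ k₁' k₁ f₂ e₂ :=
  ⟨h.fe, h.ef, h.kf', h.ke', h.kf, h.ke⟩

theorem IsLink.inv {t : K} {e₁ f₁ k₁ k₁' e₂ f₂ : A} (h : IsLink t e₁ f₁ k₁ k₁' e₂ f₂) :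
    IsLink t⁻¹ e₁ f₁ k₁' k₁ e₂ f₂ :=
  ⟨h.ef, h.fe, by rw [h.ke', inv_inv], h.kf', by rw [h.ke], by rw [h.kf, inv_inv]⟩

variable {t : K} {e₁ f₁ k₁ k₁' e₂ f₂ k₂ k₂' e₃ f₃ k₃ k₃' : A}

/-- As `f₁` commutes with `e₂`, this is the `t`-commutator of `[e₁, f₁]` with `e₂`. The parameter
`t` is exactly the one for which the `k₁'` part cancels. -/
theorem qComm_mul_left_sub (ht : t ≠ 0) (htt : t - t⁻¹ ≠ 0) (h₁ : IsTriple t e₁ f₁ k₁ k₁')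
    (h₁₂ : IsLink t e₁ f₁ k₁ k₁' e₂ f₂) :
    qComm t e₁ e₂ * f₁ - f₁ * qComm t e₁ e₂ = -(e₂ * k₁) := by
  have a := h₁₂.fe.eq
  unfold qComm
  have h := h₁.ef
  have e : (t - t⁻¹) • ((e₁ * e₂ - t • (e₂ * e₁)) * f₁ - f₁ * (e₁ * e₂ - t • (e₂ * e₁)))
      = (t - t⁻¹) • (-(e₂ * k₁)) := by
    linear_combination (norm := skip) (h * e₂ - t • (e₂ * h)
      - (t - t⁻¹) • (e₁ * a) + (t * (t - t⁻¹)) • (a * e₁) + h₁₂.ke - h₁₂.ke')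
    simp only [mul_add, add_mul, mul_sub, sub_mul, mul_neg, neg_mul, smul_add, smul_sub, smul_neg,
    smul_mul_assoc, mul_smul_comm, smul_smul, mul_assoc, pow_two, zero_mul, mul_zero, smul_zero]
    match_scalars <;> field_simp <;> ring
  exact smul_right_injective A htt e

/-- The mirror image of `qComm_mul_left_sub`: this time the `k₂` part cancels and `k₂'` survives. -/
theorem qComm_mul_right_sub (ht : t ≠ 0) (htt : t - t⁻¹ ≠ 0) (h₂ : IsTriple t e₂ f₂ k₂ k₂')
    (h₁₂ : IsLink t e₁ f₁ k₁ k₁' e₂ f₂) (h₂₁ : IsLink t e₂ f₂ k₂ k₂' e₁ f₁) :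
    qComm t e₁ e₂ * f₂ - f₂ * qComm t e₁ e₂ = t • (e₁ * k₂') := by
  have a := h₁₂.ef.eq
  unfold qComm
  have h := h₂.ef
  have e : (t - t⁻¹) • ((e₁ * e₂ - t • (e₂ * e₁)) * f₂ - f₂ * (e₁ * e₂ - t • (e₂ * e₁)))
      = (t - t⁻¹) • (t • (e₁ * k₂')) := by
    linear_combination (norm := skip) (e₁ * h - t • (h * e₁)
      - (t * (t - t⁻¹)) • (e₂ * a) + (t - t⁻¹) • (a * e₂) - t • h₂₁.ke + t • h₂₁.ke')
    simp only [mul_add, add_mul, mul_sub, sub_mul, mul_neg, neg_mul, smul_add, smul_sub, smul_neg,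
    smul_mul_assoc, mul_smul_comm, smul_smul, mul_assoc, pow_two, zero_mul, mul_zero, smul_zero]
    match_scalars <;> field_simp <;> ring
  exact smul_right_injective A htt e

/-- The commutator with `x = [e₁, e₂]` is a derivation, known on `f₁` and `f₂`. Moving `k₁` past
`f₂` and `k₂'` past `f₁` collects the terms into `[e₂, f₂] k₁ + [e₁, f₁] k₂'`, which telescopes. The
minus sign arises because the `f` are commuted in the same order as the `e`. -/
theorem qComm_qComm_sub (ht : t ≠ 0) (htt : t - t⁻¹ ≠ 0) (h₁ : IsTriple t e₁ f₁ k₁ k₁')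
    (h₂ : IsTriple t e₂ f₂ k₂ k₂') (h₁₂ : IsLink t e₁ f₁ k₁ k₁' e₂ f₂)
    (h₂₁ : IsLink t e₂ f₂ k₂ k₂' e₁ f₁) (hk : Commute k₁ k₂) (hk' : Commute k₁ k₂') :
    (t - t⁻¹) • (qComm t e₁ e₂ * (t⁻¹ • qComm t f₁ f₂) -
      (t⁻¹ • qComm t f₁ f₂) * qComm t e₁ e₂) = -(k₁ * k₂ - k₁' * k₂') := by
  have a := qComm_mul_left_sub ht htt h₁ h₁₂
  have b := qComm_mul_right_sub ht htt h₂ h₁₂ h₂₁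
  set x := qComm t e₁ e₂
  unfold qComm
  have c1 := hk.eq
  have c2 := hk'.eq
  linear_combination (norm := skip) ((t - t⁻¹) * t⁻¹) • (a * f₂) + ((t - t⁻¹) * t⁻¹) • (f₁ * b)
    - (t - t⁻¹) • (b * f₁) - (t - t⁻¹) • (f₂ * a) - ((t - t⁻¹) * t⁻¹) • (e₂ * h₁₂.kf)
    - ((t - t⁻¹) * t) • (e₁ * h₂₁.kf') - h₂.ef * k₁ - h₁.ef * k₂' + c1 - c2
  simp only [mul_add, add_mul, mul_sub, sub_mul, mul_neg, neg_mul, smul_add, smul_sub, smul_neg,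
    smul_mul_assoc, mul_smul_comm, smul_smul, mul_assoc, pow_two, zero_mul, mul_zero, smul_zero]
  match_scalars <;> field_simp <;> ring

/-- The element `x = [e₁, e₂]` commutes with `f₃`, so only `[x, f₂] = t e₁ k₂'` has to be commuted
with `f₃`; the scalar from moving `k₂'` past `f₃` is the parameter `t⁻¹`. -/
theorem commute_qComm_qComm_mixed (ht : t ≠ 0) (htt : t - t⁻¹ ≠ 0)
    (h₂ : IsTriple t e₂ f₂ k₂ k₂') (h₁₂ : IsLink t e₁ f₁ k₁ k₁' e₂ f₂)
    (h₂₁ : IsLink t e₂ f₂ k₂ k₂' e₁ f₁) (h₂₃ : IsLink t e₂ f₂ k₂ k₂' e₃ f₃)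
    (h₁₃ : Commute e₁ f₃) : Commute (qComm t e₁ e₂) (qComm t⁻¹ f₂ f₃) := by
  have b := qComm_mul_right_sub ht htt h₂ h₁₂ h₂₁
  have c : Commute (qComm t e₁ e₂) f₃ := (commute_qComm t h₁₃.symm h₂₃.ef.symm).symm
  have c' := c.eq
  set x := qComm t e₁ e₂
  have d := h₁₃.eq
  show _ * _ = _ * _
  unfold qComm
  linear_combination (norm := skip) b * f₃ + f₂ * c' - t⁻¹ • (c' * f₂) - t⁻¹ • (f₃ * b)
    + t • (e₁ * h₂₃.kf') + d * k₂'
  simp only [mul_add, add_mul, mul_sub, sub_mul, mul_neg, neg_mul, smul_add, smul_sub, smul_neg,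
    smul_mul_assoc, mul_smul_comm, smul_smul, mul_assoc, pow_two, zero_mul, mul_zero, smul_zero]
  match_scalars <;> field_simp <;> ring

/-! ### The twisted generator at the end of the chain -/

section Boundary

variable {κ κ' : A}

/-- Pulling both twists `κ'` to the right reweights the three Serre terms by `t⁻¹`, `1`, `t`. The
reweighted cubic vanishes because `[x, f₁] = -e₂ k₁` and `k₁` only rescales `f₁`. The twist thus
turns a raising and a lowering composite into neighbours in the Serre sense. -/
theorem serrePoly_twist_qComm (ht : t ≠ 0) (htt : t - t⁻¹ ≠ 0) (h₁ : IsTriple t e₁ f₁ k₁ k₁')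
    (h₁₂ : IsLink t e₁ f₁ k₁ k₁' e₂ f₂) (a1 : κ' * e₁ = t⁻¹ • (e₁ * κ'))
    (a2 : κ' * f₁ = t • (f₁ * κ')) (a3 : Commute κ' e₂) :
    serrePoly (t + t⁻¹) (f₁ * κ') (qComm t e₁ e₂) = 0 := by
  have a := qComm_mul_left_sub ht htt h₁ h₁₂
  have a3' := a3.eq
  have ax : κ' * qComm t e₁ e₂ = t⁻¹ • (qComm t e₁ e₂ * κ') := by
    unfold qComm
    linear_combination (norm := skip) a1 * e₂ + t⁻¹ • (e₁ * a3') - t • (a3' * e₁) - t • (e₂ * a1)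
    simp only [mul_add, add_mul, mul_sub, sub_mul, mul_neg, neg_mul, smul_add, smul_sub, smul_neg,
    smul_mul_assoc, mul_smul_comm, smul_smul, mul_assoc, pow_two, zero_mul, mul_zero, smul_zero]
    match_scalars <;> field_simp <;> ring
  have kf := h₁.kf
  have fe := h₁₂.fe.eq
  set x := qComm t e₁ e₂
  have s1 : f₁ * κ' * (f₁ * κ') * x = t⁻¹ • (f₁ * f₁ * x * κ' * κ') := by
    linear_combination (norm := skip) f₁ * a2 * κ' * x + t • (f₁ * f₁ * κ' * ax)
      + f₁ * f₁ * ax * κ'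
    simp only [mul_add, add_mul, mul_sub, sub_mul, mul_neg, neg_mul, smul_add, smul_sub, smul_neg,
    smul_mul_assoc, mul_smul_comm, smul_smul, mul_assoc, pow_two, zero_mul, mul_zero, smul_zero]
    match_scalars <;> field_simp <;> ring
  have s2 : f₁ * κ' * x * (f₁ * κ') = f₁ * x * f₁ * κ' * κ' := by
    linear_combination (norm := skip) f₁ * ax * f₁ * κ' + t⁻¹ • (f₁ * x * a2 * κ')
    simp only [mul_add, add_mul, mul_sub, sub_mul, mul_neg, neg_mul, smul_add, smul_sub, smul_neg,
    smul_mul_assoc, mul_smul_comm, smul_smul, mul_assoc, pow_two, zero_mul, mul_zero, smul_zero]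
    match_scalars <;> field_simp <;> ring
  have s3 : x * (f₁ * κ' * (f₁ * κ')) = t • (x * f₁ * f₁ * κ' * κ') := by
    linear_combination (norm := skip) x * f₁ * a2 * κ'
    simp only [mul_add, add_mul, mul_sub, sub_mul, mul_neg, neg_mul, smul_add, smul_sub, smul_neg,
    smul_mul_assoc, mul_smul_comm, smul_smul, mul_assoc, pow_two, zero_mul, mul_zero, smul_zero]
    match_scalars <;> field_simp <;> ring
  have s4 : t⁻¹ • (f₁ * f₁ * x) - (t + t⁻¹) • (f₁ * x * f₁) + t • (x * f₁ * f₁) = 0 := by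
    linear_combination (norm := skip) (-t⁻¹) • (f₁ * a) + t • (a * f₁)
      - t • (e₂ * kf) + t⁻¹ • (fe * k₁)
    simp only [mul_add, add_mul, mul_sub, sub_mul, mul_neg, neg_mul, smul_add, smul_sub, smul_neg,
    smul_mul_assoc, mul_smul_comm, smul_smul, mul_assoc, pow_two, zero_mul, mul_zero, smul_zero]
    match_scalars <;> field_simp <;> ring
  unfold serrePoly
  rw [pow_two, s1, s2, s3]
  linear_combination (norm := skip) s4 * κ' * κ'
  simp only [mul_add, add_mul, mul_sub, sub_mul, mul_neg, neg_mul, smul_add, smul_sub, smul_neg,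
    smul_mul_assoc, mul_smul_comm, smul_smul, mul_assoc, pow_two, zero_mul, mul_zero, smul_zero]
  module

/-- After `κ'` is pulled out, the cubic factors through `[x, f₁] = -e₂ k₁`; the scalars by which
`k₁` and `e₂` pass `x` cancel. The Serre relation of `e₂` and `e₁` enters only as the commutation of
`e₂` past `x`. -/
theorem serrePoly_qComm_twist (ht : t ≠ 0) (htt : t - t⁻¹ ≠ 0) (h₁ : IsTriple t e₁ f₁ k₁ k₁')
    (h₁₂ : IsLink t e₁ f₁ k₁ k₁' e₂ f₂) (hs : serrePoly (t + t⁻¹) e₂ e₁ = 0)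
    (a1 : κ' * e₁ = t⁻¹ • (e₁ * κ')) (a3 : Commute κ' e₂) :
    serrePoly (t + t⁻¹) (qComm t e₁ e₂) (f₁ * κ') = 0 := by
  have a := qComm_mul_left_sub ht htt h₁ h₁₂
  have a3' := a3.eq
  have ax : κ' * qComm t e₁ e₂ = t⁻¹ • (qComm t e₁ e₂ * κ') := by
    unfold qComm
    linear_combination (norm := skip) a1 * e₂ + t⁻¹ • (e₁ * a3') - t • (a3' * e₁) - t • (e₂ * a1)
    simp only [mul_add, add_mul, mul_sub, sub_mul, mul_neg, neg_mul, smul_add, smul_sub, smul_neg,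
    smul_mul_assoc, mul_smul_comm, smul_smul, mul_assoc, pow_two, zero_mul, mul_zero, smul_zero]
    match_scalars <;> field_simp <;> ring
  have kx : k₁ * qComm t e₁ e₂ = t • (qComm t e₁ e₂ * k₁) := by
    unfold qComm
    linear_combination (norm := skip) h₁.ke * e₂ + (t ^ 2) • (e₁ * h₁₂.ke)
      - t • (h₁₂.ke * e₁) - (e₂ * h₁.ke)
    simp only [mul_add, add_mul, mul_sub, sub_mul, mul_neg, neg_mul, smul_add, smul_sub, smul_neg,
    smul_mul_assoc, mul_smul_comm, smul_smul, mul_assoc, pow_two, zero_mul, mul_zero, smul_zero]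
    match_scalars <;> field_simp <;> ring
  have ex : e₂ * qComm t e₁ e₂ = t • (qComm t e₁ e₂ * e₂) := by
    unfold serrePoly at hs
    unfold qComm
    linear_combination (norm := skip) (-t) • hs
    simp only [mul_add, add_mul, mul_sub, sub_mul, mul_neg, neg_mul, smul_add, smul_sub, smul_neg,
    smul_mul_assoc, mul_smul_comm, smul_smul, mul_assoc, pow_two, zero_mul, mul_zero, smul_zero]
    match_scalars <;> field_simp <;> ring
  set x := qComm t e₁ e₂
  have s4 : x * x * f₁ - (1 + (t ^ 2)⁻¹) • (x * f₁ * x) + (t ^ 2)⁻¹ • (f₁ * x * x) = 0 := by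
    linear_combination (norm := skip) x * a - (t ^ 2)⁻¹ • (a * x)
      + (t ^ 2)⁻¹ • (e₂ * kx) + t⁻¹ • (ex * k₁)
    simp only [mul_add, add_mul, mul_sub, sub_mul, mul_neg, neg_mul, smul_add, smul_sub, smul_neg,
    smul_mul_assoc, mul_smul_comm, smul_smul, mul_assoc, pow_two, zero_mul, mul_zero, smul_zero]
    match_scalars <;> field_simp <;> ring
  unfold serrePoly
  linear_combination (norm := skip) s4 * κ' - (t + t⁻¹) • (x * f₁ * ax) + t⁻¹ • (f₁ * x * ax)
    + f₁ * ax * x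
  simp only [mul_add, add_mul, mul_sub, sub_mul, mul_neg, neg_mul, smul_add, smul_sub, smul_neg,
    smul_mul_assoc, mul_smul_comm, smul_smul, mul_assoc, pow_two, zero_mul, mul_zero, smul_zero]
  match_scalars <;> field_simp <;> ring

/-- By the Serre relation `f₁` passes the `t`-commutator with a factor `t⁻¹`, and `κ'` passes it
with a factor `t`. Compensating this scalar is one purpose of the twist. -/
theorem commute_twist_qComm (ht : t ≠ 0) (hs : serrePoly (t + t⁻¹) f₁ f₂ = 0)
    (a2 : κ' * f₁ = t • (f₁ * κ')) (a3 : Commute κ' f₂) :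
    Commute (f₁ * κ') (qComm t f₁ f₂) := by
  have fx := mul_qComm_left ht hs
  have a3' := a3.eq
  have ax : κ' * qComm t f₁ f₂ = t • (qComm t f₁ f₂ * κ') := by
    unfold qComm
    linear_combination (norm := skip) a2 * f₂ + t • (f₁ * a3') - t • (a3' * f₁) - t • (f₂ * a2)
    simp only [mul_add, add_mul, mul_sub, sub_mul, mul_neg, neg_mul, smul_add, smul_sub, smul_neg,
    smul_mul_assoc, mul_smul_comm, smul_smul, mul_assoc, pow_two, zero_mul, mul_zero, smul_zero]
    match_scalars <;> field_simp <;> ring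
  set x := qComm t f₁ f₂
  show _ * _ = _ * _
  linear_combination (norm := skip) f₁ * ax + t • (fx * κ')
  simp only [mul_add, add_mul, mul_sub, sub_mul, mul_neg, neg_mul, smul_add, smul_sub, smul_neg,
    smul_mul_assoc, mul_smul_comm, smul_smul, mul_assoc, pow_two, zero_mul, mul_zero, smul_zero]
  match_scalars <;> field_simp <;> ring

theorem serrePoly_twist_left (s : K) {b : A} (h : serrePoly s f₁ b = 0)
    (a2 : κ' * f₁ = t • (f₁ * κ')) (a3 : Commute κ' b) : serrePoly s (f₁ * κ') b = 0 := by
  have a3' := a3.eq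
  unfold serrePoly at h ⊢
  linear_combination (norm := skip) t • (h * κ' * κ') + f₁ * a2 * κ' * b
    + t • (f₁ * f₁ * κ' * a3') + t • (f₁ * f₁ * a3' * κ') - s • (f₁ * a3' * f₁ * κ')
    - s • (f₁ * b * a2 * κ') + b * f₁ * a2 * κ'
  simp only [mul_add, add_mul, mul_sub, sub_mul, mul_neg, neg_mul, smul_add, smul_sub, smul_neg,
    smul_mul_assoc, mul_smul_comm, smul_smul, mul_assoc, pow_two, zero_mul, mul_zero, smul_zero]
  module

theorem serrePoly_twist_right (s : K) {b : A} (h : serrePoly s b f₁ = 0)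
    (a3 : Commute κ' b) : serrePoly s b (f₁ * κ') = 0 := by
  have a3' := a3.eq
  unfold serrePoly at h ⊢
  linear_combination (norm := skip) h * κ' - s • (b * f₁ * a3') + f₁ * a3' * b + f₁ * b * a3'
  simp only [mul_add, add_mul, mul_sub, sub_mul, mul_neg, neg_mul, smul_add, smul_sub, smul_neg,
    smul_mul_assoc, mul_smul_comm, smul_smul, mul_assoc, pow_two, zero_mul, mul_zero, smul_zero]
  module

end Boundary

end Algebra

/-! ### Operators on formal combinations of integer arrays -/

/-- Integer arrays: `l p a` is the `a`-th entry of the row `p`. -/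
abbrev Arr : Type := ℕ → ℕ → ℤ

/-- The array whose only nonzero entry is a `1` at the place `a` of the row `p`. -/
def cell (p a : ℕ) : Arr := fun r b => if r = p ∧ b = a then 1 else 0

section RowOp

variable {K ι κ : Type*} [Field K]

/-- The operator `|l) ↦ ∑ₐ c l a |l + v a)`. -/
noncomputable def rowOp (s : Finset ι) (c : Arr → ι → K) (v : ι → Arr) : Module.End K (Arr →₀ K) :=
  Finsupp.linearCombination K fun l => ∑ a ∈ s, Finsupp.single (l + v a) (c l a)

theorem rowOp_single (s : Finset ι) (c : Arr → ι → K) (v : ι → Arr) (l : Arr) (x : K) :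
    rowOp s c v (Finsupp.single l x) = ∑ a ∈ s, Finsupp.single (l + v a) (x * c l a) := by
  simp [rowOp, Finset.smul_sum]

theorem end_ext {f g : Module.End K (Arr →₀ K)}
    (h : ∀ l, f (Finsupp.single l 1) = g (Finsupp.single l 1)) : f = g :=
  Finsupp.lhom_ext' fun l => LinearMap.ext_ring (h l)

theorem commute_rowOp {s : Finset ι} {t : Finset κ} {c : Arr → ι → K} {d : Arr → κ → K}
    {v : ι → Arr} {w : κ → Arr}
    (H : ∀ l, ∀ a ∈ s, ∀ b ∈ t, c l a * d (l + v a) b = d l b * c (l + w b) a) :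
    Commute (rowOp s c v) (rowOp t d w) := by
  refine end_ext fun l => ?_
  simp only [Module.End.mul_apply, rowOp_single, map_sum, one_mul]
  rw [Finset.sum_comm]
  refine Finset.sum_congr rfl fun a ha => Finset.sum_congr rfl fun b hb => ?_
  rw [H l a ha b hb, add_right_comm]

theorem sum_sum_eq_zero_of_antisymm [CharZero K] {W : Type*} [AddCommGroup W] [Module K W]
    (s : Finset ι) (f : ι → ι → W) (H : ∀ a ∈ s, ∀ b ∈ s, f a b + f b a = 0) :
    ∑ a ∈ s, ∑ b ∈ s, f a b = 0 := by
  have h : (2 : K) • ∑ a ∈ s, ∑ b ∈ s, f a b = 0 := by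
    rw [two_smul]
    nth_rewrite 2 [Finset.sum_comm]
    rw [← Finset.sum_add_distrib]
    refine Finset.sum_eq_zero fun a ha => ?_
    rw [← Finset.sum_add_distrib]
    exact Finset.sum_eq_zero fun b hb => H a ha b hb
  exact (smul_eq_zero.mp h).resolve_left two_ne_zero

/-- The contribution to the Serre polynomial of the three paths on which `j` precedes `j'`. -/
def serreCoeff (s : K) (c : Arr → ι → K) (d : Arr → κ → K) (v : ι → Arr) (w : κ → Arr)
    (l : Arr) (j j' : ι) (k : κ) : K :=
  d l k * c (l + w k) j * c (l + w k + v j) j' - s * (c l j * d (l + v j) k * c (l + v j + w k) j') +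
    c l j * c (l + v j) j' * d (l + v j + v j') k

/-- The end point of a path does not depend on the order of its moves, so the matrix coefficient
sums over both orders of `j` and `j'`; only the symmetrized contribution has to vanish. -/
theorem serrePoly_rowOp [CharZero K] (q : K) {s : Finset ι} {t : Finset κ} {c : Arr → ι → K}
    {d : Arr → κ → K} {v : ι → Arr} {w : κ → Arr}
    (H : ∀ l, ∀ j ∈ s, ∀ j' ∈ s, ∀ k ∈ t,
      serreCoeff q c d v w l j j' k + serreCoeff q c d v w l j' j k = 0) :
    serrePoly q (rowOp s c v) (rowOp t d w) = 0 := by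
  refine end_ext fun l => ?_
  have e : serrePoly q (rowOp s c v) (rowOp t d w) (Finsupp.single l 1) =
      ∑ j ∈ s, ∑ j' ∈ s, ∑ k ∈ t,
        Finsupp.single (l + v j + v j' + w k) (serreCoeff q c d v w l j j' k) := by
    simp only [serrePoly, pow_two, LinearMap.add_apply, LinearMap.sub_apply, LinearMap.smul_apply,
      Module.End.mul_apply, rowOp_single, map_sum, one_mul, serreCoeff, Finsupp.single_add,
      Finsupp.single_sub, Finset.sum_add_distrib, Finset.sum_sub_distrib, Finset.smul_sum,
      Finsupp.smul_single, smul_eq_mul]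
    congr 1
    · congr 1
      · rw [Finset.sum_comm]
        refine Finset.sum_congr rfl fun j _ => ?_
        rw [Finset.sum_comm]
        refine Finset.sum_congr rfl fun j' _ => Finset.sum_congr rfl fun k _ => ?_
        congr 1; abel
      · refine Finset.sum_congr rfl fun j _ => ?_
        rw [Finset.sum_comm]
        refine Finset.sum_congr rfl fun j' _ => Finset.sum_congr rfl fun k _ => ?_
        congr 1; abel
  rw [e, LinearMap.zero_apply]
  refine sum_sum_eq_zero_of_antisymm (K := K) s _ fun j hj j' hj' => ?_
  rw [← Finset.sum_add_distrib]
  refine Finset.sum_eq_zero fun k hk => ?_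
  rw [add_right_comm l (v j') (v j), ← Finsupp.single_add, H l j hj j' hj' k hk,
    Finsupp.single_zero]

end RowOp

/-! ### Identities between `q`-numbers at a generic `q` -/

section QInt

variable {K : Type*} [Field K]

/-- The `q`-number `[n]` of an integer. -/
noncomputable def qInt (q : K) (n : ℤ) : K := (q ^ n - q ^ (-n)) / (q - q⁻¹)

@[simp] theorem qInt_zero (q : K) : qInt q 0 = 0 := by simp [qInt]

theorem qInt_neg (q : K) (n : ℤ) : qInt q (-n) = -qInt q n := by
  simp only [qInt, neg_neg]; ring

/-- `q` is nonzero and not a root of unity. -/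
structure Generic (q : K) : Prop where
  ne_zero : q ≠ 0
  zpow_ne_one : ∀ n : ℤ, n ≠ 0 → q ^ n ≠ 1

theorem Generic.sub_inv_ne_zero {q : K} (hq : Generic q) : q - q⁻¹ ≠ 0 := by
  intro h
  apply hq.zpow_ne_one 2 two_ne_zero
  have h0 := hq.ne_zero
  rw [sub_eq_zero] at h
  rw [zpow_two]
  nth_rewrite 1 [h]
  exact inv_mul_cancel₀ h0

theorem Generic.add_inv_ne_zero {q : K} (hq : Generic q) : q + q⁻¹ ≠ 0 := by
  intro h
  apply hq.zpow_ne_one 4 four_ne_zero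
  have h0 := hq.ne_zero
  have h2 : q ^ 2 = -1 := by
    field_simp at h
    linear_combination h
  calc q ^ (4 : ℤ) = (q ^ 2) ^ 2 := by rw [← pow_mul]; norm_cast
    _ = 1 := by rw [h2]; norm_num

theorem Generic.qInt_ne_zero {q : K} (hq : Generic q) {n : ℤ} (hn : n ≠ 0) : qInt q n ≠ 0 := by
  refine div_ne_zero (fun h => ?_) hq.sub_inv_ne_zero
  apply hq.zpow_ne_one (n + n) (by omega)
  rw [sub_eq_zero] at h
  rw [zpow_add₀ hq.ne_zero]
  nth_rewrite 1 [h]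
  rw [← zpow_add₀ hq.ne_zero]; simp

theorem qInt_one {q : K} (hq : Generic q) : qInt q 1 = 1 := by
  rw [qInt, zpow_one, zpow_neg_one, div_self hq.sub_inv_ne_zero]

/-- `[x + σ] - t [x] = t ^ (-x)` with `t = q ^ σ` -/
theorem qInt_add_sub_mul {q : K} (hq : Generic q) {t : K} {x : ℤ} (ht : t = q ∨ t = q⁻¹) :
    qInt q (x + 1) - t * qInt q x = t ^ (-x) := by
  have h0 := hq.ne_zero
  have h1 := hq.sub_inv_ne_zero
  have h2 : q ^ x ≠ 0 := zpow_ne_zero _ h0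
  rcases ht with rfl | rfl
  all_goals
    simp only [qInt, neg_add, zpow_add₀ h0, inv_zpow, zpow_neg, zpow_one]
    rw [← mul_div_assoc, ← sub_div, div_eq_iff h1]
    field_simp
    ring

theorem qInt_add_add_qInt_sub {q : K} (hq : Generic q) (x : ℤ) :
    qInt q (x + 1) + qInt q (x - 1) = (q + q⁻¹) * qInt q x := by
  have h0 := hq.ne_zero
  have h1 := hq.sub_inv_ne_zero
  have h2 : q ^ x ≠ 0 := zpow_ne_zero _ h0
  simp only [qInt, neg_add, neg_sub, zpow_add₀ h0, zpow_sub₀ h0, zpow_neg, zpow_one]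
  rw [← mul_div_assoc, ← add_div]
  congr 1
  field_simp
  ring

/-- The Serre identity for two distinct entries, with denominators cleared: `x` and `y` stand for
the distances between these entries and the entry moved in the other row. It is a Laurent polynomial
identity in `q ^ x` and `q ^ y`. -/
theorem qInt_serre {q : K} (hq : Generic q) (σ x y : ℤ) (hσ : σ = 1 ∨ σ = -1) :
    (qInt q (x + σ) * qInt q (y + σ) + qInt q x * qInt q y) *
      (qInt q (-(x - y)) * qInt q (x - y + σ) + qInt q (x - y) * qInt q (-(x - y) + σ)) =
    (q + q⁻¹) * (qInt q x * qInt q (y + σ) * (qInt q (-(x - y)) * qInt q (x - y + σ)) +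
      qInt q y * qInt q (x + σ) * (qInt q (x - y) * qInt q (-(x - y) + σ))) := by
  have h0 := hq.ne_zero
  have h1 := hq.sub_inv_ne_zero
  have h2 : q ^ x ≠ 0 := zpow_ne_zero _ h0
  have h3 : q ^ y ≠ 0 := zpow_ne_zero _ h0
  rcases hσ with rfl | rfl
  all_goals
    simp only [qInt, neg_add, neg_sub, neg_neg, zpow_add₀ h0, zpow_sub₀ h0, zpow_neg, zpow_one]
    generalize q ^ x = a at *
    generalize q ^ y = b at *
    have e : q - q⁻¹ = (q ^ 2 - 1) / q := by field_simp
    have h4 : q ^ 2 - 1 ≠ 0 := fun h => h1 (by rw [e, h, zero_div])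
    rw [e]
    field_simp
    ring

end QInt

/-! ### Interlaced arrays and paths that leave them -/

/-- The betweenness conditions of a Gelfand-Tsetlin array, with strict inequalities on one side. -/
def Interlaced (l : Arr) : Prop :=
  ∀ p a b : ℕ, a < p + 1 → b < p →
    (a ≤ b → l p b ≤ l (p + 1) a) ∧ (b < a → l (p + 1) a < l p b)

/-- An entry of the row with one entry fewer separates the two, weakly on one side and strictly on
the other. -/
theorem Interlaced.lt {l : Arr} (h : Interlaced l) {p a b : ℕ} (hb : b < p) (hab : a < b) :
    l p b < l p a := by
  obtain ⟨p, rfl⟩ : ∃ r, p = r + 1 := ⟨p - 1, by omega⟩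
  exact ((h p b a hb (by omega)).2 hab).trans_le ((h p a a (by omega) (by omega)).1 le_rfl)

theorem Interlaced.ne {l : Arr} (h : Interlaced l) {p a b : ℕ} (ha : a < p) (hb : b < p)
    (hab : a ≠ b) : l p a ≠ l p b := by
  rcases lt_or_gt_of_ne hab with h' | h'
  · exact (h.lt hb h').ne'
  · exact (h.lt ha h').ne

/-- `r'` is the row above `r` (and `σ = 1`) or the row below `r` (and `σ = -1`). -/
def IsStep (r r' : ℕ) (σ : ℤ) : Prop := (r' = r + 1 ∧ σ = 1) ∨ (r = r' + 1 ∧ σ = -1)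

section Violations

variable {l : Arr} {r r' j j' k k' : ℕ} {σ : ℤ}

/-- This and the following seven lemmas list the possible orders of moves in the adjacent rows `r`
("lower") and `r'` ("upper", even when `σ = -1` puts it below). If both ends are interlaced, an
illegal intermediate array can only come from the moved entries of the two rows, and then they
coincide when the entry of `r` is about to move. The inequalities assumed exclude precisely these
zeros of the numerator of `raw`. -/
theorem interlaced_upper_lower_lower (hr : IsStep r r' σ) (hl : Interlaced l)
    (hf : Interlaced (l + σ • cell r' k + σ • cell r j + σ • cell r j'))
    (h0 : (l + σ • cell r' k) r' k ≠ (l + σ • cell r' k) r j)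
    (h1 : (l + σ • cell r' k + σ • cell r j) r' k ≠ (l + σ • cell r' k + σ • cell r j) r j') :
    Interlaced (l + σ • cell r' k) ∧ Interlaced (l + σ • cell r' k + σ • cell r j) := by
  simp only [Interlaced, Pi.add_apply, Pi.smul_apply, cell, smul_eq_mul] at *
  constructor <;> intro p a b ha hb <;> have := hl p a b ha hb <;> have := hf p a b ha hb
  all_goals
    rcases hr with ⟨rfl, rfl⟩ | ⟨rfl, rfl⟩ <;> grind

theorem interlaced_lower_upper_lower (hr : IsStep r r' σ) (hl : Interlaced l)
    (hf : Interlaced (l + σ • cell r j + σ • cell r' k + σ • cell r j'))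
    (h0 : l r' k ≠ l r j)
    (h1 : (l + σ • cell r j + σ • cell r' k) r' k ≠ (l + σ • cell r j + σ • cell r' k) r j') :
    Interlaced (l + σ • cell r j) ∧ Interlaced (l + σ • cell r j + σ • cell r' k) := by
  simp only [Interlaced, Pi.add_apply, Pi.smul_apply, cell, smul_eq_mul] at *
  constructor <;> intro p a b ha hb <;> have := hl p a b ha hb <;> have := hf p a b ha hb
  all_goals
    rcases hr with ⟨rfl, rfl⟩ | ⟨rfl, rfl⟩ <;> grind

theorem interlaced_lower_lower_upper (hr : IsStep r r' σ) (hl : Interlaced l)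
    (hf : Interlaced (l + σ • cell r j + σ • cell r j' + σ • cell r' k))
    (h0 : l r' k ≠ l r j)
    (h1 : (l + σ • cell r j) r' k ≠ (l + σ • cell r j) r j') :
    Interlaced (l + σ • cell r j) ∧ Interlaced (l + σ • cell r j + σ • cell r j') := by
  simp only [Interlaced, Pi.add_apply, Pi.smul_apply, cell, smul_eq_mul] at *
  constructor <;> intro p a b ha hb <;> have := hl p a b ha hb <;> have := hf p a b ha hb
  all_goals
    rcases hr with ⟨rfl, rfl⟩ | ⟨rfl, rfl⟩ <;> grind

theorem interlaced_lower_upper_upper (hr : IsStep r r' σ) (hl : Interlaced l)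
    (hf : Interlaced (l + σ • cell r j + σ • cell r' k + σ • cell r' k'))
    (h0 : l r' k ≠ l r j)
    (h1 : l r' k' ≠ l r j) :
    Interlaced (l + σ • cell r j) ∧ Interlaced (l + σ • cell r j + σ • cell r' k) := by
  simp only [Interlaced, Pi.add_apply, Pi.smul_apply, cell, smul_eq_mul] at *
  constructor <;> intro p a b ha hb <;> have := hl p a b ha hb <;> have := hf p a b ha hb
  all_goals
    rcases hr with ⟨rfl, rfl⟩ | ⟨rfl, rfl⟩ <;> grind

theorem interlaced_upper_lower_upper (hr : IsStep r r' σ) (hl : Interlaced l)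
    (hf : Interlaced (l + σ • cell r' k + σ • cell r j + σ • cell r' k'))
    (h0 : (l + σ • cell r' k) r' k ≠ (l + σ • cell r' k) r j)
    (h1 : (l + σ • cell r' k) r' k' ≠ (l + σ • cell r' k) r j) :
    Interlaced (l + σ • cell r' k) ∧ Interlaced (l + σ • cell r' k + σ • cell r j) := by
  simp only [Interlaced, Pi.add_apply, Pi.smul_apply, cell, smul_eq_mul] at *
  constructor <;> intro p a b ha hb <;> have := hl p a b ha hb <;> have := hf p a b ha hb
  all_goals
    rcases hr with ⟨rfl, rfl⟩ | ⟨rfl, rfl⟩ <;> grind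

theorem interlaced_upper_upper_lower (hr : IsStep r r' σ) (hl : Interlaced l)
    (hf : Interlaced (l + σ • cell r' k + σ • cell r' k' + σ • cell r j))
    (h0 : (l + σ • cell r' k + σ • cell r' k') r' k ≠ (l + σ • cell r' k + σ • cell r' k') r j)
    (h1 : (l + σ • cell r' k + σ • cell r' k') r' k' ≠ (l + σ • cell r' k + σ • cell r' k') r j) :
    Interlaced (l + σ • cell r' k) ∧ Interlaced (l + σ • cell r' k + σ • cell r' k') := by
  simp only [Interlaced, Pi.add_apply, Pi.smul_apply, cell, smul_eq_mul] at *
  constructor <;> intro p a b ha hb <;> have := hl p a b ha hb <;> have := hf p a b ha hb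
  all_goals
    rcases hr with ⟨rfl, rfl⟩ | ⟨rfl, rfl⟩ <;> grind

theorem interlaced_upper_lower (hr : IsStep r r' σ) (hl : Interlaced l)
    (hf : Interlaced (l + σ • cell r' k + σ • cell r j))
    (h : (l + σ • cell r' k) r' k ≠ (l + σ • cell r' k) r j) :
    Interlaced (l + σ • cell r' k) := by
  simp only [Interlaced, Pi.add_apply, Pi.smul_apply, cell, smul_eq_mul] at *
  intro p a b ha hb
  have := hl p a b ha hb
  have := hf p a b ha hb
  rcases hr with ⟨rfl, rfl⟩ | ⟨rfl, rfl⟩ <;> grind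

theorem interlaced_lower_upper (hr : IsStep r r' σ) (hl : Interlaced l)
    (hf : Interlaced (l + σ • cell r j + σ • cell r' k)) (h : l r' k ≠ l r j) :
    Interlaced (l + σ • cell r j) := by
  simp only [Interlaced, Pi.add_apply, Pi.smul_apply, cell, smul_eq_mul] at *
  intro p a b ha hb
  have := hl p a b ha hb
  have := hf p a b ha hb
  rcases hr with ⟨rfl, rfl⟩ | ⟨rfl, rfl⟩ <;> grind

/-- Moving entries in opposite directions, or in rows that are not adjacent, never leads through an
array that is not interlaced. -/
theorem interlaced_of_far {τ : ℤ} (h : r + 1 < r' ∨ r' + 1 < r ∨ ((r = r' → j ≠ k) ∧ τ = -σ)) (hσ : σ = 1 ∨ σ = -1) (hτ : τ = 1 ∨ τ = -1)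
    (hl : Interlaced l) (hf : Interlaced (l + σ • cell r j + τ • cell r' k)) :
    Interlaced (l + σ • cell r j) := by
  simp only [Interlaced, Pi.add_apply, Pi.smul_apply, cell, smul_eq_mul] at *
  intro p a b ha hb
  have := hl p a b ha hb
  have := hf p a b ha hb
  rcases h with h | h | ⟨h, rfl⟩
  · rcases hσ with rfl | rfl <;> rcases hτ with rfl | rfl <;> grind
  · rcases hσ with rfl | rfl <;> rcases hτ with rfl | rfl <;> grind
  · rcases hσ with rfl | rfl <;> grind

/-- Two entries of a row that can be moved past the fixed neighbouring row differ by two. -/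
theorem two_le_abs_sub {s : ℕ} (hσ : σ = 1 ∨ σ = -1) (hs : r = s + 1 ∨ s = r + 1) (hj : j < r)
    (hj' : j' < r) (hjj' : j ≠ j') (hl : Interlaced l) {f : Arr} (hf : Interlaced f)
    (h1 : f r j = l r j + σ) (h2 : f r j' = l r j' + σ) (h3 : f s = l s) :
    2 ≤ |l r j - l r j'| := by
  wlog h : j < j' generalizing j j'
  · rw [abs_sub_comm]
    exact this hj' hj hjj'.symm h2 h1 (by omega)
  have h0 := hl.lt hj' h
  rw [abs_of_pos (by omega)]
  rcases hs with rfl | rfl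
  · have a1 := (hl s j' j hj' (by omega)).2 h
    have a2 := (hl s j j (by omega) (by omega)).1 le_rfl
    have b1 := (hf s j' j hj' (by omega)).2 h
    have b2 := (hf s j j (by omega) (by omega)).1 le_rfl
    rw [h3] at b1 b2
    omega
  · have a1 := (hl r (j + 1) j (by omega) hj).2 (by omega)
    have a2 := (hl r (j + 1) j' (by omega) hj').1 (by omega)
    have b1 := (hf r (j + 1) j (by omega) hj).2 (by omega)
    have b2 := (hf r (j + 1) j' (by omega) hj').1 (by omega)
    rw [h3] at b1 b2
    omega

end Violations

/-! ### Rational Gelfand–Tsetlin coefficients -/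

section Raw

variable {K : Type*} [Field K]

/-- `∏ [uᵢ - y]` over `i ∈ s`. -/
noncomputable def prodDiff (q : K) (s : Finset ℕ) (u : ℕ → ℤ) (y : ℤ) : K :=
  ∏ i ∈ s, qInt q (u i - y)

theorem prodDiff_erase (q : K) {s : Finset ℕ} {i : ℕ} (hi : i ∈ s) (u : ℕ → ℤ) (y : ℤ) :
    prodDiff q s u y = qInt q (u i - y) * prodDiff q (s.erase i) u y :=
  (Finset.mul_prod_erase s _ hi).symm

theorem prodDiff_congr (q : K) {s : Finset ℕ} {u v : ℕ → ℤ} (y : ℤ) (h : ∀ i ∈ s, u i = v i) :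
    prodDiff q s u y = prodDiff q s v y :=
  Finset.prod_congr rfl fun i hi => by rw [h i hi]

theorem prodDiff_eq_zero (q : K) {s : Finset ℕ} {i : ℕ} (hi : i ∈ s) {u : ℕ → ℤ} {y : ℤ}
    (h : u i = y) : prodDiff q s u y = 0 := by
  rw [prodDiff_erase q hi, h]; simp

/-- The matrix coefficient for moving the entry `a` of the row `r`, relative to the row `r'`. -/
noncomputable def raw (q : K) (r r' : ℕ) (l : Arr) (a : ℕ) : K :=
  prodDiff q (Finset.range r') (l r') (l r a) / prodDiff q ((Finset.range r).erase a) (l r) (l r a)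

theorem raw_congr (q : K) {r r' : ℕ} {l m : Arr} (a : ℕ) (h : m r = l r) (h' : m r' = l r') :
    raw q r r' m a = raw q r r' l a := by
  simp only [raw, h, h']

theorem raw_eq_zero (q : K) {r r' : ℕ} {l : Arr} {a k : ℕ} (hk : k < r') (h : l r' k = l r a) :
    raw q r r' l a = 0 := by
  rw [raw, prodDiff_eq_zero q (Finset.mem_range.mpr hk) h, zero_div]

theorem raw_of_agree (q : K) {r r' : ℕ} {l m : Arr} {a k : ℕ} (hk : k < r')
    (h : m r = l r) (h' : ∀ i, i ≠ k → m r' i = l r' i) :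
    raw q r r' m a = prodDiff q ((Finset.range r').erase k) (l r') (l r a) /
      prodDiff q ((Finset.range r).erase a) (l r) (l r a) * qInt q (m r' k - l r a) := by
  rw [raw, prodDiff_erase q (Finset.mem_range.mpr hk), h,
    prodDiff_congr q (u := m r') (v := l r') _ fun i hi => h' i (Finset.ne_of_mem_erase hi)]
  ring

/-- Here and in the three variants below, the factor `A` does not depend on `m`: it serves at every
point of a path, and only the brackets between moved entries remain to be compared. -/
theorem exists_raw_eq (q : K) {r r' k : ℕ} (l : Arr) (a : ℕ) (hk : k < r') :
    ∃ A, ∀ m : Arr, m r = l r → (∀ i, i ≠ k → m r' i = l r' i) →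
      raw q r r' m a = A * qInt q (m r' k - l r a) :=
  ⟨_, fun _ h h' => raw_of_agree q hk h h'⟩

theorem exists_raw_eq_mul_div (q : K) {r r' b k : ℕ} (l : Arr) {a : ℕ} (hk : k < r') (hb : b < r)
    (hab : a ≠ b) : ∃ A, ∀ m : Arr, (∀ i, i ≠ b → m r i = l r i) →
      (∀ i, i ≠ k → m r' i = l r' i) →
      raw q r r' m a = A * (qInt q (m r' k - l r a) / qInt q (m r b - l r a)) := by
  refine ⟨prodDiff q ((Finset.range r').erase k) (l r') (l r a) /
    prodDiff q (((Finset.range r).erase a).erase b) (l r) (l r a), fun m h h' => ?_⟩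
  rw [raw, prodDiff_erase q (Finset.mem_range.mpr hk), h a hab,
    prodDiff_congr q (u := m r') (v := l r') _ fun i hi => h' i (Finset.ne_of_mem_erase hi),
    prodDiff_erase q (s := (Finset.range r).erase a) (i := b) (by simp [hab.symm, hb]),
    prodDiff_congr q (u := m r) (v := l r) _ fun i hi => h i (Finset.ne_of_mem_erase hi)]
  rw [mul_comm, mul_comm (qInt q (m r b - l r a)), mul_div_mul_comm]

theorem exists_raw_eq_div (q : K) {r b : ℕ} (r' : ℕ) (l : Arr) {a : ℕ} (hb : b < r)
    (hab : a ≠ b) : ∃ A, ∀ m : Arr, (∀ i, i ≠ b → m r i = l r i) → m r' = l r' →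
      raw q r r' m a = A / qInt q (m r b - l r a) := by
  refine ⟨prodDiff q (Finset.range r') (l r') (l r a) /
      prodDiff q (((Finset.range r).erase a).erase b) (l r) (l r a), fun m h h' => ?_⟩
  rw [raw, h', h a hab,
    prodDiff_erase q (s := (Finset.range r).erase a) (i := b) (by simp [hab.symm, hb]),
    prodDiff_congr q (u := m r) (v := l r) _ fun i hi => h i (Finset.ne_of_mem_erase hi)]
  rw [mul_comm (qInt q (m r b - l r a)), div_mul_eq_div_div]

theorem exists_raw_eq_mul_mul (q : K) {r r' k k' : ℕ} (l : Arr) (a : ℕ) (hk : k < r')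
    (hk' : k' < r') (hkk' : k ≠ k') : ∃ A, ∀ m : Arr, m r = l r →
      (∀ i, i ≠ k → i ≠ k' → m r' i = l r' i) →
      raw q r r' m a = A * (qInt q (m r' k - l r a) * qInt q (m r' k' - l r a)) := by
  refine ⟨prodDiff q (((Finset.range r').erase k).erase k') (l r') (l r a) /
      prodDiff q ((Finset.range r).erase a) (l r) (l r a), fun m h h' => ?_⟩
  rw [raw, prodDiff_erase q (Finset.mem_range.mpr hk),
    prodDiff_erase q (s := (Finset.range r').erase k) (i := k') (by simp [hkk'.symm, hk']), h,
    prodDiff_congr q (u := m r') (v := l r') _ fun i hi =>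
      h' i (by simp at hi; exact hi.2.1) (by simp at hi; exact hi.1)]
  ring

open Classical in
/-- `raw` for moves between interlaced arrays, and zero otherwise. -/
noncomputable def coef (q : K) (r r' : ℕ) (σ : ℤ) (l : Arr) (a : ℕ) : K :=
  if Interlaced l ∧ Interlaced (l + σ • cell r a) then raw q r r' l a else 0

/-- The operator that moves the entries of the row `r` by `σ`. -/
noncomputable def moveOp (q : K) (r r' : ℕ) (σ : ℤ) : Module.End K (Arr →₀ K) :=
  rowOp (Finset.range r) (coef q r r' σ) fun a => σ • cell r a

theorem add_cell_of_ne (l : Arr) {r s : ℕ} (h : r ≠ s) (σ : ℤ) (a : ℕ) :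
    (l + σ • cell s a) r = l r := by
  ext i; simp [cell, h]

theorem add_cell_apply_of_ne (l : Arr) (r : ℕ) {i a : ℕ} (h : i ≠ a) (σ : ℤ) :
    (l + σ • cell r a) r i = l r i := by
  simp [cell, h]

theorem add_cell_apply_self (l : Arr) (r a : ℕ) (σ : ℤ) :
    (l + σ • cell r a) r a = l r a + σ := by
  simp [cell]

theorem coef_of_interlaced (q : K) {r r' : ℕ} {σ : ℤ} {l : Arr} {a : ℕ} (hl : Interlaced l)
    (hf : Interlaced (l + σ • cell r a)) : coef q r r' σ l a = raw q r r' l a :=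
  if_pos ⟨hl, hf⟩

theorem coef_of_not_left (q : K) {r r' : ℕ} {σ : ℤ} {l : Arr} {a : ℕ} (hl : ¬ Interlaced l) :
    coef q r r' σ l a = 0 :=
  if_neg fun h => hl h.1

theorem coef_of_not_right (q : K) {r r' : ℕ} {σ : ℤ} {l : Arr} {a : ℕ}
    (hf : ¬ Interlaced (l + σ • cell r a)) : coef q r r' σ l a = 0 :=
  if_neg fun h => hf h.2

/-- Identities are easy for the explicit `raw` and wanted for the truncated `coef`. Between
interlaced ends the two products agree as soon as an illegal intermediate array forces a zero of
`raw`. -/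
theorem coef_mul_coef (q : K) {r r' s s' : ℕ} {σ τ : ℤ} {l : Arr} {a b : ℕ}
    (hl : Interlaced l) (hf : Interlaced (l + σ • cell r a + τ • cell s b))
    (h : ¬ Interlaced (l + σ • cell r a) →
      raw q r r' l a * raw q s s' (l + σ • cell r a) b = 0) :
    coef q r r' σ l a * coef q s s' τ (l + σ • cell r a) b =
      raw q r r' l a * raw q s s' (l + σ • cell r a) b := by
  by_cases hm : Interlaced (l + σ • cell r a)
  · rw [coef_of_interlaced q hl hm, coef_of_interlaced q hm hf]
  · rw [h hm, coef_of_not_right q hm, zero_mul]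

theorem coef_mul_coef_mul_coef (q : K) {r₁ r₁' r₂ r₂' r₃ r₃' : ℕ} {σ : ℤ} {l : Arr} {a b c : ℕ}
    (hl : Interlaced l)
    (hf : Interlaced (l + σ • cell r₁ a + σ • cell r₂ b + σ • cell r₃ c))
    (h : ¬ (Interlaced (l + σ • cell r₁ a) ∧ Interlaced (l + σ • cell r₁ a + σ • cell r₂ b)) →
      raw q r₁ r₁' l a * raw q r₂ r₂' (l + σ • cell r₁ a) b *
        raw q r₃ r₃' (l + σ • cell r₁ a + σ • cell r₂ b) c = 0) :
    coef q r₁ r₁' σ l a * coef q r₂ r₂' σ (l + σ • cell r₁ a) b *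
        coef q r₃ r₃' σ (l + σ • cell r₁ a + σ • cell r₂ b) c =
      raw q r₁ r₁' l a * raw q r₂ r₂' (l + σ • cell r₁ a) b *
        raw q r₃ r₃' (l + σ • cell r₁ a + σ • cell r₂ b) c := by
  by_cases h1 : Interlaced (l + σ • cell r₁ a)
  · by_cases h2 : Interlaced (l + σ • cell r₁ a + σ • cell r₂ b)
    · rw [coef_of_interlaced q hl h1, coef_of_interlaced q h1 h2, coef_of_interlaced q h2 hf]
    · rw [h (fun h => h2 h.2), coef_of_not_right q h2, mul_zero, zero_mul]
  · rw [h (fun h => h1 h.1), coef_of_not_right q h1, zero_mul, zero_mul]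

theorem coef_mul_coef_of_not (q : K) {r r' s s' : ℕ} {σ τ : ℤ} {l : Arr} {a b : ℕ}
    (h : ¬ (Interlaced l ∧ Interlaced (l + σ • cell r a + τ • cell s b))) :
    coef q r r' σ l a * coef q s s' τ (l + σ • cell r a) b = 0 := by
  by_cases hl : Interlaced l
  · rw [coef_of_not_right q (fun hf => h ⟨hl, hf⟩), mul_zero]
  · rw [coef_of_not_left q hl, zero_mul]

/-- Moves in opposite directions or in rows that are not adjacent commute. -/
theorem commute_moveOp (q : K) {r r' s s' : ℕ} {σ τ : ℤ} (hr : IsStep r r' σ) (hs : IsStep s s' τ)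
    (h : r + 1 < s ∨ s + 1 < r ∨ (r ≠ s ∧ τ = -σ)) :
    Commute (moveOp q r r' σ) (moveOp q s s' τ) := by
  have hσ : σ = 1 ∨ σ = -1 := by unfold IsStep at hr; omega
  have hτ : τ = 1 ∨ τ = -1 := by unfold IsStep at hs; omega
  refine commute_rowOp fun l a ha b hb => ?_
  rw [Finset.mem_range] at ha hb
  by_cases hlf : Interlaced l ∧ Interlaced (l + σ • cell r a + τ • cell s b)
  swap
  · rw [coef_mul_coef_of_not q hlf, coef_mul_coef_of_not q (by rwa [add_right_comm])]
  obtain ⟨hl, hf⟩ := hlf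
  have h1 : Interlaced (l + σ • cell r a) := by
    refine interlaced_of_far ?_ hσ hτ hl hf
    omega
  have h2 : Interlaced (l + τ • cell s b) := by
    rw [add_right_comm] at hf
    refine interlaced_of_far ?_ hτ hσ hl hf
    omega
  rw [coef_mul_coef q hl hf fun h => absurd h1 h,
    coef_mul_coef q hl (by rwa [add_right_comm]) fun h => absurd h2 h]
  have hrs : r ≠ s := by unfold IsStep at *; omega
  -- The coefficients influence each other only if the rows are adjacent and the moves opposite.
  -- Each coefficient then has one bracket containing the entry moved by the other, and exchanging
  -- the order changes the sign of both brackets.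
  by_cases hrs' : r' = s
  · by_cases hsr' : s' = r
    · subst hrs' hsr'
      have e1 := raw_of_agree q (r := s') (r' := r') (l := l) (m := l) (a := a) hb rfl
        fun _ _ => rfl
      have e2 := raw_of_agree q (r := r') (r' := s') (l := l) (m := l) (a := b) ha rfl
        fun _ _ => rfl
      have e3 := raw_of_agree q (r := s') (r' := r') (l := l) (m := l + τ • cell r' b) (a := a) hb
        (add_cell_of_ne l hrs _ _) fun _ h => add_cell_apply_of_ne l _ h _
      have e4 := raw_of_agree q (r := r') (r' := s') (l := l) (m := l + σ • cell s' a) (a := b) ha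
        (add_cell_of_ne l hrs.symm _ _) fun _ h => add_cell_apply_of_ne l _ h _
      rw [e1, e2, e3, e4, add_cell_apply_self, add_cell_apply_self]
      have hτσ : τ = -σ := by unfold IsStep at *; omega
      have f1 : l s' a + σ - l r' b = -(l r' b + τ - l s' a) := by omega
      have f2 : l s' a - l r' b = -(l r' b - l s' a) := by omega
      rw [f1, f2, qInt_neg, qInt_neg]
      ring
    · unfold IsStep at *; omega
  · have hsr' : s' ≠ r := by unfold IsStep at *; omega
    rw [raw_congr q (m := l + σ • cell r a) b (add_cell_of_ne l hrs.symm _ _)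
      (add_cell_of_ne l hsr' _ _), raw_congr q (m := l + τ • cell s b) a
      (add_cell_of_ne l hrs _ _) (add_cell_of_ne l hrs' _ _), mul_comm]

end Raw

/-! ### Serre relations for moves in adjacent rows -/

section Serre

variable {K : Type*} [Field K]

theorem serreCoeff_of_not (q s : K) {r r' t t' : ℕ} {σ : ℤ} {l : Arr} {j j' k : ℕ}
    (h : ¬ (Interlaced l ∧ Interlaced (l + σ • cell r j + σ • cell r j' + σ • cell t k))) :
    serreCoeff s (coef q r r' σ) (coef q t t' σ) (fun a => σ • cell r a) (fun a => σ • cell t a)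
      l j j' k = 0 := by
  unfold serreCoeff
  by_cases hl : Interlaced l
  · have hf : ¬ Interlaced (l + σ • cell r j + σ • cell r j' + σ • cell t k) := fun hf => h ⟨hl, hf⟩
    rw [coef_of_not_right q (a := j') (l := l + σ • cell t k + σ • cell r j)
      (by convert hf using 2; abel),
      coef_of_not_right q (a := j') (l := l + σ • cell r j + σ • cell t k)
      (by convert hf using 2; abel), coef_of_not_right q (a := k) hf]
    ring
  · rw [coef_of_not_left q hl, coef_of_not_left q hl]
    ring

theorem serreCoeff_eq (q s : K) {r r' t t' : ℕ} {σ : ℤ} {l : Arr} {j j' k : ℕ}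
    (hl : Interlaced l)
    (hf : Interlaced (l + σ • cell r j + σ • cell r j' + σ • cell t k))
    (h1 : ¬ (Interlaced (l + σ • cell t k) ∧ Interlaced (l + σ • cell t k + σ • cell r j)) →
      raw q t t' l k * raw q r r' (l + σ • cell t k) j *
        raw q r r' (l + σ • cell t k + σ • cell r j) j' = 0)
    (h2 : ¬ (Interlaced (l + σ • cell r j) ∧ Interlaced (l + σ • cell r j + σ • cell t k)) →
      raw q r r' l j * raw q t t' (l + σ • cell r j) k *
        raw q r r' (l + σ • cell r j + σ • cell t k) j' = 0)
    (h3 : ¬ (Interlaced (l + σ • cell r j) ∧ Interlaced (l + σ • cell r j + σ • cell r j')) →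
      raw q r r' l j * raw q r r' (l + σ • cell r j) j' *
        raw q t t' (l + σ • cell r j + σ • cell r j') k = 0) :
    serreCoeff s (coef q r r' σ) (coef q t t' σ) (fun a => σ • cell r a) (fun a => σ • cell t a)
      l j j' k = serreCoeff s (raw q r r') (raw q t t') (fun a => σ • cell r a)
        (fun a => σ • cell t a) l j j' k := by
  unfold serreCoeff
  rw [coef_mul_coef_mul_coef q hl (by convert hf using 1; abel) h1,
    coef_mul_coef_mul_coef q hl (by convert hf using 1; abel) h2,
    coef_mul_coef_mul_coef q hl hf h3]

variable {q : K} {r r' r'' : ℕ} {σ : ℤ}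

theorem serreCoeff_moveOp_eq (hr : IsStep r r' σ) {l : Arr} {j j' k : ℕ} (hk : k < r')
    (hl : Interlaced l) (hf : Interlaced (l + σ • cell r j + σ • cell r j' + σ • cell r' k)) (s : K) :
    serreCoeff s (coef q r r' σ) (coef q r' r'' σ) (fun a => σ • cell r a)
      (fun a => σ • cell r' a) l j j' k = serreCoeff s (raw q r r') (raw q r' r'')
        (fun a => σ • cell r a) (fun a => σ • cell r' a) l j j' k := by
  refine serreCoeff_eq q s hl hf (fun h => ?_) (fun h => ?_) (fun h => ?_)
  · by_contra hne
    refine h (interlaced_upper_lower_lower (j' := j') hr hl (by convert hf using 1; abel)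
      (fun e => hne ?_) (fun e => hne ?_))
    · rw [raw_eq_zero q hk e, mul_zero, zero_mul]
    · rw [raw_eq_zero q (a := j') hk e, mul_zero]
  · by_contra hne
    refine h (interlaced_lower_upper_lower (j' := j') hr hl (by convert hf using 1; abel)
      (fun e => hne ?_) (fun e => hne ?_))
    · rw [raw_eq_zero q hk e, zero_mul, zero_mul]
    · rw [raw_eq_zero q (a := j') hk e, mul_zero]
  · by_contra hne
    refine h (interlaced_lower_lower_upper hr hl hf (fun e => hne ?_) (fun e => hne ?_))
    · rw [raw_eq_zero q hk e, zero_mul, zero_mul]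
    · rw [raw_eq_zero q (a := j') hk e, mul_zero, zero_mul]

theorem serreCoeff_moveOp_eq' (hr : IsStep r r' σ) {l : Arr} {j k k' : ℕ} (hk : k < r')
    (hk' : k' < r') (hl : Interlaced l)
    (hf : Interlaced (l + σ • cell r' k + σ • cell r' k' + σ • cell r j)) (s : K) :
    serreCoeff s (coef q r' r'' σ) (coef q r r' σ) (fun a => σ • cell r' a)
      (fun a => σ • cell r a) l k k' j = serreCoeff s (raw q r' r'') (raw q r r')
        (fun a => σ • cell r' a) (fun a => σ • cell r a) l k k' j := by
  refine serreCoeff_eq q s hl hf (fun h => ?_) (fun h => ?_) (fun h => ?_)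
  · by_contra hne
    refine h (interlaced_lower_upper_upper (k' := k') hr hl (by convert hf using 1; abel)
      (fun e => hne ?_) (fun e => hne ?_))
    · rw [raw_eq_zero q hk e, zero_mul, zero_mul]
    · rw [raw_eq_zero q hk' e, zero_mul, zero_mul]
  · by_contra hne
    refine h (interlaced_upper_lower_upper (k' := k') hr hl (by convert hf using 1; abel)
      (fun e => hne ?_) (fun e => hne ?_))
    · rw [raw_eq_zero q hk e, mul_zero, zero_mul]
    · rw [raw_eq_zero q hk' e, mul_zero, zero_mul]
  · by_contra hne
    refine h (interlaced_upper_upper_lower hr hl hf (fun e => hne ?_) (fun e => hne ?_))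
    · rw [raw_eq_zero q hk e, mul_zero]
    · rw [raw_eq_zero q hk' e, mul_zero]

theorem div_add_div_eq_zero_of_mul_eq {a b d₁ d₂ : K} (h1 : d₁ ≠ 0) (h2 : d₂ ≠ 0)
    (H : a * d₂ + b * d₁ = 0) : a / d₁ + b / d₂ = 0 := by
  rw [div_add_div _ _ h1 h2, mul_comm d₁ b, H, zero_div]

/-- Six products along the paths that move two entries of a row past an entry of another row. -/
theorem qInt_serre_div (hq : Generic q) (hσ : σ = 1 ∨ σ = -1) {x y : ℤ} (hxy : 2 ≤ |-(x - y)|) :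
    (qInt q (x + σ) * qInt q (y + σ) - (q + q⁻¹) * (qInt q x * qInt q (y + σ)) +
      qInt q x * qInt q y) / (qInt q (x - y) * qInt q (-(x - y) + σ)) +
    (qInt q (x + σ) * qInt q (y + σ) - (q + q⁻¹) * (qInt q y * qInt q (x + σ)) +
      qInt q x * qInt q y) / (qInt q (-(x - y)) * qInt q (x - y + σ)) = 0 := by
  -- A gap of at least two excludes `x - y ∈ {0, 1, -1}`, where one of the four denominators would
  -- vanish.
  have n1 : qInt q (x - y) ≠ 0 := hq.qInt_ne_zero fun h => by rw [h] at hxy; simp at hxy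
  have n2 : qInt q (-(x - y)) ≠ 0 := by rw [qInt_neg]; exact neg_ne_zero.mpr n1
  have n3 : qInt q (x - y + σ) ≠ 0 := hq.qInt_ne_zero fun h => by
    rw [show -(x - y) = σ by omega] at hxy
    rcases hσ with rfl | rfl <;> simp at hxy
  have n4 : qInt q (-(x - y) + σ) ≠ 0 := hq.qInt_ne_zero fun h => by
    rw [show -(x - y) = -σ by omega] at hxy
    rcases hσ with rfl | rfl <;> simp at hxy
  exact div_add_div_eq_zero_of_mul_eq (mul_ne_zero n1 n4) (mul_ne_zero n2 n3)
    (by linear_combination qInt_serre hq σ x y hσ)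

/-- The coefficient of the row `r'` is measured against `r''` and does not see the row `r`, so it
factors out. For one entry moved twice the claim is the three-term recursion of `q`-numbers, for two
different entries it is `qInt_serre_div`. -/
theorem serrePoly_moveOp [CharZero K] (hq : Generic q) (hr : IsStep r r' σ)
    (hr' : IsStep r' r'' σ) :
    serrePoly (q + q⁻¹) (moveOp q r r' σ) (moveOp q r' r'' σ) = 0 := by
  have hσ : σ = 1 ∨ σ = -1 := by unfold IsStep at hr; omega
  have hrr' : r ≠ r' := by unfold IsStep at *; omega
  have hrr'' : r'' ≠ r := by unfold IsStep at *; omega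
  refine serrePoly_rowOp _ fun l j hj j' hj' k hk => ?_
  rw [Finset.mem_range] at hj hj' hk
  by_cases h : Interlaced l ∧ Interlaced (l + σ • cell r j + σ • cell r j' + σ • cell r' k)
  swap
  · rw [serreCoeff_of_not q _ h, serreCoeff_of_not q _ (by rwa [add_right_comm l]), add_zero]
  obtain ⟨hl, hf⟩ := h
  rw [serreCoeff_moveOp_eq hr hk hl hf, serreCoeff_moveOp_eq hr hk hl (by rwa [add_right_comm l])]
  have hU : ∀ a, raw q r' r'' (l + σ • cell r a) k = raw q r' r'' l k := fun a =>
    raw_congr q _ (add_cell_of_ne _ hrr'.symm _ _) (add_cell_of_ne _ hrr'' _ _)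
  have hU2 : ∀ a b, raw q r' r'' (l + σ • cell r a + σ • cell r b) k = raw q r' r'' l k :=
    fun a b => by
      rw [← hU a]
      exact raw_congr q _ (add_cell_of_ne _ hrr'.symm _ _) (add_cell_of_ne _ hrr'' _ _)
  simp only [serreCoeff, hU, hU2]
  rcases eq_or_ne j j' with rfl | hjj'
  · obtain ⟨A, hA⟩ := exists_raw_eq q (r := r) l j hk
    -- The second move of the entry `j` starts from its new value, so its common factor is taken at
    -- the array in which `j` has already moved.
    obtain ⟨B, hB⟩ := exists_raw_eq q (r := r) (l + σ • cell r j) j hk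
    rw [hA l rfl fun _ _ => rfl, hA (l + σ • cell r' k) (add_cell_of_ne _ hrr' _ _)
      fun _ h => add_cell_apply_of_ne _ _ h _, hB (l + σ • cell r j) rfl fun _ _ => rfl,
      hB (l + σ • cell r j + σ • cell r' k) (add_cell_of_ne _ hrr' _ _)
      fun _ h => add_cell_apply_of_ne _ _ h _,
      hB (l + σ • cell r' k + σ • cell r j) (by rw [add_right_comm, add_cell_of_ne _ hrr'])
      fun _ h => by rw [add_right_comm, add_cell_apply_of_ne _ _ h]]
    simp only [add_cell_apply_self, add_cell_of_ne _ hrr'.symm]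
    have f1 : l r' k + σ - (l r j + σ) = l r' k - l r j := by ring
    rw [f1]
    have key := qInt_add_add_qInt_sub hq (l r' k - l r j)
    rcases hσ with rfl | rfl
    · have f2 : l r' k + 1 - l r j = l r' k - l r j + 1 := by ring
      have f3 : l r' k - (l r j + 1) = l r' k - l r j - 1 := by ring
      rw [f2, f3]
      linear_combination (2 * raw q r' r'' l k * A * B * qInt q (l r' k - l r j)) * key
    · have f2 : l r' k + -1 - l r j = l r' k - l r j - 1 := by ring
      have f3 : l r' k - (l r j + -1) = l r' k - l r j + 1 := by ring
      rw [f2, f3]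
      linear_combination (2 * raw q r' r'' l k * A * B * qInt q (l r' k - l r j)) * key
  -- The row `s` is the neighbour of `r` opposite to `r'`. No move touches it, so both moved entries
  -- of `r` pass a fixed row and must be at least two apart.
  · obtain ⟨s, hs, hsr, hsr'⟩ : ∃ s, (r = s + 1 ∨ s = r + 1) ∧ s ≠ r ∧ s ≠ r' := by
      unfold IsStep at hr
      rcases hr with ⟨h, -⟩ | ⟨h, -⟩
      · exact ⟨r - 1, by omega, by omega, by omega⟩
      · exact ⟨r + 1, by omega, by omega, by omega⟩
    have abs2 := two_le_abs_sub hσ hs hj hj' hjj' hl hf (by simp [cell, hjj', hrr'])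
      (by simp [cell, hjj'.symm, hrr'])
      (by rw [add_cell_of_ne _ hsr', add_cell_of_ne _ hsr, add_cell_of_ne _ hsr])
    obtain ⟨A, hA⟩ := exists_raw_eq_mul_div q l hk hj' hjj'
    obtain ⟨B, hB⟩ := exists_raw_eq_mul_div q l hk hj hjj'.symm
    rw [hA l (fun _ _ => rfl) fun _ _ => rfl, hB l (fun _ _ => rfl) fun _ _ => rfl,
      hA (l + σ • cell r' k) (fun _ _ => by rw [add_cell_of_ne _ hrr'])
        fun _ h => add_cell_apply_of_ne _ _ h _,
      hB (l + σ • cell r' k) (fun _ _ => by rw [add_cell_of_ne _ hrr'])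
        fun _ h => add_cell_apply_of_ne _ _ h _,
      hA (l + σ • cell r j') (fun _ h => add_cell_apply_of_ne _ _ h _)
        (fun _ _ => by rw [add_cell_of_ne _ hrr'.symm]),
      hB (l + σ • cell r j) (fun _ h => add_cell_apply_of_ne _ _ h _)
        (fun _ _ => by rw [add_cell_of_ne _ hrr'.symm]),
      hA (l + σ • cell r j' + σ • cell r' k)
        (fun _ h => by rw [add_cell_of_ne _ hrr', add_cell_apply_of_ne _ _ h])
        (fun _ h => by rw [add_cell_apply_of_ne _ _ h, add_cell_of_ne _ hrr'.symm]),
      hB (l + σ • cell r j + σ • cell r' k)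
        (fun _ h => by rw [add_cell_of_ne _ hrr', add_cell_apply_of_ne _ _ h])
        (fun _ h => by rw [add_cell_apply_of_ne _ _ h, add_cell_of_ne _ hrr'.symm]),
      hA (l + σ • cell r' k + σ • cell r j')
        (fun _ h => by rw [add_cell_apply_of_ne _ _ h, add_cell_of_ne _ hrr'])
        (fun _ h => by rw [add_cell_of_ne _ hrr'.symm, add_cell_apply_of_ne _ _ h]),
      hB (l + σ • cell r' k + σ • cell r j)
        (fun _ h => by rw [add_cell_apply_of_ne _ _ h, add_cell_of_ne _ hrr'])
        (fun _ h => by rw [add_cell_of_ne _ hrr'.symm, add_cell_apply_of_ne _ _ h])]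
    simp only [add_cell_apply_self, add_cell_of_ne _ hrr', add_cell_of_ne _ hrr'.symm]
    set x := l r' k - l r j with hx
    set y := l r' k - l r j' with hy
    have g1 : l r j' - l r j = x - y := by ring
    have g2 : l r j - l r j' = -(x - y) := by ring
    have g3 : l r j' + σ - l r j = x - y + σ := by ring
    have g4 : l r j + σ - l r j' = -(x - y) + σ := by ring
    have g5 : l r' k + σ - l r j = x + σ := by ring
    have g6 : l r' k + σ - l r j' = y + σ := by ring
    rw [g2] at abs2
    rw [g1, g2, g3, g4, g5, g6]
    linear_combination (raw q r' r'' l k * A * B) * qInt_serre_div hq hσ abs2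

/-- Now two entries move in the row `r'`: the coefficient of the row `r` contains the brackets to
both of them in its numerator, while their own coefficients interact only through a denominator. -/
theorem serrePoly_moveOp' [CharZero K] (hq : Generic q) (hr : IsStep r r' σ)
    (hr' : IsStep r' r'' σ) :
    serrePoly (q + q⁻¹) (moveOp q r' r'' σ) (moveOp q r r' σ) = 0 := by
  have hσ : σ = 1 ∨ σ = -1 := by unfold IsStep at hr; omega
  have hrr' : r ≠ r' := by unfold IsStep at *; omega
  have hrr'' : r'' ≠ r := by unfold IsStep at *; omega
  have hne : r'' ≠ r' := by unfold IsStep at *; omega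
  refine serrePoly_rowOp _ fun l k hk k' hk' j hj => ?_
  rw [Finset.mem_range] at hk hk' hj
  by_cases h : Interlaced l ∧ Interlaced (l + σ • cell r' k + σ • cell r' k' + σ • cell r j)
  swap
  · rw [serreCoeff_of_not q _ h, serreCoeff_of_not q _ (by rwa [add_right_comm l]), add_zero]
  obtain ⟨hl, hf⟩ := h
  rw [serreCoeff_moveOp_eq' hr hk hk' hl hf,
    serreCoeff_moveOp_eq' hr hk' hk hl (by rwa [add_right_comm l])]
  have hU : ∀ (m : Arr) (b : ℕ), raw q r' r'' (m + σ • cell r j) b = raw q r' r'' m b := fun m b =>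
    raw_congr q _ (add_cell_of_ne _ hrr'.symm _ _) (add_cell_of_ne _ hrr'' _ _)
  have hU2 : ∀ a b, raw q r' r'' (l + σ • cell r j + σ • cell r' a) b =
      raw q r' r'' (l + σ • cell r' a) b := fun a b => by
    rw [add_right_comm, hU]
  simp only [serreCoeff, hU, hU2]
  rcases eq_or_ne k k' with rfl | hkk'
  · obtain ⟨A, hA⟩ := exists_raw_eq q (r := r) l j hk
    rw [hA l rfl fun _ _ => rfl, hA (l + σ • cell r' k) (add_cell_of_ne _ hrr' _ _)
      fun _ h => add_cell_apply_of_ne _ _ h _, hA (l + σ • cell r' k + σ • cell r' k)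
      (by rw [add_cell_of_ne _ hrr', add_cell_of_ne _ hrr'])
      fun _ h => by rw [add_cell_apply_of_ne _ _ h, add_cell_apply_of_ne _ _ h]]
    simp only [add_cell_apply_self]
    have key := qInt_add_add_qInt_sub hq (l r' k - l r j + σ)
    rcases hσ with rfl | rfl
    · have f2 : l r' k + 1 - l r j = l r' k - l r j + 1 := by ring
      have f3 : l r' k + 1 + 1 - l r j = l r' k - l r j + 1 + 1 := by ring
      rw [add_sub_cancel_right] at key
      rw [f2, f3]
      linear_combination (2 * raw q r' r'' l k * raw q r' r'' (l + (1 : ℤ) • cell r' k) k * A) * key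
    · have f2 : l r' k + -1 - l r j = l r' k - l r j + -1 := by ring
      have f3 : l r' k + -1 + -1 - l r j = l r' k - l r j + -1 - 1 := by ring
      rw [neg_add_cancel_right] at key
      rw [f2, f3]
      linear_combination
        (2 * raw q r' r'' l k * raw q r' r'' (l + (-1 : ℤ) • cell r' k) k * A) * key
  · have hs : r' = r'' + 1 ∨ r'' = r' + 1 := by unfold IsStep at hr'; omega
    have abs2 := two_le_abs_sub hσ hs hk hk' hkk' hl hf (by simp [cell, hkk', hrr'.symm])
      (by simp [cell, hkk'.symm, hrr'.symm])
      (by rw [add_cell_of_ne _ hrr'', add_cell_of_ne _ hne, add_cell_of_ne _ hne])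
    obtain ⟨M, hM⟩ := exists_raw_eq_mul_mul q (r := r) l j hk hk' hkk'
    obtain ⟨A, hA⟩ := exists_raw_eq_div q r'' l hk' hkk'
    obtain ⟨B, hB⟩ := exists_raw_eq_div q r'' l hk hkk'.symm
    rw [hM l rfl fun _ _ _ => rfl, hA l (fun _ _ => rfl) rfl, hB l (fun _ _ => rfl) rfl,
      hM (l + σ • cell r' k) (add_cell_of_ne _ hrr' _ _)
        (fun _ h _ => add_cell_apply_of_ne _ _ h _),
      hM (l + σ • cell r' k') (add_cell_of_ne _ hrr' _ _)
        (fun _ _ h => add_cell_apply_of_ne _ _ h _),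
      hM (l + σ • cell r' k + σ • cell r' k')
        (by rw [add_cell_of_ne _ hrr', add_cell_of_ne _ hrr'])
        (fun _ h h' => by rw [add_cell_apply_of_ne _ _ h', add_cell_apply_of_ne _ _ h]),
      hM (l + σ • cell r' k' + σ • cell r' k)
        (by rw [add_cell_of_ne _ hrr', add_cell_of_ne _ hrr'])
        (fun _ h h' => by rw [add_cell_apply_of_ne _ _ h, add_cell_apply_of_ne _ _ h']),
      hA (l + σ • cell r' k') (fun _ h => add_cell_apply_of_ne _ _ h _) (add_cell_of_ne _ hne _ _),
      hB (l + σ • cell r' k) (fun _ h => add_cell_apply_of_ne _ _ h _) (add_cell_of_ne _ hne _ _)]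
    simp only [add_cell_apply_self, add_cell_apply_of_ne _ _ hkk', add_cell_apply_of_ne _ _ hkk'.symm]
    -- The names are exchanged relative to `serrePoly_moveOp`, so that the difference between the
    -- second and the first moved entry is again `x - y`.
    set y := l r' k - l r j with hx
    set x := l r' k' - l r j with hy
    have g1 : l r' k' - l r' k = x - y := by ring
    have g2 : l r' k - l r' k' = -(x - y) := by ring
    have g3 : l r' k' + σ - l r' k = x - y + σ := by ring
    have g4 : l r' k + σ - l r' k' = -(x - y) + σ := by ring
    have g5 : l r' k + σ - l r j = y + σ := by ring
    have g6 : l r' k' + σ - l r j = x + σ := by ring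
    rw [g2] at abs2
    rw [g1, g2, g3, g4, g5, g6]
    linear_combination (M * A * B) * qInt_serre_div hq hσ abs2

end Serre

/-! ### The partial fraction identity for the commutator of `e` and `f` -/

section PartialFractions

open Polynomial

variable {K : Type*} [Field K]

/-- A divided difference with confluent nodes at double zeros: the singular terms contribute
`0 / 0 = 0`. -/
theorem sum_eval_div_prod_erase {ι : Type*} [DecidableEq ι] (s : Finset ι) (x : ι → K) (P : K[X])
    (hP : P.degree < s.card)
    (hs : ∀ i ∈ s, ∀ j ∈ s, i ≠ j → x i = x j →
      (X - C (x i)) ^ 2 ∣ P ∧ ∀ k ∈ s, x k = x i → k = i ∨ k = j) :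
    ∑ i ∈ s, P.eval (x i) / ∏ k ∈ s.erase i, (x i - x k) = P.coeff (s.card - 1) := by
  induction hn : s.card using Nat.strong_induction_on generalizing s P with
  | _ n ih =>
  subst hn
  by_cases hinj : Set.InjOn x s
  · exact (Lagrange.coeff_eq_sum hinj hP).symm
  obtain ⟨i, hi, j, hj, hxij, hij⟩ : ∃ i ∈ s, ∃ j ∈ s, x i = x j ∧ i ≠ j := by
    simp only [Set.InjOn, not_forall] at hinj
    obtain ⟨i, hi, j, hj, h, h'⟩ := hinj
    exact ⟨i, hi, j, hj, h, h'⟩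
  -- Induction removes a coinciding pair of nodes. Their two terms are zero because the numerator
  -- vanishes, and in every other term the double factor cancels against the two removed nodes.
  obtain ⟨⟨Q, rfl⟩, hij3⟩ := hs i hi j hj hij hxij
  set t := (s.erase i).erase j with ht
  have hjs : j ∈ s.erase i := Finset.mem_erase.mpr ⟨hij.symm, hj⟩
  have hcard : s.card = t.card + 2 := by
    rw [ht, Finset.card_erase_of_mem hjs, Finset.card_erase_of_mem hi]
    have : 1 < s.card := Finset.one_lt_card.mpr ⟨i, hi, j, hj, hij⟩
    omega
  have hts : ∀ k ∈ t, k ∈ s ∧ x k ≠ x i := fun k hk => by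
    simp only [ht, Finset.mem_erase] at hk
    refine ⟨hk.2.2, fun h => ?_⟩
    rcases hij3 k hk.2.2 h with h | h
    · exact hk.2.1 h
    · exact hk.1 h
  have hdeg : Q.degree < t.card := by
    rw [degree_mul, degree_pow, degree_X_sub_C, hcard] at hP
    by_cases hQ : Q = 0
    · rw [hQ, degree_zero]; exact WithBot.bot_lt_coe _
    · rw [degree_eq_natDegree hQ] at hP ⊢
      norm_cast at hP ⊢
      simp at hP
      norm_cast at hP
      omega
  have key := ih t.card (by omega) t Q hdeg (fun a ha b hb hab hxab => by
    obtain ⟨h1, h2⟩ := hs a (hts a ha).1 b (hts b hb).1 hab hxab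
    refine ⟨?_, fun k hk h => h2 k (hts k hk).1 h⟩
    refine (IsCoprime.pow ?_).dvd_of_dvd_mul_left h1
    exact isCoprime_X_sub_C_of_isUnit_sub (sub_ne_zero.mpr (hts a ha).2).isUnit) rfl
  have hterm : ∀ k ∈ t, ((X - C (x i)) ^ 2 * Q).eval (x k) / ∏ m ∈ s.erase k, (x k - x m) =
      Q.eval (x k) / ∏ m ∈ t.erase k, (x k - x m) := fun k hk => by
    have hk' := hts k hk
    have hki : i ≠ k := fun h => hk'.2 (by rw [h])
    have hkj : j ≠ k := fun h => hk'.2 (by rw [← h, hxij])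
    have e : t.erase k = ((s.erase k).erase i).erase j := by
      ext m; simp only [ht, Finset.mem_erase]; tauto
    have hne := sub_ne_zero.mpr hk'.2
    rw [e, ← Finset.mul_prod_erase (s.erase k) _ (Finset.mem_erase.mpr ⟨hki, hi⟩),
      ← Finset.mul_prod_erase ((s.erase k).erase i) _
        (Finset.mem_erase.mpr ⟨hij.symm, Finset.mem_erase.mpr ⟨hkj, hj⟩⟩), ← hxij]
    simp only [eval_mul, eval_pow, eval_sub, eval_X, eval_C]
    rw [← mul_assoc, ← pow_two, mul_div_mul_left _ _ (pow_ne_zero 2 hne)]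
  have hz : ∀ k, x k = x i → ((X - C (x i)) ^ 2 * Q).eval (x k) = 0 := fun k hk => by
    simp [hk]
  rw [← Finset.add_sum_erase s _ hi, ← Finset.add_sum_erase _ _ hjs, hz i rfl, hz j hxij.symm,
    zero_div, zero_div, zero_add, zero_add, Finset.sum_congr rfl hterm, key, hcard]
  -- Since `Q` has degree below `t.card`, only the `X²` part of the square reaches the coefficient
  -- in question.
  have e : (X - C (x i)) ^ 2 * Q = X * (X * Q) + (C (-2 * x i) * (X * Q) + C (x i ^ 2) * Q) := by
    simp only [map_mul, map_neg, map_pow, C_ofNat]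
    ring
  have hz1 : Q.coeff t.card = 0 := coeff_eq_zero_of_degree_lt hdeg
  have hz2 : Q.coeff (t.card + 1) = 0 := coeff_eq_zero_of_degree_lt (hdeg.trans (by norm_cast; omega))
  rw [e, show t.card + 2 - 1 = t.card + 1 by omega, coeff_add, coeff_add, coeff_X_mul, coeff_C_mul,
    coeff_C_mul, coeff_X_mul, hz1, hz2, mul_zero, mul_zero, add_zero, add_zero]
  -- For empty `t` the index `t.card - 1` is truncated to `0`, but then `Q = 0` and both sides
  -- vanish.
  rcases Nat.eq_zero_or_pos t.card with h0 | h0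
  · have : Q = 0 := by
      rw [h0] at hdeg
      rw [← degree_eq_bot]
      exact Nat.WithBot.lt_zero_iff.mp (by exact_mod_cast hdeg)
    simp [this]
  · obtain ⟨m, hm⟩ : ∃ m, t.card = m + 1 := ⟨t.card - 1, by omega⟩
    rw [hm, coeff_X_mul, Nat.add_sub_cancel]

theorem zpow_two_mul_sub {q : K} (hq : Generic q) (m n : ℤ) :
    q ^ (2 * m) - q ^ (2 * n) = -(q - q⁻¹) * q ^ (m + n) * qInt q (n - m) := by
  have h0 := hq.ne_zero
  have h1 := hq.sub_inv_ne_zero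
  rw [qInt, mul_assoc, mul_div_assoc', neg_mul, mul_div_cancel₀ _ h1, mul_sub,
    ← zpow_add₀ h0, ← zpow_add₀ h0, neg_sub, show m + n + -(n - m) = 2 * m by ring,
    show m + n + (n - m) = 2 * n by ring]

theorem prod_zpow_eq {q : K} (h0 : q ≠ 0) {ι : Type*} (s : Finset ι) (u : ι → ℤ) :
    ∏ k ∈ s, q ^ u k = q ^ ∑ k ∈ s, u k := by
  classical
  induction s using Finset.induction_on with
  | empty => simp
  | insert a s ha ih => rw [Finset.prod_insert ha, ih, Finset.sum_insert ha, ← zpow_add₀ h0]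

theorem prod_zpow_two_mul_sub {q : K} (hq : Generic q) (s : Finset ℕ) (u : ℕ → ℤ) (m : ℤ) :
    ∏ k ∈ s, (q ^ (2 * m) - q ^ (2 * u k)) =
      (-(q - q⁻¹)) ^ s.card * q ^ (s.card * m + ∑ k ∈ s, u k) * prodDiff q s u m := by
  simp only [zpow_two_mul_sub hq, Finset.prod_mul_distrib, Finset.prod_const, prodDiff]
  rw [prod_zpow_eq hq.ne_zero, Finset.sum_add_distrib, Finset.sum_const, nsmul_eq_mul]

theorem prodDiff_sub (q : K) (s : Finset ℕ) (u : ℕ → ℤ) (y c : ℤ) :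
    prodDiff q s (fun k => u k - c) y = prodDiff q s u (y + c) :=
  Finset.prod_congr rfl fun k _ => by congr 1; ring

/-- The partial fraction identity behind `[e, f] = [h]`. -/
theorem sum_prodDiff_sub_eq_qInt {q : K} (hq : Generic q) {n : ℕ} {u d y : ℕ → ℤ}
    (hy : ∀ a < n + 1, ∀ b < n + 1, y a = y b → a = b)
    (hdouble : ∀ a < n + 1, ∀ b < n + 1, y a = y b + 1 →
      (∃ k < n + 2, u k = y b) ∧ ∃ k < n, d k = y a) :
    ∑ a ∈ Finset.range (n + 1),
      (prodDiff q (Finset.range (n + 2)) u (y a) * prodDiff q (Finset.range n) d (y a + 1) /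
        (prodDiff q ((Finset.range (n + 1)).erase a) y (y a) *
          prodDiff q ((Finset.range (n + 1)).erase a) y (y a + 1)) -
      prodDiff q (Finset.range (n + 2)) u (y a - 1) * prodDiff q (Finset.range n) d (y a) /
        (prodDiff q ((Finset.range (n + 1)).erase a) y (y a - 1) *
          prodDiff q ((Finset.range (n + 1)).erase a) y (y a))) =
    qInt q (2 * ∑ k ∈ Finset.range (n + 1), y k - ∑ k ∈ Finset.range (n + 2), u k -
      ∑ k ∈ Finset.range n, d k - 1) := by
  classical
  have h0 := hq.ne_zero
  have h1 := hq.sub_inv_ne_zero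
  set c := q - q⁻¹ with hc
  set R := Finset.range (n + 1) with hR
  let z : ℤ → K := fun m => q ^ (2 * m)
  have hzinj : ∀ a b, z a = z b → a = b := fun a b h => by
    by_contra hab
    have := zpow_two_mul_sub hq a b
    rw [sub_eq_zero.mpr h] at this
    exact mul_ne_zero (mul_ne_zero (neg_ne_zero.mpr h1) (zpow_ne_zero _ h0))
      (hq.qInt_ne_zero (sub_ne_zero.mpr (Ne.symm hab))) this.symm
  have hz0 : ∀ a, z a ≠ 0 := fun a => zpow_ne_zero _ h0
  -- In the variable `z = q ^ (2m)` the nodes are `0`, the values at `y a` and those at `y a - 1`;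
  -- `P` has the zeros of the numerators. Its degree is one less than the number of nodes and it is
  -- monic, so its divided difference is `1`. Writing `H` for the exponent on the right, the node
  -- `0` contributes `q ^ (-2H)` and the others contribute `(q - q⁻¹) q ^ (-H)` times the sum.
  let x : ℕ ⊕ ℕ ⊕ ℕ → K :=
    Sum.elim (fun _ => 0) (Sum.elim (fun a => z (y a)) (fun a => z (y a - 1)))
  let S : Finset (ℕ ⊕ ℕ ⊕ ℕ) := ({0} : Finset ℕ).disjSum (R.disjSum R)
  let P : K[X] := (∏ k ∈ Finset.range (n + 2), (X - C (z (u k)))) *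
    ∏ k ∈ Finset.range n, (X - C (z (d k - 1)))
  have hmon : P.Monic := (monic_prod_of_monic _ _ fun _ _ => monic_X_sub_C _).mul
    (monic_prod_of_monic _ _ fun _ _ => monic_X_sub_C _)
  have hdegP : P.natDegree = 2 * n + 2 := by
    rw [Monic.natDegree_mul (monic_prod_of_monic _ _ fun _ _ => monic_X_sub_C _)
      (monic_prod_of_monic _ _ fun _ _ => monic_X_sub_C _),
      natDegree_prod_of_monic _ _ fun _ _ => monic_X_sub_C _,
      natDegree_prod_of_monic _ _ fun _ _ => monic_X_sub_C _]
    simp; ring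
  have hcard : S.card = 2 * n + 3 := by
    simp [S, hR]; ring
  have heval : ∀ m, P.eval (z m) = (-c) ^ (2 * n + 2) *
      q ^ ((2 * n + 2) * m + ∑ k ∈ Finset.range (n + 2), u k + ∑ k ∈ Finset.range n, d k - n) *
      (prodDiff q (Finset.range (n + 2)) u m * prodDiff q (Finset.range n) d (m + 1)) := by
    intro m
    simp only [P, eval_mul, eval_prod, eval_sub, eval_X, eval_C, z]
    rw [prod_zpow_two_mul_sub hq _ u, prod_zpow_two_mul_sub hq _ (fun k => d k - 1), prodDiff_sub,
      ← hc, Finset.card_range, Finset.card_range, Finset.sum_sub_distrib]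
    have e : q ^ ((2 * (n : ℤ) + 2) * m + ∑ k ∈ Finset.range (n + 2), u k +
        ∑ k ∈ Finset.range n, d k - n) =
        q ^ (((n + 2 : ℕ) : ℤ) * m + ∑ k ∈ Finset.range (n + 2), u k) *
        q ^ (n * m + (∑ k ∈ Finset.range n, d k - ∑ k ∈ Finset.range n, 1)) := by
      rw [← zpow_add₀ h0]
      congr 1
      simp
      ring
    rw [e]
    ring
  have key := sum_eval_div_prod_erase S x P (by
    rw [hmon.ne_zero |> degree_eq_natDegree, hdegP, hcard]; norm_cast; omega) ?_
  swap
  -- Nodes collide exactly when `y a = y b + 1`. Then an entry of `u` and an entry of `d - 1` both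
  -- equal `y b`, which provides the double zero.
  · have hD : ∀ a < n + 1, ∀ b < n + 1, y a = y b + 1 → (X - C (z (y b))) ^ 2 ∣ P := by
      intro a ha b hb hab
      obtain ⟨⟨k, hk, hk'⟩, ⟨m, hm, hm'⟩⟩ := hdouble a ha b hb hab
      rw [pow_two]
      refine mul_dvd_mul ?_ ?_
      · rw [← hk']
        exact Finset.dvd_prod_of_mem (fun k => X - C (z (u k))) (Finset.mem_range.mpr hk)
      · rw [show y b = d m - 1 by omega]
        exact Finset.dvd_prod_of_mem (fun k => X - C (z (d k - 1))) (Finset.mem_range.mpr hm)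
    rintro (i | i | i) hi (j | j | j) hj hij hx <;>
      simp only [S, x, hR, Finset.inl_mem_disjSum, Finset.inr_mem_disjSum, Finset.mem_singleton,
        Finset.mem_range, Sum.elim_inl, Sum.elim_inr] at hi hj hx
    · exact absurd (by rw [hi, hj]) hij
    · exact absurd hx.symm (hz0 _)
    · exact absurd hx.symm (hz0 _)
    · exact absurd hx (hz0 _)
    · exact absurd (by rw [hy i hi j hj (hzinj _ _ hx)]) hij
    · have e := hzinj _ _ hx
      refine ⟨hD j hj i hi (by omega), ?_⟩
      rintro (k | k | k) hk hkx <;>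
        simp only [S, x, hR, Finset.inl_mem_disjSum, Finset.inr_mem_disjSum, Finset.mem_singleton,
          Finset.mem_range, Sum.elim_inl, Sum.elim_inr] at hk hkx
      · exact absurd hkx.symm (hz0 _)
      · left; rw [hy k hk i hi (hzinj _ _ hkx)]
      · right; rw [hy k hk j hj (by have := hzinj _ _ hkx; omega)]
    · exact absurd hx (hz0 _)
    · have e := hzinj _ _ hx
      refine ⟨?_, ?_⟩
      · simp only [x, Sum.elim_inr, e]
        exact hD i hi j hj (by omega)
      rintro (k | k | k) hk hkx <;>
        simp only [S, x, hR, Finset.inl_mem_disjSum, Finset.inr_mem_disjSum, Finset.mem_singleton,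
          Finset.mem_range, Sum.elim_inl, Sum.elim_inr] at hk hkx
      · exact absurd hkx.symm (hz0 _)
      · right; rw [hy k hk j hj (by have := hzinj _ _ hkx; omega)]
      · left; rw [hy k hk i hi (by have := hzinj _ _ hkx; omega)]
    · exact absurd (by rw [hy i hi j hj (by have := hzinj _ _ hx; omega)]) hij
  rw [hcard, show 2 * n + 3 - 1 = P.natDegree by rw [hdegP]; rfl, hmon.coeff_natDegree,
    Finset.sum_disjSum, Finset.sum_singleton, Finset.sum_disjSum] at key
  have er0 : S.erase (Sum.inl 0) = (∅ : Finset ℕ).disjSum (R.disjSum R) := by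
    ext (i | i | i) <;> simp [S]
  have er1 : ∀ a, S.erase (Sum.inr (Sum.inl a)) =
      ({0} : Finset ℕ).disjSum ((R.erase a).disjSum R) := fun a => by
    ext (i | i | i) <;> simp [S]
  have er2 : ∀ a, S.erase (Sum.inr (Sum.inr a)) =
      ({0} : Finset ℕ).disjSum (R.disjSum (R.erase a)) := fun a => by
    ext (i | i | i) <;> simp [S]
  simp only [er0, er1, er2, Finset.prod_disjSum, Finset.prod_singleton, Finset.prod_empty, one_mul]
    at key
  simp only [x, Sum.elim_inl, Sum.elim_inr] at key
  set U := ∑ k ∈ Finset.range (n + 2), u k with hU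
  set D := ∑ k ∈ Finset.range n, d k with hD
  set Y := ∑ k ∈ R, y k with hY
  have hRc : R.card = n + 1 := Finset.card_range _
  have node0 : P.eval 0 / ((∏ k ∈ R, (0 - z (y k))) * ∏ k ∈ R, (0 - z (y k - 1))) =
      q ^ (-2 * (2 * Y - U - D - 1)) := by
    have en : ∀ (s : Finset ℕ) (v : ℕ → ℤ), ∏ k ∈ s, (0 - z (v k)) =
        (-1) ^ s.card * q ^ (2 * ∑ k ∈ s, v k) := fun s v => by
      simp only [zero_sub, z]
      rw [Finset.prod_neg, prod_zpow_eq h0, Finset.mul_sum]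
    have eP : P.eval 0 = (∏ k ∈ Finset.range (n + 2), (0 - z (u k))) *
        ∏ k ∈ Finset.range n, (0 - z (d k - 1)) := by
      simp only [P, eval_mul, eval_prod, eval_sub, eval_X, eval_C]
    rw [eP, en, en, en, en, Finset.sum_sub_distrib,
      Finset.sum_sub_distrib, ← hU, ← hD, ← hY, hRc, Finset.card_range, Finset.card_range,
      Finset.sum_const, Finset.sum_const, hRc, Finset.card_range, div_eq_iff (by
        exact mul_ne_zero (mul_ne_zero (by simp) (zpow_ne_zero _ h0))
          (mul_ne_zero (by simp) (zpow_ne_zero _ h0)))]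
    have e : q ^ (2 * U) * q ^ (2 * (D - n • 1)) =
        q ^ (-2 * (2 * Y - U - D - 1)) * (q ^ (2 * Y) * q ^ (2 * (Y - (n + 1) • 1))) := by
      simp only [← zpow_add₀ h0]
      congr 1
      simp
      ring
    have s1 : ((-1 : K) ^ n) ^ 2 = 1 := by rw [← pow_mul, mul_comm, pow_mul]; simp
    rw [pow_add, pow_add]
    linear_combination ((-1 : K) ^ n) ^ 2 * e
  have yer : ∀ a ∈ R, ∑ k ∈ R.erase a, y k = Y - y a := fun a ha => by
    rw [hY, ← Finset.add_sum_erase R y ha]; ring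
  have cer : ∀ a ∈ R, (R.erase a).card = n := fun a ha => by
    rw [Finset.card_erase_of_mem ha, hRc]; rfl
  have nodep : ∀ a ∈ R, P.eval (z (y a)) / ((z (y a) - 0) *
      ((∏ k ∈ R.erase a, (z (y a) - z (y k))) * ∏ k ∈ R, (z (y a) - z (y k - 1)))) =
      c * q ^ (-(2 * Y - U - D - 1)) *
      (prodDiff q (Finset.range (n + 2)) u (y a) * prodDiff q (Finset.range n) d (y a + 1) /
        (prodDiff q (R.erase a) y (y a) * prodDiff q (R.erase a) y (y a + 1))) := fun a ha => by
    rw [heval]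
    simp only [z]
    rw [prod_zpow_two_mul_sub hq _ y, prod_zpow_two_mul_sub hq _ (fun k => y k - 1), prodDiff_sub,
      prodDiff_erase q ha y, Finset.sum_sub_distrib, yer a ha, cer a ha, hRc, ← hY, ← hc,
      show y a - (y a + 1) = -1 by ring, qInt_neg, qInt_one hq, Finset.sum_const, hRc]
    have e : q ^ ((2 * (n : ℤ) + 2) * y a + U + D - n) =
        q ^ (-(2 * Y - U - D - 1)) * (q ^ (2 * y a) * (q ^ (n * y a + (Y - y a)) *
          q ^ (((n + 1 : ℕ) : ℤ) * y a + (Y - (n + 1) • 1)))) := by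
      simp only [← zpow_add₀ h0]
      congr 1
      simp
      ring
    rw [e, sub_zero]
    generalize prodDiff q (R.erase a) y (y a) = A
    generalize prodDiff q (R.erase a) y (y a + 1) = B
    generalize prodDiff q (Finset.range (n + 2)) u (y a) * prodDiff q (Finset.range n) d (y a + 1) = N
    have f1 : (-c) ^ (2 * n + 2) = c * (c * (-c) ^ (2 * n)) := by ring
    rw [f1]
    have hcn : (-c) ^ (2 * n) ≠ 0 := pow_ne_zero _ (neg_ne_zero.mpr h1)
    have g1 := zpow_ne_zero (2 * y a) h0
    have g2 := zpow_ne_zero (n * y a + (Y - y a)) h0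
    have g3 := zpow_ne_zero (((n + 1 : ℕ) : ℤ) * y a + (Y - (n + 1) • 1)) h0
    generalize q ^ (n * y a + (Y - y a)) = x2 at *
    generalize q ^ (((n + 1 : ℕ) : ℤ) * y a + (Y - (n + 1) • 1)) = x3 at *
    generalize q ^ (2 * y a) = x1 at *
    rw [show x1 * ((-c) ^ n * x2 * A * ((-c) ^ (n + 1) * x3 * (-1 * B))) =
      (c * (-c) ^ (2 * n) * x1 * x2 * x3) * (A * B) by ring, 
      show ∀ Q, c * (c * (-c) ^ (2 * n)) * (Q * (x1 * (x2 * x3))) * N = 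
        (c * (-c) ^ (2 * n) * x1 * x2 * x3) * (c * Q * N) by intro Q; ring,
      mul_div_mul_left _ _ (by simp [h1, g1, g2, g3]), mul_div_assoc]
  have nodem : ∀ a ∈ R, P.eval (z (y a - 1)) / ((z (y a - 1) - 0) *
      ((∏ k ∈ R, (z (y a - 1) - z (y k))) * ∏ k ∈ R.erase a, (z (y a - 1) - z (y k - 1)))) =
      -(c * q ^ (-(2 * Y - U - D - 1)) *
      (prodDiff q (Finset.range (n + 2)) u (y a - 1) * prodDiff q (Finset.range n) d (y a) /
        (prodDiff q (R.erase a) y (y a - 1) * prodDiff q (R.erase a) y (y a)))) := fun a ha => by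
    rw [heval]
    simp only [z]
    rw [prod_zpow_two_mul_sub hq _ y, prod_zpow_two_mul_sub hq _ (fun k => y k - 1), prodDiff_sub,
      prodDiff_erase q ha y, Finset.sum_sub_distrib, yer a ha, cer a ha, hRc, ← hY, ← hc,
      show y a - (y a - 1) = 1 by ring, qInt_one hq, Finset.sum_const, cer a ha,
      show y a - 1 + 1 = y a by ring]
    have e : q ^ ((2 * (n : ℤ) + 2) * (y a - 1) + U + D - n) =
        q ^ (-(2 * Y - U - D - 1)) * (q ^ (2 * (y a - 1)) *
          (q ^ (((n + 1 : ℕ) : ℤ) * (y a - 1) + Y) * q ^ (n * (y a - 1) + (Y - y a - n • 1)))) := by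
      simp only [← zpow_add₀ h0]
      congr 1
      simp
      ring
    rw [e, sub_zero]
    generalize prodDiff q (R.erase a) y (y a) = A
    generalize prodDiff q (R.erase a) y (y a - 1) = B
    generalize prodDiff q (Finset.range (n + 2)) u (y a - 1) * prodDiff q (Finset.range n) d (y a) = N
    have f1 : (-c) ^ (2 * n + 2) = c * (c * (-c) ^ (2 * n)) := by ring
    rw [f1]
    have hcn : (-c) ^ (2 * n) ≠ 0 := pow_ne_zero _ (neg_ne_zero.mpr h1)
    have g1 := zpow_ne_zero (2 * (y a - 1)) h0
    have g2 := zpow_ne_zero (n * (y a - 1) + (Y - y a - n • 1)) h0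
    have g3 := zpow_ne_zero (((n + 1 : ℕ) : ℤ) * (y a - 1) + Y) h0
    generalize q ^ (n * (y a - 1) + (Y - y a - n • 1)) = x2 at *
    generalize q ^ (((n + 1 : ℕ) : ℤ) * (y a - 1) + Y) = x3 at *
    generalize q ^ (2 * (y a - 1)) = x1 at *
    rw [show x1 * ((-c) ^ (n + 1) * x3 * (1 * B) * ((-c) ^ n * x2 * A)) =
      (c * (-c) ^ (2 * n) * x1 * x2 * x3) * (-(B * A)) by ring, 
      show ∀ Q, c * (c * (-c) ^ (2 * n)) * (Q * (x1 * (x3 * x2))) * N = 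
        (c * (-c) ^ (2 * n) * x1 * x2 * x3) * (c * Q * N) by intro Q; ring,
      mul_div_mul_left _ _ (by simp [h1, g1, g2, g3]), div_neg, mul_div_assoc]
  rw [node0, Finset.sum_congr rfl nodep, Finset.sum_congr rfl nodem, Finset.sum_neg_distrib,
    ← Finset.mul_sum, ← Finset.mul_sum, ← sub_eq_add_neg, ← mul_sub, ← Finset.sum_sub_distrib]
    at key
  rw [qInt, eq_div_iff h1]
  have hx := zpow_ne_zero (-(2 * Y - U - D - 1)) h0
  apply mul_left_cancel₀ hx
  have e1 : q ^ (-(2 * Y - U - D - 1)) * q ^ (2 * Y - U - D - 1) = 1 := by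
    rw [← zpow_add₀ h0, neg_add_cancel, zpow_zero]
  have e2 : q ^ (-(2 * Y - U - D - 1)) * q ^ (-(2 * Y - U - D - 1)) =
      q ^ (-2 * (2 * Y - U - D - 1)) := by
    rw [← zpow_add₀ h0]
    congr 1
    ring
  linear_combination key - e1 + e2

end PartialFractions

/-! ### Diagonal operators, Cartan elements and the rank one relations -/

section DiagOp

variable {K ι : Type*} [Field K]

/-- The diagonal operator with eigenvalues `w`. -/
noncomputable def diagOp (w : Arr → K) : Module.End K (Arr →₀ K) :=
  Finsupp.linearCombination K fun l => Finsupp.single l (w l)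

theorem diagOp_single (w : Arr → K) (l : Arr) (x : K) :
    diagOp w (Finsupp.single l x) = Finsupp.single l (x * w l) := by
  simp [diagOp]

theorem diagOp_mul (w w' : Arr → K) : diagOp w * diagOp w' = diagOp fun l => w l * w' l :=
  end_ext fun l => by
    simp only [Module.End.mul_apply, diagOp_single, one_mul]
    rw [mul_comm]

theorem commute_diagOp (w w' : Arr → K) : Commute (diagOp w) (diagOp w') := by
  rw [Commute, SemiconjBy, diagOp_mul, diagOp_mul]
  simp only [mul_comm]

theorem diagOp_mul_rowOp {s : Finset ι} {c : Arr → ι → K} {v : ι → Arr} {w : Arr → K} (t : K)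
    (H : ∀ l, ∀ a ∈ s, c l a ≠ 0 → w (l + v a) = t * w l) :
    diagOp w * rowOp s c v = t • (rowOp s c v * diagOp w) := by
  refine end_ext fun l => ?_
  simp only [Module.End.mul_apply, LinearMap.smul_apply, rowOp_single, diagOp_single, map_sum,
    one_mul, Finset.smul_sum, Finsupp.smul_single, smul_eq_mul]
  refine Finset.sum_congr rfl fun a ha => ?_
  by_cases h : c l a = 0
  · simp [h]
  · rw [H l a ha h]
    congr 1
    ring

end DiagOp

section Triple

variable {K : Type*} [Field K]

/-- The exponent of the Cartan element attached to the row `n + 1`. -/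
def cartan (n : ℕ) (l : Arr) : ℤ :=
  2 * ∑ k ∈ Finset.range (n + 1), l (n + 1) k - ∑ k ∈ Finset.range (n + 2), l (n + 2) k -
    ∑ k ∈ Finset.range n, l n k - 1

open Classical in
/-- `q ^ (σ H)` on interlaced arrays, where `H` is the Cartan element attached to the row `n + 1`. -/
noncomputable def cartanOp (q : K) (σ : ℤ) (n : ℕ) : Module.End K (Arr →₀ K) :=
  diagOp fun l => if Interlaced l then q ^ (σ * cartan n l) else 0

theorem sum_add_cell (l : Arr) (r s : ℕ) {a : ℕ} (ha : a < s) (σ : ℤ) :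
    ∑ k ∈ Finset.range r, (l + σ • cell s a) r k =
      ∑ k ∈ Finset.range r, l r k + if r = s then σ else 0 := by
  simp only [Pi.add_apply, Finset.sum_add_distrib, Pi.smul_apply, cell, smul_eq_mul]
  congr 1
  split_ifs with h
  · subst h
    rw [Finset.sum_eq_single_of_mem a (Finset.mem_range.mpr ha)] <;> simp +contextual
  · simp [h]

theorem cartan_add_cell (n : ℕ) (l : Arr) {s a : ℕ} (ha : a < s) (σ : ℤ) :
    cartan n (l + σ • cell s a) = cartan n l +
      (if s = n + 1 then 2 * σ else if s = n ∨ s = n + 2 then -σ else 0) := by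
  simp only [cartan, sum_add_cell l _ s ha]
  split_ifs <;> omega

theorem coef_ne_zero {q : K} {r r' : ℕ} {σ : ℤ} {l : Arr} {a : ℕ} (h : coef q r r' σ l a ≠ 0) :
    Interlaced l ∧ Interlaced (l + σ • cell r a) := by
  by_contra hn
  exact h (if_neg hn)

/-- A nonzero `coef` has interlaced arrays at both ends, so the truncation in `cartanOp` never
interferes with the weight count. -/
theorem cartanOp_mul_moveOp {q : K} (h0 : q ≠ 0) (τ : ℤ) (n : ℕ) (r r' : ℕ) (σ : ℤ) (d : ℤ)
    (hd : d = τ * (if r = n + 1 then 2 * σ else if r = n ∨ r = n + 2 then -σ else 0)) :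
    cartanOp q τ n * moveOp q r r' σ = (q ^ d) • (moveOp q r r' σ * cartanOp q τ n) := by
  refine diagOp_mul_rowOp _ fun l a ha hc => ?_
  obtain ⟨h1, h2⟩ := coef_ne_zero hc
  rw [if_pos h1, if_pos h2, cartan_add_cell n l (Finset.mem_range.mp ha), ← zpow_add₀ h0, hd]
  congr 1
  ring

/-- A single move fails only by hitting an entry of a neighbouring row. The doubled equations treat
both signs at once; which side is off by one reflects the half-strict convention of `Interlaced`. -/
theorem not_interlaced_add_cell {l : Arr} (hl : Interlaced l) {n a : ℕ} (ha : a < n + 1)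
    {σ : ℤ} (hσ : σ = 1 ∨ σ = -1) (hn : ¬ Interlaced (l + σ • cell (n + 1) a)) :
    (∃ k < n + 2, 2 * l (n + 2) k = 2 * l (n + 1) a + σ - 1) ∨
      ∃ k < n, 2 * l n k = 2 * l (n + 1) a + σ + 1 := by
  by_contra hcon
  push Not at hcon
  obtain ⟨h1, h2⟩ := hcon
  refine hn fun p i j hi hj => ?_
  have h := hl p i j hi hj
  simp only [Pi.add_apply, Pi.smul_apply, cell, smul_eq_mul]
  by_cases e1 : p = n + 1
  · subst e1
    have := h1 i hi
    have := @Interlaced.ne l hl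
    rcases hσ with rfl | rfl <;> grind
  · by_cases e2 : p = n
    · subst e2
      have := h2 j hj
      rcases hσ with rfl | rfl <;> grind
    · grind

/-- The formula needs no condition on the array in between: if that array is not interlaced, one of
the two numerators vanishes. -/
theorem moveOp_diagonal (q : K) {n : ℕ} {l : Arr} (hl : Interlaced l) {a : ℕ}
    (ha : a < n + 1) :
    coef q (n + 1) (n + 2) 1 l a * coef q (n + 1) n (-1) (l + (1 : ℤ) • cell (n + 1) a) a =
      prodDiff q (Finset.range (n + 2)) (l (n + 2)) (l (n + 1) a) *
        prodDiff q (Finset.range n) (l n) (l (n + 1) a + 1) /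
        (prodDiff q ((Finset.range (n + 1)).erase a) (l (n + 1)) (l (n + 1) a) *
          prodDiff q ((Finset.range (n + 1)).erase a) (l (n + 1)) (l (n + 1) a + 1)) := by
  have e : l + (1 : ℤ) • cell (n + 1) a + (-1 : ℤ) • cell (n + 1) a = l := by
    rw [add_assoc, ← add_smul]; simp
  have e1 : raw q (n + 1) n (l + (1 : ℤ) • cell (n + 1) a) a =
      prodDiff q (Finset.range n) (l n) (l (n + 1) a + 1) /
        prodDiff q ((Finset.range (n + 1)).erase a) (l (n + 1)) (l (n + 1) a + 1) := by
    rw [raw, add_cell_apply_self, add_cell_of_ne _ (by omega), prodDiff_congr q (u :=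
      (l + (1 : ℤ) • cell (n + 1) a) (n + 1)) (v := l (n + 1)) _ fun i hi =>
        add_cell_apply_of_ne _ _ (Finset.ne_of_mem_erase hi) _]
  rw [mul_div_mul_comm, ← e1]
  change _ = raw q (n + 1) (n + 2) l a * _
  refine coef_mul_coef q hl (by rwa [e]) fun h => ?_
  rcases not_interlaced_add_cell hl ha (Or.inl rfl) h with ⟨k, hk, h⟩ | ⟨k, hk, h⟩
  · rw [raw_eq_zero q hk (by omega), zero_mul]
  · rw [raw_eq_zero q (k := k) hk, mul_zero]
    rw [add_cell_apply_self, add_cell_of_ne _ (by omega)]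
    omega

theorem moveOp_diagonal' (q : K) {n : ℕ} {l : Arr} (hl : Interlaced l) {a : ℕ}
    (ha : a < n + 1) :
    coef q (n + 1) n (-1) l a * coef q (n + 1) (n + 2) 1 (l + (-1 : ℤ) • cell (n + 1) a) a =
      prodDiff q (Finset.range (n + 2)) (l (n + 2)) (l (n + 1) a - 1) *
        prodDiff q (Finset.range n) (l n) (l (n + 1) a) /
        (prodDiff q ((Finset.range (n + 1)).erase a) (l (n + 1)) (l (n + 1) a - 1) *
          prodDiff q ((Finset.range (n + 1)).erase a) (l (n + 1)) (l (n + 1) a)) := by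
  have e : l + (-1 : ℤ) • cell (n + 1) a + (1 : ℤ) • cell (n + 1) a = l := by
    rw [add_assoc, ← add_smul]; simp
  have e1 : raw q (n + 1) (n + 2) (l + (-1 : ℤ) • cell (n + 1) a) a =
      prodDiff q (Finset.range (n + 2)) (l (n + 2)) (l (n + 1) a - 1) /
        prodDiff q ((Finset.range (n + 1)).erase a) (l (n + 1)) (l (n + 1) a - 1) := by
    rw [raw, add_cell_apply_self, add_cell_of_ne _ (by omega), prodDiff_congr q (u :=
      (l + (-1 : ℤ) • cell (n + 1) a) (n + 1)) (v := l (n + 1)) _ fun i hi =>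
        add_cell_apply_of_ne _ _ (Finset.ne_of_mem_erase hi) _, ← sub_eq_add_neg]
  rw [mul_div_mul_comm, ← e1, mul_comm (raw q (n + 1) (n + 2) _ a)]
  change _ = raw q (n + 1) n l a * _
  refine coef_mul_coef q hl (by rwa [e]) fun h => ?_
  rcases not_interlaced_add_cell hl ha (Or.inr rfl) h with ⟨k, hk, h⟩ | ⟨k, hk, h⟩
  · rw [raw_eq_zero q (r := n + 1) (r' := n + 2) (k := k) hk, mul_zero]
    rw [add_cell_apply_self, add_cell_of_ne _ (by omega)]
    omega
  · rw [raw_eq_zero q hk (by omega), zero_mul]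

/-- The two moves see each other only through one denominator bracket each; exchanging the order
changes the sign of both. -/
theorem moveOp_off_diagonal (q : K) {n : ℕ} {l : Arr} {a b : ℕ}
    (ha : a < n + 1) (hb : b < n + 1) (hab : a ≠ b) :
    coef q (n + 1) (n + 2) 1 l a * coef q (n + 1) n (-1) (l + (1 : ℤ) • cell (n + 1) a) b =
    coef q (n + 1) n (-1) l b * coef q (n + 1) (n + 2) 1 (l + (-1 : ℤ) • cell (n + 1) b) a := by
  by_cases hlf : Interlaced l ∧ Interlaced (l + (1 : ℤ) • cell (n + 1) a + (-1 : ℤ) • cell (n + 1) b)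
  swap
  · rw [coef_mul_coef_of_not q hlf, coef_mul_coef_of_not q (by rwa [add_right_comm])]
  obtain ⟨hl, hf⟩ := hlf
  have h1 : Interlaced (l + (1 : ℤ) • cell (n + 1) a) :=
    interlaced_of_far (by simp [hab]) (by simp) (by simp) hl hf
  have h2 : Interlaced (l + (-1 : ℤ) • cell (n + 1) b) := by
    rw [add_right_comm] at hf
    exact interlaced_of_far (by simp [hab.symm]) (by simp) (by simp) hl hf
  rw [coef_mul_coef q hl hf fun h => absurd h1 h,
    coef_mul_coef q hl (by rwa [add_right_comm]) fun h => absurd h2 h]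
  obtain ⟨A, hA⟩ := exists_raw_eq_div q (n + 2) l hb hab
  obtain ⟨B, hB⟩ := exists_raw_eq_div q n l ha hab.symm
  rw [hA l (fun _ _ => rfl) rfl, hB l (fun _ _ => rfl) rfl,
    hB _ (fun i hi => add_cell_apply_of_ne l _ hi _) (add_cell_of_ne l (by omega) _ _),
    hA _ (fun i hi => add_cell_apply_of_ne l _ hi _) (add_cell_of_ne l (by omega) _ _),
    add_cell_apply_self, add_cell_apply_self,
    show l (n + 1) b + -1 - l (n + 1) a = -(l (n + 1) a + 1 - l (n + 1) b) by ring,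
    show l (n + 1) b - l (n + 1) a = -(l (n + 1) a - l (n + 1) b) by ring, qInt_neg, qInt_neg,
    div_neg, div_neg]
  ring

theorem sum_coef_mul_coef_sub {q : K} (hq : Generic q) (n : ℕ) {l : Arr} (hl : Interlaced l) :
    ∑ a ∈ Finset.range (n + 1),
      (coef q (n + 1) (n + 2) 1 l a * coef q (n + 1) n (-1) (l + (1 : ℤ) • cell (n + 1) a) a -
      coef q (n + 1) n (-1) l a * coef q (n + 1) (n + 2) 1 (l + (-1 : ℤ) • cell (n + 1) a) a) =
      qInt q (cartan n l) := by
  rw [cartan, ← sum_prodDiff_sub_eq_qInt hq]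
  · refine Finset.sum_congr rfl fun a ha => ?_
    rw [moveOp_diagonal q hl (Finset.mem_range.mp ha), moveOp_diagonal' q hl (Finset.mem_range.mp ha)]
  · intro a ha b hb h
    by_contra hab
    exact hl.ne ha hb hab h
  -- Two entries of a row at distance one pin the entries between them in both neighbouring rows;
  -- this is the double zero needed where nodes collide.
  · intro a ha b hb h
    have hab : a < b := by
      by_contra hba
      rcases lt_or_eq_of_le (not_lt.mp hba) with h' | h'
      · have := hl.lt ha h'
        omega
      · subst h'; omega
    have h1 : l (n + 1) b ≤ l (n + 2) b := (hl (n + 1) b b (by omega) hb).1 le_rfl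
    have h2 : l (n + 2) b < l (n + 1) a := (hl (n + 1) b a (by omega) ha).2 hab
    have h3 := (hl n a a (by omega) (by omega)).1 le_rfl
    have h4 := (hl n b a (by omega) (by omega)).2 hab
    exact ⟨⟨b, by omega, by omega⟩, ⟨a, by omega, by omega⟩⟩

/-- Off-diagonal terms cancel in pairs and the diagonal is the partial fraction identity. On arrays
that are not interlaced all moves vanish, hence the truncation of the Cartan operators, which makes
them non-invertible. -/
theorem moveOp_mul_sub {q : K} (hq : Generic q) (n : ℕ) :
    (q - q⁻¹) • (moveOp q (n + 1) n (-1) * moveOp q (n + 1) (n + 2) 1 -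
      moveOp q (n + 1) (n + 2) 1 * moveOp q (n + 1) n (-1)) =
      cartanOp q 1 n - cartanOp q (-1) n := by
  refine end_ext fun l => ?_
  have e1 : ∀ a, l + (1 : ℤ) • cell (n + 1) a + (-1 : ℤ) • cell (n + 1) a = l := fun a => by
    rw [add_assoc, ← add_smul]; simp
  have e2 : ∀ a, l + (-1 : ℤ) • cell (n + 1) a + (1 : ℤ) • cell (n + 1) a = l := fun a => by
    rw [add_assoc, ← add_smul]; simp
  have e : (moveOp q (n + 1) n (-1) * moveOp q (n + 1) (n + 2) 1 -
      moveOp q (n + 1) (n + 2) 1 * moveOp q (n + 1) n (-1)) (Finsupp.single l 1) =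
      Finsupp.single l (∑ a ∈ Finset.range (n + 1),
      (coef q (n + 1) (n + 2) 1 l a * coef q (n + 1) n (-1) (l + (1 : ℤ) • cell (n + 1) a) a -
      coef q (n + 1) n (-1) l a * coef q (n + 1) (n + 2) 1 (l + (-1 : ℤ) • cell (n + 1) a) a)) := by
    simp only [moveOp, LinearMap.sub_apply, Module.End.mul_apply, rowOp_single, map_sum, one_mul]
    nth_rewrite 2 [Finset.sum_comm]
    rw [← Finset.sum_sub_distrib, ← Finsupp.singleAddHom_apply, map_sum]
    refine Finset.sum_congr rfl fun a ha => ?_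
    rw [← Finset.sum_sub_distrib, Finset.sum_eq_single_of_mem a ha]
    · rw [e1, e2, ← Finsupp.single_sub]; rfl
    · intro b hb hba
      rw [moveOp_off_diagonal q (Finset.mem_range.mp ha) (Finset.mem_range.mp hb) hba.symm,
        add_right_comm, sub_self]
  rw [LinearMap.smul_apply, e]
  simp only [cartanOp, LinearMap.sub_apply, diagOp_single, Finsupp.smul_single, smul_eq_mul,
    one_mul, ← Finsupp.single_sub, neg_mul]
  congr 1
  split_ifs with hl
  · rw [sum_coef_mul_coef_sub hq n hl, qInt, mul_div_cancel₀ _ hq.sub_inv_ne_zero]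
  · simp [coef_of_not_left q hl]

end Triple

/-! ### Two-sided generators inside a one-sided chain -/

section System

variable {K A : Type*} [Field K] [Ring A] [Algebra K A]

/-- Chevalley generators of type `A`, with Cartan elements `k`, `k'` that need not be invertible,
and an invertible element `κ` that twists the first generator. -/
structure IsSystem (q : K) (e f k k' : ℕ → A) (κ κ' : A) : Prop where
  ne_zero : q ≠ 0
  sub_ne_zero : q - q⁻¹ ≠ 0
  add_ne_zero : q + q⁻¹ ≠ 0
  triple : ∀ p, IsTriple q (e p) (f p) (k p) (k' p)
  link : ∀ p, IsLink q (e p) (f p) (k p) (k' p) (e (p + 1)) (f (p + 1))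
  link' : ∀ p, IsLink q (e (p + 1)) (f (p + 1)) (k (p + 1)) (k' (p + 1)) (e p) (f p)
  serre_e : ∀ p, serrePoly (q + q⁻¹) (e p) (e (p + 1)) = 0
  serre_e' : ∀ p, serrePoly (q + q⁻¹) (e (p + 1)) (e p) = 0
  serre_f : ∀ p, serrePoly (q + q⁻¹) (f p) (f (p + 1)) = 0
  serre_f' : ∀ p, serrePoly (q + q⁻¹) (f (p + 1)) (f p) = 0
  far_e : ∀ p r, p + 1 < r → Commute (e p) (e r)
  far_f : ∀ p r, p + 1 < r → Commute (f p) (f r)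
  e_f : ∀ p r, p ≠ r → Commute (e p) (f r)
  k_k : ∀ p r, Commute (k p) (k r)
  k_k' : ∀ p r, Commute (k p) (k' r)
  k'_k' : ∀ p r, Commute (k' p) (k' r)
  twist_mul : κ * κ' = 1
  twist_mul' : κ' * κ = 1
  twist_e : κ * e 0 = q⁻¹ • (e 0 * κ)
  twist_f : κ * f 0 = q • (f 0 * κ)
  twist_e' : κ' * e 0 = q • (e 0 * κ')
  twist_f' : κ' * f 0 = q⁻¹ • (f 0 * κ')
  comm_e : ∀ p, Commute κ (e (p + 1))
  comm_f : ∀ p, Commute κ (f (p + 1))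
  comm_e' : ∀ p, Commute κ' (e (p + 1))
  comm_f' : ∀ p, Commute κ' (f (p + 1))

/-- `q` for even `p` and `q⁻¹` for odd `p`. -/
noncomputable def alt (q : K) (p : ℕ) : K := if Even p then q else q⁻¹

theorem alt_succ (q : K) (p : ℕ) : alt q (p + 1) = (alt q p)⁻¹ := by
  unfold alt
  by_cases h : Even p <;> simp [h, Nat.even_add_one]

theorem alt_ne_zero {q : K} (h : q ≠ 0) (p : ℕ) : alt q p ≠ 0 := by
  unfold alt; split_ifs <;> simp [h]

theorem alt_add_inv (q : K) (p : ℕ) : alt q p + (alt q p)⁻¹ = q + q⁻¹ := by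
  unfold alt; split_ifs <;> simp [add_comm]

/-- The `q`-commutators of consecutive generators, with alternating parameters. -/
noncomputable def gen (q : K) (e : ℕ → A) (κ : A) : ℕ → A
  | 0 => e 0 * κ
  | p + 1 => qComm (alt q (p + 1)) (e p) (e (p + 1))

namespace IsSystem

variable {q : K} {e f k k' : ℕ → A} {κ κ' : A}

theorem swap (S : IsSystem q e f k k' κ κ') : IsSystem q f e k' k κ' κ where
  ne_zero := S.ne_zero
  sub_ne_zero := S.sub_ne_zero
  add_ne_zero := S.add_ne_zero
  triple p := (S.triple p).swap
  link p := (S.link p).swap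
  link' p := (S.link' p).swap
  serre_e := S.serre_f
  serre_e' := S.serre_f'
  serre_f := S.serre_e
  serre_f' := S.serre_e'
  far_e := S.far_f
  far_f := S.far_e
  e_f p r h := (S.e_f r p h.symm).symm
  k_k := S.k'_k'
  k_k' p r := (S.k_k' r p).symm
  k'_k' := S.k_k
  twist_mul := S.twist_mul'
  twist_mul' := S.twist_mul
  twist_e := S.twist_f'
  twist_f := S.twist_e'
  twist_e' := S.twist_f
  twist_f' := S.twist_e
  comm_e := S.comm_f'
  comm_f := S.comm_e'
  comm_e' := S.comm_f
  comm_f' := S.comm_e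

/-- The relations hold for `q` as well as for `q⁻¹`. -/
theorem exists_alt (S : IsSystem q e f k k' κ κ') (r : ℕ) :
    ∃ l l' : ℕ → A, (∀ p, IsTriple (alt q r) (e p) (f p) (l p) (l' p)) ∧
      (∀ p, IsLink (alt q r) (e p) (f p) (l p) (l' p) (e (p + 1)) (f (p + 1))) ∧
      (∀ p, IsLink (alt q r) (e (p + 1)) (f (p + 1)) (l (p + 1)) (l' (p + 1)) (e p) (f p)) := by
  by_cases h : Even r
  · rw [alt, if_pos h]
    exact ⟨k, k', S.triple, S.link, S.link'⟩
  · rw [alt, if_neg h]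
    exact ⟨k', k, fun p => (S.triple p).inv, fun p => (S.link p).inv, fun p => (S.link' p).inv⟩

theorem alt_sub_ne_zero (S : IsSystem q e f k k' κ κ') (r : ℕ) :
    alt q r - (alt q r)⁻¹ ≠ 0 := by
  unfold alt
  split_ifs
  · exact S.sub_ne_zero
  · rw [inv_inv, ← neg_sub]
    exact neg_ne_zero.mpr S.sub_ne_zero

theorem alt_add_ne_zero (S : IsSystem q e f k k' κ κ') (r : ℕ) :
    alt q r + (alt q r)⁻¹ ≠ 0 := by
  rw [alt_add_inv]
  exact S.add_ne_zero

theorem alt_one (q : K) : alt q 1 = q⁻¹ := if_neg (by decide)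

theorem commute_gen {x : A} {p : ℕ} (h0 : p = 0 → Commute x κ)
    (h : ∀ r, r = p ∨ r + 1 = p → Commute x (e r)) : Commute x (gen q e κ p) := by
  cases p with
  | zero => exact (h 0 (Or.inl rfl)).mul_right (h0 rfl)
  | succ p => exact commute_qComm _ (h p (Or.inr rfl)) (h (p + 1) (Or.inl rfl))

theorem commute_gen_gen_of_far (S : IsSystem q e f k k' κ κ') {p r : ℕ} (h : p + 2 < r) :
    Commute (gen q e κ p) (gen q e κ r) := by
  refine commute_gen (fun h0 => by omega) fun s hs => (commute_gen (fun h0 => ?_) fun u hu => ?_).symm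
  · obtain ⟨s, rfl⟩ : ∃ v, s = v + 1 := ⟨s - 1, by omega⟩
    exact (S.comm_e s).symm
  · exact (S.far_e u s (by omega)).symm

theorem commute_gen_gen'_of_far (S : IsSystem q e f k k' κ κ') {p r : ℕ} (h : p + 1 < r) :
    Commute (gen q e κ p) (gen q f κ' r) := by
  refine commute_gen (fun h0 => by omega) fun s hs => (commute_gen (fun h0 => ?_) fun u hu => ?_).symm
  · obtain ⟨s, rfl⟩ : ∃ v, s = v + 1 := ⟨s - 1, by omega⟩
    exact (S.comm_f s).symm
  · exact (S.e_f u s (by omega)).symm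

/-- Consecutive parameters are inverse to each other, as `commute_qComm_qComm` requires; at the end
of the chain the twist takes over this role. -/
theorem commute_gen_gen_succ (S : IsSystem q e f k k' κ κ') (p : ℕ) :
    Commute (gen q e κ p) (gen q e κ (p + 1)) := by
  cases p with
  | zero =>
    refine commute_twist_qComm (alt_ne_zero S.ne_zero 1) ?_ ?_ (S.comm_e 0)
    · rw [alt_add_inv]
      exact S.serre_e 0
    · rw [alt_one]
      exact S.twist_e
  | succ p =>
    simp only [gen]
    rw [alt_succ q (p + 1)]
    refine commute_qComm_qComm (alt_ne_zero S.ne_zero _) (S.alt_add_ne_zero _)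
      (S.far_e p (p + 2) (by omega)) ?_ ?_
    · rw [alt_add_inv]
      exact S.serre_e' p
    · rw [alt_add_inv]
      exact S.serre_e (p + 1)

theorem commute_gen_gen'_succ (S : IsSystem q e f k k' κ κ') (p : ℕ) :
    Commute (gen q e κ (p + 1)) (gen q f κ' (p + 2)) := by
  obtain ⟨l, l', h1, h2, h3⟩ := S.exists_alt (p + 1)
  simp only [gen]
  rw [alt_succ q (p + 1)]
  exact commute_qComm_qComm_mixed (alt_ne_zero S.ne_zero _) (S.alt_sub_ne_zero _) (h1 (p + 1))
    (h2 p) (h3 p) (h2 (p + 1)) (S.e_f p (p + 2) (by omega))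

/-- Generators of different parity commute. -/
theorem commute_gen_gen (S : IsSystem q e f k k' κ κ') {p r : ℕ} (h : p % 2 ≠ r % 2) :
    Commute (gen q e κ p) (gen q e κ r) := by
  wlog hpr : p < r generalizing p r
  · exact (this h.symm (by omega)).symm
  by_cases h1 : r = p + 1
  · rw [h1]
    exact S.commute_gen_gen_succ p
  · exact S.commute_gen_gen_of_far (by omega)

theorem commute_gen_gen_same (S : IsSystem q e f k k' κ κ') {p r : ℕ} (h : p % 2 = r % 2)
    (h1 : r ≠ p + 2) (h2 : p ≠ r + 2) : Commute (gen q e κ p) (gen q e κ r) := by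
  by_cases hpr : p = r
  · rw [hpr]
  rcases lt_or_gt_of_ne hpr with h' | h'
  · exact S.commute_gen_gen_of_far (by omega)
  · exact (S.commute_gen_gen_of_far (by omega)).symm

theorem commute_gen_gen'_same (S : IsSystem q e f k k' κ κ') {p r : ℕ} (h : p % 2 = r % 2)
    (hpr : p ≠ r) : Commute (gen q e κ p) (gen q f κ' r) := by
  rcases lt_or_gt_of_ne hpr with h' | h'
  · exact S.commute_gen_gen'_of_far (by omega)
  · exact (S.swap.commute_gen_gen'_of_far (by omega)).symm

/-- The second hypothesis excludes the places `0` and `1`, which carry the generators with indices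
`-1` and `0`. Those are neighbours in the two-sided diagram and satisfy Serre relations instead. -/
theorem commute_gen_gen' (S : IsSystem q e f k k' κ κ') {p r : ℕ} (h : p % 2 ≠ r % 2)
    (h' : 1 < p ∨ 1 < r) : Commute (gen q e κ p) (gen q f κ' r) := by
  rcases lt_or_gt_of_ne (show p ≠ r by omega) with hpr | hpr
  · by_cases h1 : r = p + 1
    · obtain ⟨p, rfl⟩ : ∃ v, p = v + 1 := ⟨p - 1, by omega⟩
      rw [h1]
      exact S.commute_gen_gen'_succ p
    · exact S.commute_gen_gen'_of_far (by omega)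
  · by_cases h1 : p = r + 1
    · obtain ⟨r, rfl⟩ : ∃ v, r = v + 1 := ⟨r - 1, by omega⟩
      rw [h1]
      exact (S.swap.commute_gen_gen'_succ r).symm
    · exact (S.swap.commute_gen_gen'_of_far (by omega)).symm

/-- The last factor of the composite at `p + 2` commutes with the composite at `p`, so only the
factor `e (p + 1)` adjacent to it counts; then the composite at `p` acts like a single node next to
`e (p + 1)`. -/
theorem serrePoly_gen_gen_add_two (S : IsSystem q e f k k' κ κ') (p : ℕ) :
    serrePoly (q + q⁻¹) (gen q e κ p) (gen q e κ (p + 2)) = 0 := by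
  refine serrePoly_qComm_right _ _ ?_ ?_
  · refine (commute_gen (fun h0 => (S.comm_e _).symm) fun r hr => ?_).symm
    exact (S.far_e r (p + 2) (by omega)).symm
  · cases p with
    | zero => exact serrePoly_twist_left (t := q⁻¹) _ (S.serre_e 0) S.twist_e (S.comm_e 0)
    | succ p =>
      rw [← alt_add_inv q (p + 1)]
      refine serrePoly_qComm_left (alt_ne_zero S.ne_zero _) (S.alt_add_ne_zero _)
        (S.far_e p (p + 2) (by omega)) ?_ ?_ ?_ <;> rw [alt_add_inv]
      · exact S.serre_e' p
      · exact S.serre_e (p + 1)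
      · exact S.serre_e p

/-- Reversing the `q`-commutators with `qComm_flip` reads the chain from the other end, at the price
of a scalar that the Serre polynomial tolerates. -/
theorem serrePoly_gen_add_two_gen (S : IsSystem q e f k k' κ κ') (p : ℕ) :
    serrePoly (q + q⁻¹) (gen q e κ (p + 2)) (gen q e κ p) = 0 := by
  have e1 : gen q e κ (p + 2) = (-alt q (p + 2)) • qComm (alt q (p + 2))⁻¹ (e (p + 2)) (e (p + 1)) :=
    qComm_flip (alt_ne_zero S.ne_zero _) _ _
  have key : serrePoly (q + q⁻¹) (gen q e κ (p + 2)) (e p) = 0 := by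
    rw [e1, ← one_smul K (e p), serrePoly_smul_smul, ← alt_succ, ← alt_add_inv q (p + 2 + 1)]
    have : serrePoly (alt q (p + 2 + 1) + (alt q (p + 2 + 1))⁻¹)
        (qComm (alt q (p + 2 + 1)) (e (p + 2)) (e (p + 1))) (e p) = 0 := by
      refine serrePoly_qComm_left (alt_ne_zero S.ne_zero _) (S.alt_add_ne_zero _)
        (S.far_e p (p + 2) (by omega)).symm ?_ ?_ ?_ <;> rw [alt_add_inv]
      · exact S.serre_e (p + 1)
      · exact S.serre_e' p
      · exact S.serre_e' (p + 1)
    rw [this, smul_zero]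
  cases p with
  | zero =>
    exact serrePoly_twist_right _ key (commute_gen (fun h0 => by omega) fun r hr => by
      obtain ⟨r, rfl⟩ : ∃ v, r = v + 1 := ⟨r - 1, by omega⟩
      exact S.comm_e r)
  | succ p =>
    have e2 : gen q e κ (p + 1) = (-alt q (p + 1)) • qComm (alt q (p + 1))⁻¹ (e (p + 1)) (e p) :=
      qComm_flip (alt_ne_zero S.ne_zero _) _ _
    rw [e2, ← one_smul K (gen q e κ (p + 1 + 2)), serrePoly_smul_smul,
      serrePoly_qComm_right _ _ ?_ key, smul_zero]
    exact (commute_gen (fun h0 => by omega) fun r hr => S.far_e p r (by omega)).symm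

/-- The fold of the diagram: across it `e` and `f` change roles, so the neighbouring generators at
the places `0` and `1` have opposite directions. -/
theorem serrePoly_gen_zero_gen_one (S : IsSystem q e f k k' κ κ') :
    serrePoly (q + q⁻¹) (gen q e κ 0) (gen q f κ' 1) = 0 := by
  obtain ⟨l, l', h1, h2, h3⟩ := S.swap.exists_alt 1
  rw [← alt_add_inv q 1]
  refine serrePoly_twist_qComm (alt_ne_zero S.ne_zero _) (S.alt_sub_ne_zero _) (h1 0) (h2 0) ?_ ?_
    (S.comm_f 0) <;> rw [alt_one]
  · rw [inv_inv]
    exact S.twist_f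
  · exact S.twist_e

theorem serrePoly_gen_one_gen_zero (S : IsSystem q e f k k' κ κ') :
    serrePoly (q + q⁻¹) (gen q e κ 1) (gen q f κ' 0) = 0 := by
  obtain ⟨l, l', h1, h2, h3⟩ := S.exists_alt 1
  rw [← alt_add_inv q 1]
  refine serrePoly_qComm_twist (alt_ne_zero S.ne_zero _) (S.alt_sub_ne_zero _) (h1 0) (h2 0) ?_ ?_
    (S.comm_e' 0)
  · rw [alt_add_inv]
    exact S.serre_e' 0
  · rw [alt_one, inv_inv]
    exact S.twist_e'

theorem gen_zero_mul_sub (S : IsSystem q e f k k' κ κ') :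
    (q - q⁻¹) • (gen q e κ 0 * ((alt q 0)⁻¹ • gen q f κ' 0) -
      ((alt q 0)⁻¹ • gen q f κ' 0) * gen q e κ 0) = k 0 - k' 0 := by
  have h0 := S.ne_zero
  have e1 : gen q e κ 0 * ((alt q 0)⁻¹ • gen q f κ' 0) = e 0 * f 0 := by
    have e : κ * f 0 * κ' = q • f 0 := by
      rw [S.twist_f, smul_mul_assoc, mul_assoc, S.twist_mul, mul_one]
    simp only [gen, alt, Even.zero, if_true]
    rw [mul_smul_comm, mul_assoc, ← mul_assoc κ, e, mul_smul_comm, smul_smul, inv_mul_cancel₀ h0,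
      one_smul]
  have e2 : ((alt q 0)⁻¹ • gen q f κ' 0) * gen q e κ 0 = f 0 * e 0 := by
    have e : κ' * e 0 * κ = q • e 0 := by
      rw [S.twist_e', smul_mul_assoc, mul_assoc, S.twist_mul', mul_one]
    simp only [gen, alt, Even.zero, if_true]
    rw [smul_mul_assoc, mul_assoc, ← mul_assoc κ', e, mul_smul_comm, smul_smul,
      inv_mul_cancel₀ h0, one_smul]
  rw [e1, e2, (S.triple 0).ef]

/-- The composite at a place carries the product of two consecutive Cartan elements. The sign on the
right is what `chainScale` compensates at positive places. -/
theorem gen_succ_mul_sub (S : IsSystem q e f k k' κ κ') (p : ℕ) :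
    (q - q⁻¹) • (gen q e κ (p + 1) * ((alt q (p + 1))⁻¹ • gen q f κ' (p + 1)) -
      ((alt q (p + 1))⁻¹ • gen q f κ' (p + 1)) * gen q e κ (p + 1)) =
      -(k p * k (p + 1) - k' p * k' (p + 1)) := by
  simp only [gen]
  have h0 := alt_ne_zero S.ne_zero (p + 1)
  have h1 := S.alt_sub_ne_zero (p + 1)
  by_cases h : Even (p + 1)
  · rw [alt, if_pos h] at *
    exact qComm_qComm_sub h0 h1 (S.triple p) (S.triple (p + 1)) (S.link p) (S.link' p) (S.k_k _ _)
      (S.k_k' _ _)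
  -- For parameter `q⁻¹` both the prefactor and the difference of the Cartan products change sign,
  -- so the formula is the same for both parities.
  · rw [alt, if_neg h] at *
    have := qComm_qComm_sub h0 h1 (S.triple p).inv (S.triple (p + 1)).inv (S.link p).inv
      (S.link' p).inv (S.k'_k' _ _) (S.k_k' _ _).symm
    rw [inv_inv, ← neg_sub q, neg_smul, neg_inj] at this
    rw [inv_inv, this, neg_sub]

end IsSystem

end System

/-! ### The Gelfand–Tsetlin model of the one-sided chain -/

section Model

variable {K : Type*} [Field K]

/-- The raising operator of the row `n + 1`. -/
noncomputable def raiseOp (q : K) (n : ℕ) : Module.End K (Arr →₀ K) :=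
  (-1 : K) • moveOp q (n + 1) (n + 2) 1

/-- The lowering operator of the row `n + 1`. -/
noncomputable def lowerOp (q : K) (n : ℕ) : Module.End K (Arr →₀ K) := moveOp q (n + 1) n (-1)

/-- The diagonal operator `q ^ (σ l₁)`, where `l₁` is the entry of the first row. -/
noncomputable def twistOp (q : K) (σ : ℤ) : Module.End K (Arr →₀ K) :=
  diagOp fun l => q ^ (σ * l 1 0)

theorem twistOp_mul_moveOp {q : K} (h0 : q ≠ 0) (τ : ℤ) (r r' : ℕ) (σ : ℤ) :
    twistOp q τ * moveOp q r r' σ =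
      (q ^ (if r = 1 then τ * σ else 0)) • (moveOp q r r' σ * twistOp q τ) := by
  refine diagOp_mul_rowOp _ fun l a ha _ => ?_
  rw [← zpow_add₀ h0]
  congr 1
  split_ifs with h
  · subst h
    obtain rfl : a = 0 := by simpa using ha
    rw [add_cell_apply_self]; ring
  · rw [add_cell_of_ne _ (Ne.symm h)]; ring

theorem twistOp_mul {q : K} (h0 : q ≠ 0) {σ τ : ℤ} (h : σ + τ = 0) :
    twistOp q σ * twistOp q τ = 1 := by
  rw [twistOp, twistOp, diagOp_mul]
  refine end_ext fun l => ?_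
  rw [diagOp_single, ← zpow_add₀ h0, ← add_mul, h]
  simp

theorem isStep_up (r : ℕ) : IsStep r (r + 1) 1 := Or.inl ⟨rfl, rfl⟩

theorem isStep_down (r : ℕ) : IsStep (r + 1) r (-1) := Or.inr ⟨rfl, rfl⟩

/-- The Cartan and twist exponents only record how a move changes row sums and the first row; the
other relations are the path identities. For lowering operators the steps run downwards, so the two
Serre statements exchange places. -/
theorem isSystem [CharZero K] {q : K} (hq : Generic q) :
    IsSystem q (raiseOp q) (lowerOp q) (cartanOp q 1) (cartanOp q (-1)) (twistOp q (-1))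
      (twistOp q 1) := by
  have h0 := hq.ne_zero
  have hc : ∀ (τ : ℤ) (n r r' : ℕ) (σ d : ℤ) (x : K),
      d = τ * (if r = n + 1 then 2 * σ else if r = n ∨ r = n + 2 then -σ else 0) → x = q ^ d →
      cartanOp q τ n * moveOp q r r' σ = x • (moveOp q r r' σ * cartanOp q τ n) :=
    fun τ n r r' σ d x h hx => hx ▸ cartanOp_mul_moveOp h0 τ n r r' σ d h
  have hc' : ∀ (τ : ℤ) (n r r' : ℕ) (σ d : ℤ) (x : K),
      d = τ * (if r = n + 1 then 2 * σ else if r = n ∨ r = n + 2 then -σ else 0) → x = q ^ d →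
      cartanOp q τ n * ((-1 : K) • moveOp q r r' σ) =
        x • (((-1 : K) • moveOp q r r' σ) * cartanOp q τ n) :=
    fun τ n r r' σ d x h hx => by
      rw [mul_smul_comm, smul_mul_assoc, hc τ n r r' σ d x h hx, smul_comm]
  have hz2 : (q ^ 2)⁻¹ = q ^ (-2 : ℤ) := by rw [zpow_neg]; norm_cast
  have hz2' : q ^ 2 = q ^ (2 : ℤ) := by norm_cast
  have hz1 : q⁻¹ = q ^ (-1 : ℤ) := (zpow_neg_one q).symm
  have hz1' : q = q ^ (1 : ℤ) := (zpow_one q).symm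
  have ht : ∀ (τ : ℤ) (r r' : ℕ) (σ d : ℤ) (x : K), d = (if r = 1 then τ * σ else 0) → x = q ^ d →
      twistOp q τ * moveOp q r r' σ = x • (moveOp q r r' σ * twistOp q τ) :=
    fun τ r r' σ d x h hx => by rw [twistOp_mul_moveOp h0, hx, h]
  have ht' : ∀ (τ : ℤ) (r r' : ℕ) (σ d : ℤ) (x : K), d = (if r = 1 then τ * σ else 0) → x = q ^ d →
      twistOp q τ * ((-1 : K) • moveOp q r r' σ) =
        x • (((-1 : K) • moveOp q r r' σ) * twistOp q τ) :=
    fun τ r r' σ d x h hx => by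
      rw [mul_smul_comm, smul_mul_assoc, ht τ r r' σ d x h hx, smul_comm]
  have hef : ∀ p r, p ≠ r → Commute (raiseOp q p) (lowerOp q r) := fun p r h =>
    (commute_moveOp q (isStep_up _) (isStep_down _) (by right; right; simp [h])).smul_left _
  exact
  { ne_zero := h0
    sub_ne_zero := hq.sub_inv_ne_zero
    add_ne_zero := hq.add_inv_ne_zero
    triple := fun p => 
      { ef := by
          rw [raiseOp, lowerOp, ← moveOp_mul_sub hq p, smul_mul_assoc, mul_smul_comm]
          congr 1
          module
        ke := hc' _ _ _ _ _ 2 _ (by simp) hz2'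
        kf := hc _ _ _ _ _ (-2) _ (by simp) hz2
        ke' := hc' _ _ _ _ _ (-2) _ (by simp) hz2
        kf' := hc _ _ _ _ _ 2 _ (by simp) hz2' }
    link := fun p =>
      { ef := hef p (p + 1) (by omega)
        fe := (hef (p + 1) p (by omega)).symm
        ke := hc' _ _ _ _ _ (-1) _ (by simp) hz1
        kf := hc _ _ _ _ _ 1 _ (by simp) hz1'
        ke' := hc' _ _ _ _ _ 1 _ (by simp) hz1'
        kf' := hc _ _ _ _ _ (-1) _ (by simp) hz1 }
    link' := fun p =>
      { ef := hef (p + 1) p (by omega)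
        fe := (hef p (p + 1) (by omega)).symm
        ke := hc' _ _ _ _ _ (-1) _ (by simp) hz1
        kf := hc _ _ _ _ _ 1 _ (by simp) hz1'
        ke' := hc' _ _ _ _ _ 1 _ (by simp) hz1'
        kf' := hc _ _ _ _ _ (-1) _ (by simp) hz1 }
    serre_e := fun p => by
      rw [raiseOp, raiseOp, serrePoly_smul_smul, serrePoly_moveOp hq (isStep_up _) (isStep_up _), smul_zero]
    serre_e' := fun p => by
      rw [raiseOp, raiseOp, serrePoly_smul_smul, serrePoly_moveOp' hq (isStep_up _) (isStep_up _), smul_zero]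
    serre_f := fun p => serrePoly_moveOp' hq (isStep_down _) (isStep_down _)
    serre_f' := fun p => serrePoly_moveOp hq (isStep_down _) (isStep_down _)
    far_e := fun p r h => ((commute_moveOp q (isStep_up _) (isStep_up _)
      (by omega)).smul_left _).smul_right _
    far_f := fun p r h => commute_moveOp q (isStep_down _) (isStep_down _) (by omega)
    e_f := hef
    k_k := fun p r => commute_diagOp _ _
    k_k' := fun p r => commute_diagOp _ _
    k'_k' := fun p r => commute_diagOp _ _
    twist_mul := twistOp_mul h0 (by simp)
    twist_mul' := twistOp_mul h0 (by simp)
    twist_e := ht' _ _ _ _ (-1) _ (by simp) hz1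
    twist_f := ht _ _ _ _ 1 _ (by simp) hz1'
    twist_e' := ht' _ _ _ _ 1 _ (by simp) hz1'
    twist_f' := ht _ _ _ _ (-1) _ (by simp) hz1
    comm_e := fun p => (ht' _ _ _ _ 0 1 (by simp) (by simp)).trans (one_smul _ _)
    comm_f := fun p => (ht _ _ _ _ 0 1 (by simp) (by simp)).trans (one_smul _ _)
    comm_e' := fun p => (ht' _ _ _ _ 0 1 (by simp) (by simp)).trans (one_smul _ _)
    comm_f' := fun p => (ht _ _ _ _ 0 1 (by simp) (by simp)).trans (one_smul _ _) }

end Model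

/-! ### Square roots and positivity in `ℂ[[h]]`, and the generic `q` -/

section Series

/-- The power series with positive constant term. -/
def HasPosConst (f : ℂ⟦X⟧) : Prop := ∃ r : ℝ, 0 < r ∧ PowerSeries.constantCoeff f = (r : ℂ)

/-- Scale the constant term `r` to `1`, substitute the rest into the binomial series `(1 + X) ^
(1/2)`, and multiply by the real root of `r`. -/
theorem exists_isPosSqrt {f : ℂ⟦X⟧} (hf : HasPosConst f) : ∃ g, IsPosSqrt f g := by
  obtain ⟨r, hr, hf⟩ := hf
  have hr0 : (r : ℂ) ≠ 0 := by exact_mod_cast hr.ne'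
  set u : ℂ⟦X⟧ := PowerSeries.C (r : ℂ)⁻¹ * f - 1 with hu
  have hs : PowerSeries.HasSubst u := PowerSeries.HasSubst.of_constantCoeff_zero' (by
    simp [hu, hf, hr0])
  set B : ℂ⟦X⟧ := PowerSeries.binomialSeries ℂ (1 / 2 : ℚ) with hB
  have hB2 : B ^ 2 = 1 + PowerSeries.X := by
    rw [pow_two, hB, ← PowerSeries.binomialSeries_add]
    have := PowerSeries.binomialSeries_nat (R := ℚ) (A := ℂ) 1
    rw [pow_one] at this
    rw [← this]
    norm_num
  have hone : PowerSeries.subst u (1 : ℂ⟦X⟧) = (1 : ℂ⟦X⟧) := by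
    rw [← PowerSeries.coe_substAlgHom hs, map_one]
  have h1 : PowerSeries.subst u B ^ 2 = 1 + u := by
    rw [← PowerSeries.subst_pow hs, hB2, PowerSeries.subst_add hs, hone, PowerSeries.subst_X hs]
  -- Splitting off the constant term of the binomial series before substituting shows that the
  -- constant term of the result is `1`.
  have h2 : (PowerSeries.subst u B : ℂ⟦X⟧) = 1 + u * PowerSeries.subst u
      (PowerSeries.mk fun n => PowerSeries.coeff (n + 1) B) := by
    conv_lhs => rw [PowerSeries.eq_X_mul_shift_add_const B]
    rw [PowerSeries.subst_add hs, PowerSeries.subst_mul hs, PowerSeries.subst_X hs, add_comm, hB,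
      PowerSeries.binomialSeries_constantCoeff, map_one, hone]
  refine ⟨PowerSeries.C (Real.sqrt r : ℂ) * PowerSeries.subst u B, ?_, Real.sqrt r,
    Real.sqrt_pos.mpr hr, ?_⟩
  · rw [mul_pow, h1, ← map_pow, ← Complex.ofReal_pow, Real.sq_sqrt hr.le, hu, add_sub_cancel,
      ← mul_assoc, ← map_mul, mul_inv_cancel₀ hr0, map_one, one_mul]
  · have hu0 : PowerSeries.constantCoeff u = 0 := by simp [hu, hf, hr0]
    rw [h2, map_mul, map_add, map_mul, hu0]
    simp

theorem qPow_C (a : ℂ) : qPow (PowerSeries.C a) =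
    PowerSeries.rescale (1 / 2 * a) (PowerSeries.exp ℂ) := by
  rw [PowerSeries.rescale_eq_subst, qPow]
  congr 1
  rw [PowerSeries.smul_eq_C_mul, map_mul]
  ring

theorem qPow_C_add (a b : ℂ) :
    qPow (PowerSeries.C (a + b)) = qPow (PowerSeries.C a) * qPow (PowerSeries.C b) := by
  rw [qPow_C, qPow_C, qPow_C, PowerSeries.exp_mul_exp_eq_exp_add, mul_add]

theorem qPow_zero : qPow 0 = 1 := by
  have := qPow_C 0
  rw [map_zero] at this
  rw [this, mul_zero]
  simp [PowerSeries.rescale_zero]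

theorem constantCoeff_bracket (x : ℂ⟦X⟧) :
    PowerSeries.constantCoeff (bracket x) = PowerSeries.constantCoeff x := by
  have h1 : PowerSeries.constantCoeff (divH (qPow x - qPow (-x))) =
      PowerSeries.coeff 1 (qPow x - qPow (-x)) := by
    rw [← PowerSeries.coeff_zero_eq_constantCoeff_apply, divH, PowerSeries.coeff_mk]
  have h2 : ∀ y : ℂ⟦X⟧, PowerSeries.coeff 1 (hh * y) = PowerSeries.constantCoeff y := fun y => by
    rw [← zero_add 1, PowerSeries.coeff_succ_X_mul, PowerSeries.coeff_zero_eq_constantCoeff_apply]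
  rw [bracket, map_mul, h1, PowerSeries.constantCoeff_inv, constantCoeff_qUnit, map_sub, coeff_qPow,
    coeff_qPow]
  simp only [Finset.sum_range_succ, Finset.sum_range_zero, pow_one, h2, map_neg]
  simp [PowerSeries.coeff_one]
  ring

/-- The fraction field of `ℂ[[h]]`. -/
abbrev FracK : Type := FractionRing ℂ⟦X⟧

/-- The inclusion of `ℂ[[h]]` into its fraction field. -/
noncomputable abbrev toK : ℂ⟦X⟧ →+* FracK := algebraMap ℂ⟦X⟧ FracK

theorem toK_injective : Function.Injective toK := IsFractionRing.injective _ _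

/-- `q` as an element of the fraction field. -/
noncomputable def qK : FracK := toK (qPow 1)

theorem toK_qPow_intCast (n : ℤ) : toK (qPow (n : ℂ⟦X⟧)) = qK ^ n := by
  let φ : Multiplicative ℤ →* FracK :=
    { toFun := fun m => toK (qPow ((Multiplicative.toAdd m : ℤ) : ℂ⟦X⟧))
      map_one' := by simp [qPow_zero]
      map_mul' := fun a b => by
        have h : ∀ n : ℤ, (n : ℂ⟦X⟧) = PowerSeries.C (n : ℂ) := fun n => (map_intCast _ n).symm
        rw [← map_mul, h, h, h, ← qPow_C_add, toAdd_mul, Int.cast_add] }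
  have h1 : φ (Multiplicative.ofAdd 1) = qK := by simp [φ, qK]
  have h2 := map_zpow φ (Multiplicative.ofAdd 1) n
  rw [h1, ← ofAdd_zsmul] at h2
  simpa [φ] using h2

theorem qK_inv : toK (qPow (-1)) = qK⁻¹ := by
  have := toK_qPow_intCast (-1)
  rw [zpow_neg_one] at this
  rw [← this]
  simp

theorem qK_sub_inv_ne_zero : qK - qK⁻¹ ≠ 0 := by
  have h : qPow 1 - qPow (-1) ≠ 0 := by
    rw [← hh_mul_qUnit]
    refine mul_ne_zero PowerSeries.X_ne_zero fun h => ?_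
    have := constantCoeff_qUnit
    simp [h] at this
  rw [← qK_inv, qK, ← map_sub]
  exact fun h0 => h ((map_eq_zero_iff _ toK_injective).mp h0)

theorem toK_bracket_intCast (n : ℤ) : toK (bracket (n : ℂ⟦X⟧)) = qInt qK n := by
  rw [qInt, eq_div_iff qK_sub_inv_ne_zero]
  have h := congrArg toK (bracket_mul (n : ℂ⟦X⟧))
  rw [map_mul, map_sub, map_sub, qK_inv, ← Int.cast_neg, toK_qPow_intCast, toK_qPow_intCast] at h
  exact h

/-- If `q` were a root of unity of order dividing `n ≠ 0`, then `[n]` would vanish, but its constant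
term is `n`. -/
theorem generic_qK : Generic qK where
  ne_zero := by
    rw [qK, Ne, map_eq_zero_iff _ toK_injective]
    intro h
    have := constantCoeff_qPow 1
    simp [h] at this
  zpow_ne_one n hn h := by
    have h1 : qInt qK n = 0 := by rw [qInt, zpow_neg, h]; simp
    rw [← toK_bracket_intCast, map_eq_zero_iff _ toK_injective] at h1
    have h2 := constantCoeff_bracket (n : ℂ⟦X⟧)
    rw [h1, map_zero, map_intCast] at h2
    exact hn (by exact_mod_cast h2.symm)

/-- The elements of the fraction field that are power series with positive constant term. -/
def IsPos (x : FracK) : Prop := ∃ f, HasPosConst f ∧ toK f = x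

theorem HasPosConst.mul {f g : ℂ⟦X⟧} : HasPosConst f → HasPosConst g → HasPosConst (f * g) := by
  rintro ⟨r, hr, hf⟩ ⟨s, hs, hg⟩
  exact ⟨r * s, mul_pos hr hs, by rw [map_mul, hf, hg]; push_cast; rfl⟩

theorem HasPosConst.inv {f : ℂ⟦X⟧} : HasPosConst f → HasPosConst f⁻¹ := by
  rintro ⟨r, hr, hf⟩
  exact ⟨r⁻¹, inv_pos.mpr hr, by rw [PowerSeries.constantCoeff_inv, hf]; push_cast; rfl⟩

theorem HasPosConst.constantCoeff_ne_zero {f : ℂ⟦X⟧} :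
    HasPosConst f → PowerSeries.constantCoeff f ≠ 0 := by
  rintro ⟨r, hr, hf⟩
  rw [hf]
  exact_mod_cast hr.ne'

namespace IsPos

theorem one : IsPos 1 := ⟨1, ⟨1, one_pos, by simp⟩, map_one _⟩

theorem mul {x y : FracK} : IsPos x → IsPos y → IsPos (x * y) := by
  rintro ⟨f, hf, rfl⟩ ⟨g, hg, rfl⟩
  exact ⟨f * g, hf.mul hg, map_mul _ _ _⟩

theorem inv {x : FracK} : IsPos x → IsPos x⁻¹ := by
  rintro ⟨f, hf, rfl⟩
  refine ⟨f⁻¹, hf.inv, ?_⟩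
  refine eq_inv_of_mul_eq_one_left ?_
  rw [← map_mul, PowerSeries.inv_mul_cancel _ hf.constantCoeff_ne_zero, map_one]

theorem div {x y : FracK} (hx : IsPos x) (hy : IsPos y) : IsPos (x / y) := by
  rw [div_eq_mul_inv]; exact hx.mul hy.inv

theorem ne_zero {x : FracK} : IsPos x → x ≠ 0 := by
  rintro ⟨f, hf, rfl⟩ h
  rw [map_eq_zero_iff _ toK_injective] at h
  exact hf.constantCoeff_ne_zero (by rw [h, map_zero])

theorem prod {ι : Type*} {s : Finset ι} {u : ι → FracK} (h : ∀ i ∈ s, IsPos (u i)) :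
    IsPos (∏ i ∈ s, u i) :=
  Finset.prod_induction u IsPos (fun _ _ => mul) one h

theorem of_mul_right {x y : FracK} (hxy : IsPos (x * y)) (hy : IsPos y) : IsPos x := by
  rw [← mul_div_cancel_right₀ x hy.ne_zero]
  exact hxy.div hy

theorem eq_of_sq_eq {x y : FracK} (hx : IsPos x) (hy : IsPos y) (h : x ^ 2 = y ^ 2) : x = y := by
  obtain ⟨f, hf, rfl⟩ := hx
  obtain ⟨g, hg, rfl⟩ := hy
  rw [← map_pow, ← map_pow] at h
  exact congrArg toK (IsPosSqrt.unique (f := f ^ 2) ⟨rfl, hf⟩ ⟨(toK_injective h).symm, hg⟩)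

theorem exists_sqrt {x : FracK} (hx : IsPos x) : ∃ y, IsPos y ∧ y ^ 2 = x := by
  obtain ⟨f, hf, rfl⟩ := hx
  obtain ⟨g, hg, hg'⟩ := exists_isPosSqrt hf
  exact ⟨toK g, ⟨g, hg', rfl⟩, by rw [← map_pow, hg]⟩

theorem hasPosConst {f : ℂ⟦X⟧} (h : IsPos (toK f)) : HasPosConst f := by
  obtain ⟨g, hg, h⟩ := h
  rwa [← toK_injective h]

theorem sqrtSeries {f : ℂ⟦X⟧} {y : FracK} (hy : IsPos y) (h : y ^ 2 = toK f) :
    toK (sqrtSeries f) = y := by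
  obtain ⟨g, hg, rfl⟩ := hy
  rw [← map_pow] at h
  rw [IsPosSqrt.sqrtSeries_eq (g := g) ⟨toK_injective h, hg⟩]

theorem qInt {n : ℤ} (hn : 0 < n) : IsPos (qInt qK n) := by
  refine ⟨bracket (n : ℂ⟦X⟧), ⟨n, by exact_mod_cast hn, ?_⟩, toK_bracket_intCast n⟩
  rw [constantCoeff_bracket, map_intCast]
  simp

end IsPos

end Series

/-! ### The gauge that makes raising and lowering transposes -/

section Gauge

/-- `[|n|]`, with the value `1` at `n = 0`. -/
noncomputable def rho (n : ℤ) : FracK := if n = 0 then 1 else qInt qK |n|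

theorem isPos_rho (n : ℤ) : IsPos (rho n) := by
  unfold rho
  split_ifs with h
  · exact IsPos.one
  · exact IsPos.qInt (abs_pos.mpr h)

theorem rho_neg (n : ℤ) : rho (-n) = rho n := by
  simp only [rho, neg_eq_zero, abs_neg]

theorem qInt_eq_rho {n : ℤ} (h : n ≠ 0) : qInt qK n = (if n < 0 then -1 else 1) * rho n := by
  rw [rho, if_neg h]
  split_ifs with h'
  · rw [abs_of_neg h', qInt_neg]; ring
  · rw [abs_of_nonneg (not_lt.mp h'), one_mul]

/-- A quantum gamma function. -/
noncomputable def gam : ℤ → FracK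
  | Int.ofNat n => ∏ i ∈ Finset.range n, rho i
  | Int.negSucc n => ∏ i ∈ Finset.range (n + 1), (rho (-i - 1))⁻¹

theorem isPos_gam : ∀ n, IsPos (gam n)
  | Int.ofNat _ => IsPos.prod fun _ _ => isPos_rho _
  | Int.negSucc _ => IsPos.prod fun _ _ => (isPos_rho _).inv

/-- The functional equation of the gamma function, up to signs. The value `rho 0 = 1` removes the
pole, so it holds on all of `ℤ` with positive values and no division by zero. -/
theorem gam_add_one : ∀ n, gam (n + 1) = rho n * gam n
  | Int.ofNat n => by
    change gam (Int.ofNat (n + 1)) = _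
    simp only [gam]
    rw [Finset.prod_range_succ, mul_comm]
    rfl
  | Int.negSucc 0 => by
    change gam (Int.ofNat 0) = _
    simp only [gam, Finset.prod_range_zero, zero_add, Finset.prod_range_one]
    exact (mul_inv_cancel₀ (isPos_rho _).ne_zero).symm
  | Int.negSucc (n + 1) => by
    change gam (Int.negSucc n) = _
    simp only [gam]
    rw [Finset.prod_range_succ _ (n + 1), mul_left_comm,
      show Int.negSucc (n + 1) = -((n + 1 : ℕ) : ℤ) - 1 by omega,
      mul_inv_cancel₀ (isPos_rho _).ne_zero, mul_one]

theorem prod_mul_of_change {ι : Type*} [DecidableEq ι] {s : Finset ι} {a : ι} (ha : a ∈ s)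
    {f g : ι → FracK} (c d : FracK) (h : ∀ i ∈ s, i ≠ a → f i = g i) (h' : f a * c = g a * d) :
    (∏ i ∈ s, f i) * c = (∏ i ∈ s, g i) * d := by
  rw [← Finset.mul_prod_erase s f ha, ← Finset.mul_prod_erase s g ha,
    Finset.prod_congr rfl fun i hi => h i (Finset.mem_of_mem_erase hi) (Finset.ne_of_mem_erase hi)]
  linear_combination (∏ i ∈ s.erase a, g i) * h'

/-- The contribution of the rows `p` and `p + 1` to the gauge. -/
noncomputable def gaugeInter (p : ℕ) (l : Arr) : FracK :=
  ∏ b ∈ Finset.range (p + 1), ∏ a ∈ Finset.range p, gam (l (p + 1) b - l p a + 1)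

/-- The contribution of the row `p` to the gauge. -/
noncomputable def gaugeIntra (p : ℕ) (l : Arr) : FracK :=
  ∏ a ∈ Finset.range p, ∏ b ∈ (Finset.range p).erase a, gam (l p a - l p b)

/-- The squared ratio between the orthonormal and the rational basis. -/
noncomputable def gauge (P : ℕ) (l : Arr) : FracK :=
  ∏ p ∈ Finset.range P, (gaugeInter p l * gaugeIntra p l)

theorem isPos_gauge (P : ℕ) (l : Arr) : IsPos (gauge P l) :=
  IsPos.prod fun _ _ => (IsPos.prod fun _ _ => IsPos.prod fun _ _ => isPos_gam _).mul
    (IsPos.prod fun _ _ => IsPos.prod fun _ _ => isPos_gam _)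

variable {l : Arr} {n a : ℕ}

/-- A move shifts the argument of every gamma factor containing the moved entry by one, so each
ratio is a single `rho`. In this lemma and the next two the entry belongs to the smaller row of the
pair, to the larger row, and to ordered pairs within the row. -/
theorem gaugeInter_add_cell (l : Arr) (ha : a < n + 1) :
    gaugeInter (n + 1) (l + (1 : ℤ) • cell (n + 1) a) *
      ∏ b ∈ Finset.range (n + 2), rho (l (n + 2) b - l (n + 1) a) = gaugeInter (n + 1) l := by
  rw [gaugeInter, gaugeInter, ← Finset.prod_mul_distrib]
  refine Finset.prod_congr rfl fun b _ => ?_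
  refine (prod_mul_of_change (Finset.mem_range.mpr ha) _ 1 (fun i _ hi => ?_) ?_).trans (mul_one _)
  · rw [add_cell_apply_of_ne _ _ hi, add_cell_of_ne _ (by omega)]
  · rw [add_cell_apply_self, add_cell_of_ne _ (by omega), mul_one,
      gam_add_one (l (n + 1 + 1) b - l (n + 1) a), mul_comm]
    congr 2
    ring

theorem gaugeInter_add_cell' (l : Arr) (ha : a < n + 1) :
    gaugeInter n (l + (1 : ℤ) • cell (n + 1) a) =
      gaugeInter n l * ∏ k ∈ Finset.range n, rho (l n k - (l (n + 1) a + 1)) := by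
  rw [← mul_one (gaugeInter n _), gaugeInter, gaugeInter]
  refine prod_mul_of_change (Finset.mem_range.mpr ha) _ _ (fun i _ hi => ?_) ?_
  · simp only [add_cell_apply_of_ne _ _ hi, add_cell_of_ne l (show n ≠ n + 1 by omega)]
  · rw [mul_one, ← Finset.prod_mul_distrib]
    refine Finset.prod_congr rfl fun k _ => ?_
    rw [add_cell_apply_self, add_cell_of_ne _ (by omega), ← rho_neg, mul_comm,
      show -(l n k - (l (n + 1) a + 1)) = l (n + 1) a - l n k + 1 by ring, ← gam_add_one]
    congr 1
    ring

theorem gaugeIntra_add_cell (l : Arr) (ha : a < n + 1) :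
    gaugeIntra (n + 1) (l + (1 : ℤ) • cell (n + 1) a) *
      ∏ b ∈ (Finset.range (n + 1)).erase a, rho (l (n + 1) b - (l (n + 1) a + 1)) =
    gaugeIntra (n + 1) l *
      ∏ b ∈ (Finset.range (n + 1)).erase a, rho (l (n + 1) b - l (n + 1) a) := by
  have ha' := Finset.mem_range.mpr ha
  rw [gaugeIntra, gaugeIntra, ← Finset.mul_prod_erase _ _ ha', ← Finset.mul_prod_erase _ _ ha']
  have h1 : ∏ b ∈ (Finset.range (n + 1)).erase a,
      gam ((l + (1 : ℤ) • cell (n + 1) a) (n + 1) a - (l + (1 : ℤ) • cell (n + 1) a) (n + 1) b) =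
      (∏ b ∈ (Finset.range (n + 1)).erase a, gam (l (n + 1) a - l (n + 1) b)) *
        ∏ b ∈ (Finset.range (n + 1)).erase a, rho (l (n + 1) b - l (n + 1) a) := by
    rw [← Finset.prod_mul_distrib]
    refine Finset.prod_congr rfl fun b hb => ?_
    rw [add_cell_apply_self, add_cell_apply_of_ne _ _ (Finset.ne_of_mem_erase hb), ← rho_neg,
      mul_comm, neg_sub, ← gam_add_one]
    congr 1
    ring
  have h2 : (∏ a' ∈ (Finset.range (n + 1)).erase a, ∏ b ∈ (Finset.range (n + 1)).erase a',
      gam ((l + (1 : ℤ) • cell (n + 1) a) (n + 1) a' - (l + (1 : ℤ) • cell (n + 1) a) (n + 1) b)) *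
      ∏ b ∈ (Finset.range (n + 1)).erase a, rho (l (n + 1) b - (l (n + 1) a + 1)) =
      ∏ a' ∈ (Finset.range (n + 1)).erase a, ∏ b ∈ (Finset.range (n + 1)).erase a',
      gam (l (n + 1) a' - l (n + 1) b) := by
    rw [← Finset.prod_mul_distrib]
    refine Finset.prod_congr rfl fun a' hb => ?_
    rw [← mul_one (∏ b ∈ (Finset.range (n + 1)).erase a', gam (l (n + 1) a' - _))]
    have hb' := Finset.ne_of_mem_erase hb
    refine prod_mul_of_change (a := a) (by simp [hb'.symm, ha]) _ _ (fun i _ hi => ?_) ?_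
    · rw [add_cell_apply_of_ne _ _ hi, add_cell_apply_of_ne _ _ hb']
    · rw [add_cell_apply_self, add_cell_apply_of_ne _ _ hb', mul_comm, ← gam_add_one, mul_one]
      congr 1
      ring
  rw [h1, mul_assoc, mul_right_comm, ← mul_assoc, mul_assoc _ _ (∏ b ∈ _, rho _), mul_right_comm,
    ← h2]
  ring

/-- The ratio of the gauges is the ratio of the absolute values of the lowering and the raising
coefficient. The bound on `P` ensures that all gamma factors involving the row `n + 1` lie in the
truncated product. -/
theorem gauge_add_cell (l : Arr) (ha : a < n + 1) {P : ℕ} (hP : n + 1 < P) :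
    gauge P (l + (1 : ℤ) • cell (n + 1) a) *
      ((∏ b ∈ Finset.range (n + 2), rho (l (n + 2) b - l (n + 1) a)) /
        ∏ b ∈ (Finset.range (n + 1)).erase a, rho (l (n + 1) b - l (n + 1) a)) =
    gauge P l * ((∏ k ∈ Finset.range n, rho (l n k - (l (n + 1) a + 1))) /
        ∏ b ∈ (Finset.range (n + 1)).erase a, rho (l (n + 1) b - (l (n + 1) a + 1))) := by
  have h1 : n + 1 ∈ Finset.range P := Finset.mem_range.mpr hP
  have h2 : n ∈ (Finset.range P).erase (n + 1) := by simp; omega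
  have h3 : ∀ m : Arr, gauge P m = gaugeInter (n + 1) m * gaugeIntra (n + 1) m *
      (gaugeInter n m * gaugeIntra n m * ∏ p ∈ ((Finset.range P).erase (n + 1)).erase n,
        gaugeInter p m * gaugeIntra p m) := fun m => by
    rw [gauge, ← Finset.mul_prod_erase _ _ h1, ← Finset.mul_prod_erase _ _ h2]
  have h4 : ∏ p ∈ ((Finset.range P).erase (n + 1)).erase n,
      gaugeInter p (l + (1 : ℤ) • cell (n + 1) a) * gaugeIntra p (l + (1 : ℤ) • cell (n + 1) a) =
      ∏ p ∈ ((Finset.range P).erase (n + 1)).erase n, gaugeInter p l * gaugeIntra p l := by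
    refine Finset.prod_congr rfl fun p hp => ?_
    simp only [Finset.mem_erase] at hp
    rw [gaugeInter, gaugeIntra, gaugeInter, gaugeIntra, add_cell_of_ne _ (show p ≠ n + 1 by omega),
      add_cell_of_ne _ (show p + 1 ≠ n + 1 by omega)]
  have h5 : gaugeIntra n (l + (1 : ℤ) • cell (n + 1) a) = gaugeIntra n l := by
    rw [gaugeIntra, gaugeIntra, add_cell_of_ne _ (show n ≠ n + 1 by omega)]
  have e1 := gaugeInter_add_cell l ha
  have e2 := gaugeInter_add_cell' l ha
  have e3 := gaugeIntra_add_cell l ha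
  have z1 : ∏ b ∈ (Finset.range (n + 1)).erase a, rho (l (n + 1) b - l (n + 1) a) ≠ 0 :=
    (IsPos.prod fun _ _ => isPos_rho _).ne_zero
  have z2 : ∏ b ∈ (Finset.range (n + 1)).erase a, rho (l (n + 1) b - (l (n + 1) a + 1)) ≠ 0 :=
    (IsPos.prod fun _ _ => isPos_rho _).ne_zero
  rw [mul_div_assoc', mul_div_assoc', div_eq_div_iff z1 z2, h3, h3, h4, h5, e2, ← e1]
  linear_combination gaugeInter (n + 1) (l + (1 : ℤ) • cell (n + 1) a) * gaugeInter n l *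
    (∏ k ∈ Finset.range n, rho (l n k - (l (n + 1) a + 1))) * gaugeIntra n l *
    (∏ p ∈ ((Finset.range P).erase (n + 1)).erase n, gaugeInter p l * gaugeIntra p l) *
    (∏ b ∈ Finset.range (n + 2), rho (l (n + 2) b - l (n + 1) a)) * e3

theorem prodDiff_eq_rho {s : Finset ℕ} {u : ℕ → ℤ} {y : ℤ} (h : ∀ b ∈ s, u b ≠ y) :
    prodDiff qK s u y = (-1) ^ (s.filter (u · < y)).card * ∏ b ∈ s, rho (u b - y) := by
  have e : ∏ b ∈ s, (if u b < y then (-1 : FracK) else 1) = (-1) ^ (s.filter (u · < y)).card := by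
    rw [Finset.prod_ite]; simp
  rw [← e, ← Finset.prod_mul_distrib]
  refine Finset.prod_congr rfl fun b hb => ?_
  rw [qInt_eq_rho (sub_ne_zero.mpr (h b hb))]
  simp only [sub_neg]

theorem raw_up_eq (hl : Interlaced l) (ha : a < n + 1)
    (hf : Interlaced (l + (1 : ℤ) • cell (n + 1) a)) :
    raw qK (n + 1) (n + 2) l a =
      -((∏ b ∈ Finset.range (n + 2), rho (l (n + 2) b - l (n + 1) a)) /
        ∏ b ∈ (Finset.range (n + 1)).erase a, rho (l (n + 1) b - l (n + 1) a)) := by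
  have h1 : ∀ b < n + 2, (b ≤ a → l (n + 1) a < l (n + 2) b) ∧ (a < b → l (n + 2) b < l (n + 1) a) :=
    fun b hb => by
    have h2 := hf (n + 1) b a hb ha
    rw [add_cell_apply_self, add_cell_of_ne _ (by omega)] at h2
    refine ⟨fun h => ?_, (hl (n + 1) b a hb ha).2⟩
    have h3 : l (n + 1) a + 1 ≤ l (n + 2) b := h2.1 h
    omega
  rw [raw, prodDiff_eq_rho, prodDiff_eq_rho]
  -- Interlacing determines the signs: exactly the entries to the right of `a` are smaller. The row
  -- `n + 2` has one more of them than the row `n + 1`, hence the overall minus sign.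
  · have c1 : ((Finset.range (n + 2)).filter (l (n + 2) · < l (n + 1) a)) =
        Finset.Ico (a + 1) (n + 2) := by
      ext b
      have := h1 b
      simp only [Finset.mem_filter, Finset.mem_range, Finset.mem_Ico]
      grind
    have c2 : (((Finset.range (n + 1)).erase a).filter (l (n + 1) · < l (n + 1) a)) =
        Finset.Ico (a + 1) (n + 1) := by
      ext b
      simp only [Finset.mem_filter, Finset.mem_erase, Finset.mem_range, Finset.mem_Ico]
      constructor
      · rintro ⟨⟨h1, h2⟩, h3⟩
        refine ⟨?_, h2⟩
        by_contra h
        have := hl.lt ha (show b < a by omega)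
        omega
      · rintro ⟨h1, h2⟩
        exact ⟨⟨by omega, h2⟩, hl.lt h2 h1⟩
    rw [c1, c2, Nat.card_Ico, Nat.card_Ico, show n + 2 - (a + 1) = (n + 1 - (a + 1)) + 1 by omega,
      pow_succ, mul_assoc, mul_div_mul_left _ _ (by simp)]
    ring
  · intro b hb
    rw [Finset.mem_erase, Finset.mem_range] at hb
    exact hl.ne hb.2 ha hb.1
  · intro b hb
    rw [Finset.mem_range] at hb
    have := h1 b hb
    omega

theorem raw_down_eq (hl : Interlaced l) (ha : a < n + 1)
    (hf : Interlaced (l + (1 : ℤ) • cell (n + 1) a)) :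
    raw qK (n + 1) n (l + (1 : ℤ) • cell (n + 1) a) a =
      (∏ k ∈ Finset.range n, rho (l n k - (l (n + 1) a + 1))) /
        ∏ b ∈ (Finset.range (n + 1)).erase a, rho (l (n + 1) b - (l (n + 1) a + 1)) := by
  have h1 : ∀ k < n, (k < a → l (n + 1) a + 1 < l n k) ∧ (a ≤ k → l n k < l (n + 1) a + 1) :=
    fun k hk => by
    have h2 := hf n a k ha hk
    have h3 := hl n a k ha hk
    rw [add_cell_apply_self, add_cell_of_ne _ (by omega)] at h2
    exact ⟨h2.2, fun h => by have := h3.1 h; omega⟩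
  have h4 : ∀ b, b ≠ a → b < n + 1 → (l (n + 1) b < l (n + 1) a + 1 ↔ a < b) ∧
      l (n + 1) b ≠ l (n + 1) a + 1 := fun b hba hb => by
    have h5 := hf.ne ha hb hba.symm
    rw [add_cell_apply_self, add_cell_apply_of_ne _ _ hba] at h5
    refine ⟨⟨fun h => ?_, fun h => ?_⟩, h5.symm⟩
    · by_contra h'
      have := hl.lt ha (show b < a by omega)
      omega
    · have := hl.lt hb h
      omega
  rw [raw, add_cell_apply_self, add_cell_of_ne _ (by omega), prodDiff_congr qK (u :=
    (l + (1 : ℤ) • cell (n + 1) a) (n + 1)) (v := l (n + 1)) _ fun i hi =>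
      add_cell_apply_of_ne _ _ (Finset.ne_of_mem_erase hi) _, prodDiff_eq_rho, prodDiff_eq_rho]
  · have c1 : ((Finset.range n).filter (l n · < l (n + 1) a + 1)) = Finset.Ico a n := by
      ext b
      have := h1 b
      simp only [Finset.mem_filter, Finset.mem_range, Finset.mem_Ico]
      grind
    have c2 : (((Finset.range (n + 1)).erase a).filter (l (n + 1) · < l (n + 1) a + 1)) =
        Finset.Ico (a + 1) (n + 1) := by
      ext b
      have := h4 b
      simp only [Finset.mem_filter, Finset.mem_erase, Finset.mem_range, Finset.mem_Ico]
      grind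
    rw [c1, c2, Nat.card_Ico, Nat.card_Ico, show n + 1 - (a + 1) = n - a by omega,
      mul_div_mul_left _ _ (by simp)]
  · intro b hb
    rw [Finset.mem_erase, Finset.mem_range] at hb
    exact (h4 b hb.1 hb.2).2
  · intro b hb
    rw [Finset.mem_range] at hb
    have := h1 b hb
    omega

/-- The matrix coefficients of a raising and a lowering operator are positive, and the gauge makes
them transposes of each other. -/
theorem raw_gauge (hl : Interlaced l) (ha : a < n + 1)
    (hf : Interlaced (l + (1 : ℤ) • cell (n + 1) a)) {P : ℕ} (hP : n + 1 < P) :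
    IsPos (-raw qK (n + 1) (n + 2) l a) ∧
    IsPos (raw qK (n + 1) n (l + (1 : ℤ) • cell (n + 1) a) a) ∧
    -raw qK (n + 1) (n + 2) l a * gauge P (l + (1 : ℤ) • cell (n + 1) a) =
      raw qK (n + 1) n (l + (1 : ℤ) • cell (n + 1) a) a * gauge P l := by
  rw [raw_up_eq hl ha hf, raw_down_eq hl ha hf, neg_neg]
  refine ⟨(IsPos.prod fun _ _ => isPos_rho _).div (IsPos.prod fun _ _ => isPos_rho _),
    (IsPos.prod fun _ _ => isPos_rho _).div (IsPos.prod fun _ _ => isPos_rho _), ?_⟩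
  rw [mul_comm, gauge_add_cell l ha hP, mul_comm]

end Gauge

/-! ### Matrix coefficients of `q`-commutators of adjacent moves -/

section TwoStep

variable {K : Type*} [Field K]

/-- The common factor of the matrix coefficients along the two paths that move the entry `a` of the
row `r` and the entry `b` of the row `r'`. -/
noncomputable def pathCoef (q : K) (r r' r'' : ℕ) (l : Arr) (a b : ℕ) : K :=
  prodDiff q ((Finset.range r').erase b) (l r') (l r a) /
    prodDiff q ((Finset.range r).erase a) (l r) (l r a) * raw q r' r'' l b

/-- The two orders of the moves share `pathCoef` and differ in one bracket, the distance of the two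
entries when the entry of `r` moves. -/
theorem raw_mul_raw_inner (q : K) {r r' r'' : ℕ} (σ : ℤ) (l : Arr) {a b : ℕ} (hb : b < r')
    (h : r' ≠ r) (h' : r'' ≠ r) :
    raw q r r' l a * raw q r' r'' (l + σ • cell r a) b =
      pathCoef q r r' r'' l a b * qInt q (l r' b - l r a) := by
  rw [raw_congr q b (add_cell_of_ne l h σ a) (add_cell_of_ne l h' σ a),
    raw_of_agree q hb (l := l) rfl fun _ _ => rfl, pathCoef]
  ring

theorem raw_mul_raw_outer (q : K) {r r' r'' : ℕ} (σ : ℤ) (l : Arr) {a b : ℕ} (hb : b < r')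
    (h : r' ≠ r) :
    raw q r' r'' l b * raw q r r' (l + σ • cell r' b) a =
      pathCoef q r r' r'' l a b * qInt q (l r' b + σ - l r a) := by
  rw [raw_of_agree q hb (l := l) (add_cell_of_ne l h.symm σ b)
    fun i hi => add_cell_apply_of_ne l r' hi σ, pathCoef, add_cell_apply_self]
  ring

theorem qInt_add_sub_mul_qInt {q s : K} (hq : Generic q) (hs : s = q ∨ s = q⁻¹) {σ : ℤ}
    (hσ : σ = 1 ∨ σ = -1) (x : ℤ) :
    qInt q (x + σ) - s * qInt q x = σ * s ^ (-σ * x) := by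
  rcases hσ with rfl | rfl
  · rw [qInt_add_sub_mul hq hs]; simp
  · have := qInt_add_sub_mul hq (x := -x) hs
    rw [show -x + 1 = -(x + -1) by ring, qInt_neg, qInt_neg, neg_neg] at this
    rw [neg_neg, one_mul, ← this]
    push_cast
    ring

open Classical in
/-- The matrix coefficients of the `q`-commutators of adjacent moves. -/
theorem qComm_moveOp_single {q s : K} (hq : Generic q) (hs : s = q ∨ s = q⁻¹) {r r' r'' : ℕ} {σ : ℤ}
    (hr : IsStep r r' σ) (hr' : IsStep r' r'' σ) (l : Arr) :
    qComm s (moveOp q r r' σ) (moveOp q r' r'' σ) (Finsupp.single l 1) =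
      ∑ a ∈ Finset.range r, ∑ b ∈ Finset.range r',
        Finsupp.single (l + σ • cell r a + σ • cell r' b)
          (if Interlaced l ∧ Interlaced (l + σ • cell r a + σ • cell r' b) then
            σ * (pathCoef q r r' r'' l a b * s ^ (-σ * (l r' b - l r a))) else 0) := by
  have hσ : σ = 1 ∨ σ = -1 := by unfold IsStep at hr; omega
  have h1 : r' ≠ r := by unfold IsStep at hr; omega
  have h2 : r'' ≠ r := by unfold IsStep at hr hr'; omega
  simp only [qComm, moveOp, LinearMap.sub_apply, LinearMap.smul_apply, Module.End.mul_apply,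
    rowOp_single, map_sum, one_mul]
  rw [Finset.sum_comm, Finset.smul_sum, ← Finset.sum_sub_distrib]
  refine Finset.sum_congr rfl fun a ha => ?_
  rw [Finset.smul_sum, ← Finset.sum_sub_distrib]
  refine Finset.sum_congr rfl fun b hb => ?_
  rw [Finset.mem_range] at ha hb
  rw [Finsupp.smul_single, smul_eq_mul, add_right_comm l (σ • cell r' b), ← Finsupp.single_sub]
  congr 1
  split_ifs with hlf
  · obtain ⟨hl, hf⟩ := hlf
    have hf' := hf
    rw [add_right_comm] at hf'
    rw [coef_mul_coef q hl hf', coef_mul_coef q hl hf, raw_mul_raw_inner q σ l hb h1 h2,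
      raw_mul_raw_outer q σ l hb h1]
    -- The two orders contribute `[x + σ]` and `-s [x]`; for `s = q` or `q⁻¹` their sum is a
    -- monomial in `s`. This is why the composite generators still have product coefficients.
    · have := qInt_add_sub_mul_qInt hq hs hσ (l r' b - l r a)
      rw [sub_add_eq_add_sub] at this
      linear_combination pathCoef q r r' r'' l a b * this
    · intro hm
      by_contra hne
      refine hm (interlaced_lower_upper hr hl hf fun h => hne ?_)
      rw [raw_eq_zero q hb h, zero_mul]
    · intro hm
      by_contra hne
      refine hm (interlaced_upper_lower hr hl hf' fun h => hne ?_)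
      rw [raw_eq_zero (r := r) (r' := r') q hb h, mul_zero]
  · rw [coef_mul_coef_of_not q hlf, coef_mul_coef_of_not q (by rwa [add_right_comm])]
    simp

end TwoStep

/-! ### The normalized basis and the radicands -/

section Normalize

/-- The positive square root of the gauge. -/
noncomputable def sqrtGauge (P : ℕ) (l : Arr) : FracK := (isPos_gauge P l).exists_sqrt.choose

theorem isPos_sqrtGauge (P : ℕ) (l : Arr) : IsPos (sqrtGauge P l) :=
  (isPos_gauge P l).exists_sqrt.choose_spec.1

theorem sqrtGauge_sq (P : ℕ) (l : Arr) : sqrtGauge P l ^ 2 = gauge P l :=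
  (isPos_gauge P l).exists_sqrt.choose_spec.2

/-- `n (n - 1) / 2`. -/
def tri (n : ℤ) : ℤ := n * (n - 1) / 2

theorem tri_add_one (n : ℤ) : tri (n + 1) = tri n + n := by
  unfold tri
  rw [show (n + 1) * (n + 1 - 1) = n * (n - 1) + n * 2 by ring, Int.add_mul_ediv_right _ _ two_ne_zero]

/-- The power of `q` in the normalization of the basis. -/
noncomputable def qGauge (P : ℕ) (l : Arr) : FracK :=
  ∏ p ∈ Finset.range P, alt qK p ^ ∑ a ∈ Finset.range p, tri (l p a)

theorem qK_ne_zero : qK ≠ 0 := generic_qK.ne_zero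

theorem qGauge_ne_zero (P : ℕ) (l : Arr) : qGauge P l ≠ 0 :=
  Finset.prod_ne_zero_iff.mpr fun _ _ => zpow_ne_zero _ (alt_ne_zero qK_ne_zero _)

/-- The increment of a triangular number at `n` is `n`, so the normalization changes by `alt qK r`
to the power of the entry that is moved. -/
theorem qGauge_add_cell (l : Arr) {P r a : ℕ} (hr : r < P) (ha : a < r) :
    qGauge P (l + (1 : ℤ) • cell r a) = qGauge P l * alt qK r ^ l r a := by
  rw [← mul_one (qGauge P (l + _)), qGauge, qGauge]
  refine prod_mul_of_change (Finset.mem_range.mpr hr) _ _ (fun i _ hi => ?_) ?_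
  · rw [add_cell_of_ne _ hi]
  · rw [mul_one, ← zpow_add₀ (alt_ne_zero qK_ne_zero _), ← Finset.add_sum_erase _ _
      (Finset.mem_range.mpr ha), ← Finset.add_sum_erase (Finset.range r) _
      (Finset.mem_range.mpr ha), add_cell_apply_self, tri_add_one, Finset.sum_congr rfl fun i hi => by
        rw [add_cell_apply_of_ne _ _ (Finset.ne_of_mem_erase hi)]]
    congr 1
    ring

/-- The ratio between the orthonormal and the rational basis. -/
noncomputable def norm (P : ℕ) (l : Arr) : FracK := qGauge P l / sqrtGauge P l

theorem norm_ne_zero (P : ℕ) (l : Arr) : norm P l ≠ 0 :=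
  div_ne_zero (qGauge_ne_zero P l) (isPos_sqrtGauge P l).ne_zero

/-- The sign that is `1` for `j < k` and `-1` otherwise. -/
noncomputable def colSign (j k : ℕ) : FracK := if j < k then 1 else -1

theorem colSign_sq (j k : ℕ) : colSign j k ^ 2 = 1 := by
  unfold colSign; split_ifs <;> norm_num

variable {l : Arr} {n j k P : ℕ}

/-- Of the two orders of the moves, one is chosen that passes through an interlaced array, so
`raw_gauge` applies to both steps. The bracket between the two entries, of known sign, is then
divided out. -/
theorem pathCoef_gauge (hl : Interlaced l) (hj : j < n + 1) (hk : k < n + 2)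
    (hf : Interlaced (l + (1 : ℤ) • cell (n + 1) j + (1 : ℤ) • cell (n + 2) k)) (hP : n + 2 < P) :
    IsPos (-(colSign j k * pathCoef qK (n + 1) (n + 2) (n + 3) l j k)) ∧
    IsPos (colSign j k * pathCoef qK (n + 2) (n + 1) n
      (l + (1 : ℤ) • cell (n + 1) j + (1 : ℤ) • cell (n + 2) k) k j) ∧
    pathCoef qK (n + 1) (n + 2) (n + 3) l j k *
      gauge P (l + (1 : ℤ) • cell (n + 1) j + (1 : ℤ) • cell (n + 2) k) =
    -pathCoef qK (n + 2) (n + 1) n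
      (l + (1 : ℤ) • cell (n + 1) j + (1 : ℤ) • cell (n + 2) k) k j * gauge P l := by
  set f := l + (1 : ℤ) • cell (n + 1) j + (1 : ℤ) • cell (n + 2) k with hfdef
  have hf' : f = l + (1 : ℤ) • cell (n + 2) k + (1 : ℤ) • cell (n + 1) j := by
    rw [hfdef, add_right_comm]
  have fj : f (n + 1) j = l (n + 1) j + 1 := by
    rw [hfdef, add_cell_of_ne _ (by omega), add_cell_apply_self]
  have fk : f (n + 2) k = l (n + 2) k + 1 := by
    rw [hf', add_cell_of_ne _ (by omega), add_cell_apply_self]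
  have hstep : IsStep (n + 1) (n + 2) 1 := isStep_up (n + 1)
  have hint := hl (n + 1) k j hk hj
  -- For `j < k` the entry of the row `n + 1` lies above that of the row `n + 2` and may be raised
  -- first; otherwise the entry of the row `n + 2` goes first.
  rcases lt_or_ge j k with hjk | hkj
  · have hx : l (n + 2) k < l (n + 1) j := hint.2 hjk
    have hm : Interlaced (l + (1 : ℤ) • cell (n + 1) j) :=
      interlaced_lower_upper hstep hl hf hx.ne
    obtain ⟨a1, a2, a3⟩ := raw_gauge hl hj hm (show n + 1 < P by omega)
    obtain ⟨b1, b2, b3⟩ := raw_gauge (n := n + 1) hm hk hf hP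
    have e1 := raw_mul_raw_inner qK (r := n + 1) (r' := n + 2) (r'' := n + 3) 1 l (a := j) hk
      (by omega) (by omega)
    have e2 := raw_mul_raw_inner qK (r := n + 2) (r' := n + 1) (r'' := n) (-1) f (a := k) hj
      (by omega) (by omega)
    have ef : f + (-1 : ℤ) • cell (n + 2) k = l + (1 : ℤ) • cell (n + 1) j := by
      rw [hfdef, add_assoc, ← add_smul]; simp
    rw [ef, fj, fk, add_sub_add_right_eq_sub, ← neg_sub (l (n + 2) k), qInt_neg] at e2
    have px : IsPos (-qInt qK (l (n + 2) k - l (n + 1) j)) := by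
      rw [← qInt_neg]; exact IsPos.qInt (by omega)
    have p1 := a1.mul b1
    have p2 := b2.mul a2
    rw [neg_mul_neg, e1] at p1
    rw [e2] at p2
    rw [colSign, if_pos hjk, one_mul, one_mul]
    refine ⟨IsPos.of_mul_right (by rwa [neg_mul_neg]) px, IsPos.of_mul_right p2 px, ?_⟩
    have z := (isPos_gauge P (l + (1 : ℤ) • cell (n + 1) j)).ne_zero
    have zx := px.ne_zero
    apply mul_left_cancel₀ zx
    apply mul_left_cancel₀ z
    generalize gauge P (l + (1 : ℤ) • cell (n + 1) j) = G1 at *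
    linear_combination (G1 * gauge P f) * e1 - (G1 * gauge P l) * e2 +
      raw qK (n + 1) (n + 2) l j * G1 * b3 - raw qK (n + 2) (n + 1) f k * G1 * a3
  · have hx : l (n + 1) j ≤ l (n + 2) k := hint.1 hkj
    have hm : Interlaced (l + (1 : ℤ) • cell (n + 2) k) :=
      interlaced_upper_lower hstep hl (hf' ▸ hf) (by
        rw [add_cell_apply_self, add_cell_of_ne _ (by omega)]; omega)
    obtain ⟨a1, a2, a3⟩ := raw_gauge (n := n + 1) hl hk hm hP
    obtain ⟨b1, b2, b3⟩ := raw_gauge (n := n) hm hj (hf' ▸ hf) (show n + 1 < P by omega)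
    rw [← hf'] at b2 b3
    have e1 := raw_mul_raw_outer qK (r := n + 1) (r' := n + 2) (r'' := n + 3) 1 l (a := j) hk
      (by omega)
    have e2 := raw_mul_raw_outer qK (r := n + 2) (r' := n + 1) (r'' := n) (-1) f (a := k) hj
      (by omega)
    have ef : f + (-1 : ℤ) • cell (n + 1) j = l + (1 : ℤ) • cell (n + 2) k := by
      rw [hf', add_assoc, ← add_smul]; simp
    rw [ef, fj, fk, show l (n + 1) j + 1 + -1 - (l (n + 2) k + 1) =
      -(l (n + 2) k + 1 - l (n + 1) j) by ring, qInt_neg] at e2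
    have px : IsPos (qInt qK (l (n + 2) k + 1 - l (n + 1) j)) := IsPos.qInt (by omega)
    have p1 := a1.mul b1
    have p2 := b2.mul a2
    rw [neg_mul_neg, e1] at p1
    rw [e2, mul_neg] at p2
    rw [colSign, if_neg (by omega), neg_one_mul, neg_one_mul, neg_neg]
    refine ⟨IsPos.of_mul_right p1 px, IsPos.of_mul_right (by rwa [neg_mul]) px, ?_⟩
    have z := (isPos_gauge P (l + (1 : ℤ) • cell (n + 2) k)).ne_zero
    have zx := px.ne_zero
    apply mul_left_cancel₀ zx
    apply mul_left_cancel₀ z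
    generalize gauge P (l + (1 : ℤ) • cell (n + 2) k) = G1 at *
    linear_combination (-G1 * gauge P f) * e1 + (G1 * gauge P l) * e2 -
      raw qK (n + 2) (n + 3) l k * G1 * b3 + raw qK (n + 1) n f j * G1 * a3

/-- The radicand of the move of two entries. -/
noncomputable def rad (n : ℕ) (l : Arr) (j k : ℕ) : FracK :=
  -(pathCoef qK (n + 1) (n + 2) (n + 3) l j k * pathCoef qK (n + 2) (n + 1) n
      (l + (1 : ℤ) • cell (n + 1) j + (1 : ℤ) • cell (n + 2) k) k j)

theorem isPos_rad (hl : Interlaced l) (hj : j < n + 1) (hk : k < n + 2)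
    (hf : Interlaced (l + (1 : ℤ) • cell (n + 1) j + (1 : ℤ) • cell (n + 2) k)) :
    IsPos (rad n l j k) := by
  obtain ⟨h1, h2, -⟩ := pathCoef_gauge hl hj hk hf (Nat.lt_succ_self _)
  have := h1.mul h2
  rw [rad]
  convert this using 1
  linear_combination (-pathCoef qK (n + 1) (n + 2) (n + 3) l j k * pathCoef qK (n + 2) (n + 1) n
      (l + (1 : ℤ) • cell (n + 1) j + (1 : ℤ) • cell (n + 2) k) k j) * (colSign_sq j k).symm

theorem qGauge_add_add (hj : j < n + 1) (hk : k < n + 2) (hP : n + 2 < P) :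
    qGauge P (l + (1 : ℤ) • cell (n + 1) j + (1 : ℤ) • cell (n + 2) k) =
      qGauge P l * alt qK (n + 1) ^ (-(l (n + 2) k - l (n + 1) j)) := by
  have h0 := alt_ne_zero qK_ne_zero (n + 1)
  rw [qGauge_add_cell _ hP hk, qGauge_add_cell _ (by omega) hj, add_cell_of_ne _ (by omega),
    alt_succ qK (n + 1), inv_zpow', mul_assoc, ← zpow_add₀ h0]
  congr 2
  ring

/-- The gauge relation turns the square of the path coefficient into the radicand times a ratio of
gauges. Both sides being positive up to the sign `colSign`, equality of squares gives equality; the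
power of `q` is absorbed by `qGauge`. -/
theorem norm_mul_raise (hl : Interlaced l) (hj : j < n + 1) (hk : k < n + 2)
    (hf : Interlaced (l + (1 : ℤ) • cell (n + 1) j + (1 : ℤ) • cell (n + 2) k)) (hP : n + 2 < P)
    {w : FracK} (hw : IsPos w) (hw2 : w ^ 2 = rad n l j k) :
    norm P l * (pathCoef qK (n + 1) (n + 2) (n + 3) l j k *
      alt qK (n + 1) ^ (-(l (n + 2) k - l (n + 1) j))) =
    -(colSign j k * w) * norm P (l + (1 : ℤ) • cell (n + 1) j + (1 : ℤ) • cell (n + 2) k) := by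
  obtain ⟨h1, h2, h3⟩ := pathCoef_gauge hl hj hk hf hP
  have z1 := (isPos_sqrtGauge P l).ne_zero
  have z2 := (isPos_sqrtGauge P
    (l + (1 : ℤ) • cell (n + 1) j + (1 : ℤ) • cell (n + 2) k)).ne_zero
  have s1 := sqrtGauge_sq P l
  have s2 := sqrtGauge_sq P (l + (1 : ℤ) • cell (n + 1) j + (1 : ℤ) • cell (n + 2) k)
  have p1 := isPos_sqrtGauge P l
  have p2 := isPos_sqrtGauge P (l + (1 : ℤ) • cell (n + 1) j + (1 : ℤ) • cell (n + 2) k)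
  rw [norm, norm, qGauge_add_add hj hk hP]
  rw [rad] at hw2
  generalize gauge P (l + (1 : ℤ) • cell (n + 1) j + (1 : ℤ) • cell (n + 2) k) = G2 at *
  generalize sqrtGauge P (l + (1 : ℤ) • cell (n + 1) j + (1 : ℤ) • cell (n + 2) k) = r2 at *
  generalize sqrtGauge P l = r1 at *
  generalize pathCoef qK (n + 1) (n + 2) (n + 3) l j k = C at *
  generalize pathCoef qK (n + 2) (n + 1) n _ k j = R at *
  have hs := colSign_sq j k
  generalize colSign j k = s at *
  have key : w = -(s * C) * (r2 / r1) := by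
    refine hw.eq_of_sq_eq (h1.mul (p2.div p1)) ?_
    rw [hw2]
    field_simp
    rw [s1, s2]
    linear_combination (-C) * h3 - C ^ 2 * G2 * hs
  rw [show -(s * w) = C * (r2 / r1) by rw [key]; linear_combination C * (r2 / r1) * hs]
  field_simp

theorem norm_mul_lower (hl : Interlaced l) (hj : j < n + 1) (hk : k < n + 2)
    (hf : Interlaced (l + (1 : ℤ) • cell (n + 1) j + (1 : ℤ) • cell (n + 2) k)) (hP : n + 2 < P)
    {w : FracK} (hw : IsPos w) (hw2 : w ^ 2 = rad n l j k) :
    norm P (l + (1 : ℤ) • cell (n + 1) j + (1 : ℤ) • cell (n + 2) k) *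
      (pathCoef qK (n + 2) (n + 1) n
        (l + (1 : ℤ) • cell (n + 1) j + (1 : ℤ) • cell (n + 2) k) k j *
      alt qK (n + 1) ^ (l (n + 2) k - l (n + 1) j)) =
    colSign j k * w * norm P l := by
  obtain ⟨h1, h2, h3⟩ := pathCoef_gauge hl hj hk hf hP
  have z1 := (isPos_sqrtGauge P l).ne_zero
  have z2 := (isPos_sqrtGauge P
    (l + (1 : ℤ) • cell (n + 1) j + (1 : ℤ) • cell (n + 2) k)).ne_zero
  have s1 := sqrtGauge_sq P l
  have s2 := sqrtGauge_sq P (l + (1 : ℤ) • cell (n + 1) j + (1 : ℤ) • cell (n + 2) k)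
  have p1 := isPos_sqrtGauge P l
  have p2 := isPos_sqrtGauge P (l + (1 : ℤ) • cell (n + 1) j + (1 : ℤ) • cell (n + 2) k)
  rw [norm, norm, qGauge_add_add hj hk hP]
  rw [rad] at hw2
  generalize gauge P (l + (1 : ℤ) • cell (n + 1) j + (1 : ℤ) • cell (n + 2) k) = G2 at *
  generalize sqrtGauge P (l + (1 : ℤ) • cell (n + 1) j + (1 : ℤ) • cell (n + 2) k) = r2 at *
  generalize sqrtGauge P l = r1 at *
  generalize pathCoef qK (n + 1) (n + 2) (n + 3) l j k = C at *
  generalize pathCoef qK (n + 2) (n + 1) n _ k j = R at *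
  have hs := colSign_sq j k
  generalize colSign j k = s at *
  have key : w = (s * R) * (r1 / r2) := by
    refine hw.eq_of_sq_eq (h2.mul (p1.div p2)) ?_
    rw [hw2]
    field_simp
    rw [s1, s2]
    linear_combination (-R) * h3 - R ^ 2 * gauge P l * hs
  rw [show s * w = R * (r1 / r2) by rw [key]; linear_combination R * (r1 / r2) * hs, zpow_neg]
  have := zpow_ne_zero (l (n + 2) k - l (n + 1) j) (alt_ne_zero qK_ne_zero (n + 1))
  field_simp

end Normalize

/-! ### `C`-patterns as interlaced integer arrays -/

section Patterns

/-- `x` is an integer. -/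
def IsInt (x : ℂ[X]) : Prop := ∃ z : ℤ, x = (z : ℂ[X])

open Classical in
/-- The integer equal to `x` (and `0` if there is none). -/
noncomputable def toInt (x : ℂ[X]) : ℤ := if h : IsInt x then h.choose else 0

theorem IsInt.eq {x : ℂ[X]} (h : IsInt x) : x = (toInt x : ℂ[X]) := by
  rw [toInt, dif_pos h]
  exact h.choose_spec

theorem intCast_poly_injective {a b : ℤ} (h : (a : ℂ[X]) = b) : a = b := Int.cast_injective h

theorem isNonnegInt_intCast (z : ℤ) : IsNonnegInt (z : ℂ[X]) ↔ 0 ≤ z := by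
  constructor
  · rintro ⟨n, hn⟩
    have : z = (n : ℤ) := intCast_poly_injective (by rw [hn]; simp)
    omega
  · intro h
    obtain ⟨n, rfl⟩ := Int.eq_ofNat_of_zero_le h
    exact ⟨n, by simp⟩

theorem IsNonnegInt.isInt {x : ℂ[X]} : IsNonnegInt x → IsInt x := by
  rintro ⟨n, rfl⟩
  exact ⟨n, by simp⟩

theorem IsInt.add {x y : ℂ[X]} : IsInt x → IsInt y → IsInt (x + y) := by
  rintro ⟨a, rfl⟩ ⟨b, rfl⟩
  exact ⟨a + b, by push_cast; rfl⟩

theorem IsInt.neg {x : ℂ[X]} : IsInt x → IsInt (-x) := by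
  rintro ⟨a, rfl⟩
  exact ⟨-a, by push_cast; rfl⟩

/-- Row `p` has exactly `p` positions, centred around the column `0`. -/
theorem isSlot_iff {i p : ℤ} : IsSlot i p ↔ 1 ≤ p ∧ -(p / 2) ≤ i ∧ i ≤ (p + 1) / 2 - 1 := by
  constructor
  · rintro ⟨k, θ, hk, hθ, rfl, h1, h2⟩
    omega
  · rintro ⟨h, h1, h2⟩
    exact ⟨(p + 1) / 2, (p + 1) % 2, by omega, by omega, by omega, by omega, by omega⟩

/-- The column of the `a`-th entry of the row `r`. -/
def col (r a : ℕ) : ℤ := a - (r / 2 : ℕ)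

theorem isSlot_col {r a : ℕ} (h : a < r) : IsSlot (col r a) r := by
  rw [isSlot_iff]
  unfold col
  omega

theorem exists_col_of_isSlot {i p : ℤ} (h : IsSlot i p) : ∃ r a : ℕ, a < r ∧ p = r ∧ i = col r a := by
  rw [isSlot_iff] at h
  refine ⟨p.toNat, (i + p / 2).toNat, by omega, by omega, ?_⟩
  unfold col
  omega

/-- The conditions on an array that do not involve the betweenness relations. -/
structure IsPre (M : ℤ → ℂ[X]) (m : ℤ → ℤ → ℂ[X]) : Prop where
  off_slot : ∀ i p, ¬ IsSlot i p → m i p = 0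
  stable : ∃ N : ℤ, 1 < N ∧ ∀ i p, IsSlot i p → N ≤ p → m i p = M i
  integral : ∀ i p, IsSlot i p → IsInt (m i p - M 0)

/-- The integer array of a pattern, shifted so that rows are strictly decreasing. -/
noncomputable def ell (M : ℤ → ℂ[X]) (m : ℤ → ℤ → ℂ[X]) : Arr := fun r a =>
  if a < r then toInt (m (col r a) r - M 0) - a else 0

variable {M : ℤ → ℂ[X]} {m : ℤ → ℤ → ℂ[X]}

theorem IsPre.eq (h : IsPre M m) {r a : ℕ} (ha : a < r) :
    m (col r a) r = M 0 + ((ell M m r a + a : ℤ) : ℂ[X]) := by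
  have := (h.integral _ _ (isSlot_col ha)).eq
  rw [ell, if_pos ha, sub_add_cancel, ← this]
  ring

theorem IsPre.L_eq (h : IsPre M m) {r a : ℕ} (ha : a < r) :
    L m (col r a) r = M 0 + ((ell M m r a + (r / 2 : ℕ) : ℤ) : ℂ[X]) := by
  rw [L, h.eq ha, col]
  push_cast
  ring

/-- In the stable rows the entries are the `M i`, which differ from `M 0` by integers; each
betweenness condition passes integrality on to the row with one entry fewer. -/
theorem IsCPattern.isPre (hM : ∀ i j : ℤ, i < j → IsNonnegInt (M i - M j)) (h : IsCPattern M m) :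
    IsPre M m where
  off_slot := h.off_slot
  stable := h.stable
  integral := by
    obtain ⟨N, hN, hs⟩ := h.stable
    have key : ∀ d : ℕ, ∀ i p, IsSlot i p → N ≤ p + d → IsInt (m i p - M 0) := by
      intro d
      induction d with
      | zero =>
        intro i p hip hp
        rw [hs i p hip (by simpa using hp)]
        rcases lt_trichotomy i 0 with h0 | h0 | h0
        · exact (hM i 0 h0).isInt
        · exact ⟨0, by rw [h0]; simp⟩
        · have := (hM 0 i h0).isInt.neg
          rwa [neg_sub] at this
      | succ d ih =>
        intro i p hip hp
        obtain ⟨k, θ, hk, hθ, rfl, h1, h2⟩ := hip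
        have h3 := (h.between k θ i hk hθ h1 h2).2.isInt
        have h4 := ih (i + θ) (2 * k + θ) (by rw [isSlot_iff]; omega) (by push_cast at hp; omega)
        have := h3.add h4
        rwa [sub_add_sub_cancel] at this
    intro i p hip
    exact key (N - p).toNat i p hip (by omega)

/-- The inequalities between nearest neighbours chain along the rows and imply all the others. -/
theorem interlaced_of_local {l : Arr}
    (h : ∀ p a : ℕ, a < p → l p a ≤ l (p + 1) a ∧ l (p + 1) (a + 1) < l p a) : Interlaced l := by
  have hd : ∀ p a b : ℕ, a ≤ b → b < p + 1 → l (p + 1) b ≤ l (p + 1) a := by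
    intro p a b hab
    induction b, hab using Nat.le_induction with
    | base => intro _; exact le_rfl
    | succ b hab ih =>
      intro hb
      have h1 := h p b (by omega)
      have h2 := ih (by omega)
      omega
  intro p a b ha hb
  have h1 := h p b hb
  refine ⟨fun hab => ?_, fun hba => ?_⟩
  · have := hd p a b hab (by omega)
    omega
  · have := hd p (b + 1) a hba ha
    omega

/-- Subtracting the place `a` within the row turns one of the two weak betweenness inequalities into
a strict one and leaves the other weak. -/
theorem IsPre.isCPattern_iff (h : IsPre M m) : IsCPattern M m ↔ Interlaced (ell M m) := by
  have e : ∀ r a b : ℕ, a < r → b < r + 1 → ∀ c : ℤ, c = b →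
      m (c - ((r + 1 : ℕ) / 2 : ℕ)) ((r + 1 : ℕ) : ℤ) - m (col r a) r =
      ((ell M m (r + 1) b + b - ell M m r a - a : ℤ) : ℂ[X]) := by
    rintro r a b ha hb c rfl
    have h1 := h.eq hb
    have h2 := h.eq ha
    unfold col at h1 h2 ⊢
    rw [h1, h2]
    push_cast
    ring
  constructor
  · intro hc
    refine interlaced_of_local fun p a ha => ?_
    have hb := hc.between ((p + 1) / 2 : ℕ) ((p + 1) % 2 : ℕ) (col p a) (by omega) (by omega)
      (by unfold col; omega) (by unfold col; omega)
    rw [show (2 : ℤ) * ((p + 1) / 2 : ℕ) + ((p + 1) % 2 : ℕ) = ((p + 1 : ℕ) : ℤ) by omega,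
      show ((p + 1 : ℕ) : ℤ) - 1 = p by omega,
      show col p a + ((p + 1) % 2 : ℕ) - 1 = (a : ℤ) - ((p + 1 : ℕ) / 2 : ℕ) by unfold col; omega,
      show col p a + ((p + 1) % 2 : ℕ) = ((a + 1 : ℕ) : ℤ) - ((p + 1 : ℕ) / 2 : ℕ) by
        unfold col; omega,
      e p a a ha (by omega) a rfl, ← neg_sub (m _ ((p + 1 : ℕ) : ℤ)),
      e p a (a + 1) ha (by omega) (a + 1 : ℕ) rfl, ← Int.cast_neg, isNonnegInt_intCast,
      isNonnegInt_intCast] at hb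
    push_cast at hb
    omega
  · intro hi
    refine ⟨h.off_slot, h.stable, fun k θ i hk hθ h1 h2 => ?_⟩
    obtain ⟨r, a, ha, hp, rfl⟩ := exists_col_of_isSlot (i := i) (p := 2 * k + θ - 1)
      (by rw [isSlot_iff]; omega)
    have q1 := (hi r a a (by omega) ha).1 le_rfl
    have q2 := (hi r (a + 1) a (by omega) ha).2 (by omega)
    rw [hp, show 2 * k + θ = ((r + 1 : ℕ) : ℤ) by omega,
      show col r a + θ - 1 = (a : ℤ) - ((r + 1 : ℕ) / 2 : ℕ) by unfold col; omega,
      show col r a + θ = ((a + 1 : ℕ) : ℤ) - ((r + 1 : ℕ) / 2 : ℕ) by unfold col; omega,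
      e r a a ha (by omega) a rfl, ← neg_sub (m _ ((r + 1 : ℕ) : ℤ)),
      e r a (a + 1) ha (by omega) (a + 1 : ℕ) rfl, ← Int.cast_neg, isNonnegInt_intCast,
      isNonnegInt_intCast]
    push_cast
    omega

theorem IsPre.shift (h : IsPre M m) {r a : ℕ} (ha : a < r) (d : ℤ) :
    IsPre M (shift m (col r a) r d) where
  off_slot i p hip := by
    rw [UhAInf.shift, if_neg, h.off_slot i p hip]
    rintro ⟨rfl, rfl⟩
    exact hip (isSlot_col ha)
  stable := by
    obtain ⟨N, hN, hs⟩ := h.stable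
    refine ⟨max N (r + 1), by omega, fun i p hip hp => ?_⟩
    rw [UhAInf.shift, if_neg (by omega), hs i p hip (by omega)]
  integral i p hip := by
    unfold UhAInf.shift
    split_ifs
    · have := (h.integral i p hip).add ⟨d, rfl⟩
      rwa [sub_add_eq_add_sub] at this
    · exact h.integral i p hip

theorem IsPre.ell_shift (h : IsPre M m) {r a : ℕ} (ha : a < r) (d : ℤ) :
    ell M (UhAInf.shift m (col r a) r d) = ell M m + d • cell r a := by
  funext s b
  simp only [Pi.add_apply, Pi.smul_apply, cell, smul_eq_mul]
  by_cases hb : b < s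
  · have e1 := (h.shift ha d).eq hb
    have e2 := h.eq hb
    by_cases hsb : s = r ∧ b = a
    · obtain ⟨rfl, rfl⟩ := hsb
      rw [UhAInf.shift, if_pos ⟨rfl, rfl⟩, e2, add_assoc, add_right_inj, ← Int.cast_add] at e1
      have := intCast_poly_injective e1
      simp
      omega
    · rw [UhAInf.shift, if_neg, e2, add_right_inj] at e1
      · have := intCast_poly_injective e1
        rw [if_neg hsb]
        omega
      · rintro ⟨h1, h2⟩
        have : s = r := by exact_mod_cast h2
        subst this
        unfold col at h1
        exact hsb ⟨rfl, by omega⟩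
  · rw [ell, ell, if_neg hb, if_neg hb, if_neg]
    · simp
    · rintro ⟨rfl, rfl⟩
      exact hb ha

theorem IsPre.ext {m' : ℤ → ℤ → ℂ[X]} (h : IsPre M m) (h' : IsPre M m')
    (he : ell M m = ell M m') : m = m' := by
  funext i p
  by_cases hip : IsSlot i p
  · obtain ⟨r, a, ha, rfl, rfl⟩ := exists_col_of_isSlot hip
    rw [h.eq ha, h'.eq ha, he]
  · rw [h.off_slot i p hip, h'.off_slot i p hip]

end Patterns

/-! ### Comparison with the model -/

section Intertwine

variable {M : ℤ → ℂ[X]}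

/-- The comparison of the orthonormal with the rational basis. -/
noncomputable def phi (M : ℤ → ℂ[X]) (P : ℕ) : VHat M →ₗ[ℂ⟦X⟧] (Arr →₀ FracK) :=
  Finsupp.linearCombination ℂ⟦X⟧ fun m => Finsupp.single (ell M m.1) (norm P (ell M m.1))

theorem phi_single (P : ℕ) (m : CPattern M) (c : ℂ⟦X⟧) :
    phi M P (Finsupp.single m c) =
      Finsupp.single (ell M m.1) (toK c * norm P (ell M m.1)) := by
  rw [phi, Finsupp.linearCombination_single, Finsupp.smul_single, Algebra.smul_def]

theorem ell_injective (hM : ∀ i j : ℤ, i < j → IsNonnegInt (M i - M j)) {m m' : CPattern M}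
    (h : ell M m.1 = ell M m'.1) : m = m' :=
  Subtype.ext ((m.2.isPre hM).ext (m'.2.isPre hM) h)

theorem phi_injective (hM : ∀ i j : ℤ, i < j → IsNonnegInt (M i - M j)) (P : ℕ) :
    Function.Injective (phi M P) := by
  have key : ∀ (v : VHat M) (m : CPattern M),
      phi M P v (ell M m.1) = toK (v m) * norm P (ell M m.1) := by
    intro v m
    induction v using Finsupp.induction_linear with
    | zero => simp
    | add v w hv hw => rw [map_add, Finsupp.add_apply, hv, hw, Finsupp.add_apply, map_add, add_mul]
    | single m' c =>
      rw [phi_single]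
      by_cases h : m' = m
      · subst h; simp
      · rw [Finsupp.single_eq_of_ne, Finsupp.single_eq_of_ne, map_zero, zero_mul]
        · exact fun e => h e.symm
        · exact fun e => h (ell_injective hM e.symm)
  refine (injective_iff_map_eq_zero _).mpr fun v hv => ?_
  ext1 m
  have := key v m
  rw [hv, Finsupp.zero_apply] at this
  exact (map_eq_zero_iff _ toK_injective).mp
    ((mul_eq_zero.mp this.symm).resolve_right (norm_ne_zero _ _))

/-- `T` corresponds to `U` under the comparison map of all sufficiently high rows. -/
def Corresponds (T : Module.End ℂ⟦X⟧ (VHat M)) (U : Module.End FracK (Arr →₀ FracK)) : Prop :=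
  ∃ P₀, ∀ P ≥ P₀, ∀ v, phi M P (T v) = U (phi M P v)

namespace Corresponds

variable {T T' : Module.End ℂ⟦X⟧ (VHat M)} {U U' : Module.End FracK (Arr →₀ FracK)}

theorem mul : Corresponds T U → Corresponds T' U' → Corresponds (T * T') (U * U') := by
  rintro ⟨P, h⟩ ⟨P', h'⟩
  refine ⟨max P P', fun Q hQ v => ?_⟩
  rw [Module.End.mul_apply, Module.End.mul_apply, h Q (le_of_max_le_left hQ),
    h' Q (le_of_max_le_right hQ)]

theorem sub : Corresponds T U → Corresponds T' U' → Corresponds (T - T') (U - U') := by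
  rintro ⟨P, h⟩ ⟨P', h'⟩
  refine ⟨max P P', fun Q hQ v => ?_⟩
  rw [LinearMap.sub_apply, LinearMap.sub_apply, map_sub, h Q (le_of_max_le_left hQ),
    h' Q (le_of_max_le_right hQ)]

theorem add : Corresponds T U → Corresponds T' U' → Corresponds (T + T') (U + U') := by
  rintro ⟨P, h⟩ ⟨P', h'⟩
  refine ⟨max P P', fun Q hQ v => ?_⟩
  rw [LinearMap.add_apply, LinearMap.add_apply, map_add, h Q (le_of_max_le_left hQ),
    h' Q (le_of_max_le_right hQ)]

theorem smul (c : ℂ⟦X⟧) : Corresponds T U → Corresponds (c • T) (toK c • U) := by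
  rintro ⟨P, h⟩
  refine ⟨P, fun Q hQ v => ?_⟩
  rw [LinearMap.smul_apply, LinearMap.smul_apply, map_smul, h Q hQ, algebraMap_smul]

/-- Identities of the model are pulled back along the injective `phi`. The truncation row depends on
the operators, so it is taken beyond both thresholds. -/
theorem eq_of_eq (hM : ∀ i j : ℤ, i < j → IsNonnegInt (M i - M j)) :
    Corresponds T U → Corresponds T' U' → U = U' → T = T' := by
  rintro ⟨P, h⟩ ⟨P', h'⟩ rfl
  refine LinearMap.ext fun v => phi_injective hM (max P P') ?_
  rw [h _ (le_max_left _ _), h' _ (le_max_right _ _)]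

theorem of_basis {P₀ : ℕ} (h : ∀ P ≥ P₀, ∀ m : CPattern M,
    phi M P (T (Finsupp.single m 1)) =
      norm P (ell M m.1) • U (Finsupp.single (ell M m.1) 1)) : Corresponds T U := by
  refine ⟨P₀, fun P hP v => ?_⟩
  induction v using Finsupp.induction_linear with
  | zero => simp
  | add v w hv hw => simp only [map_add, hv, hw]
  | single m c =>
    have e : (Finsupp.single m c : VHat M) = c • Finsupp.single m 1 := by simp
    rw [e, map_smul, map_smul, map_smul, h P hP, phi_single, map_one, one_mul,
      ← algebraMap_smul FracK c, ← algebraMap_smul FracK c, map_smul, ← map_smul U, Finsupp.smul_single,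
      smul_eq_mul, mul_one]

end Corresponds

/-- Deleting a term whose array is not a pattern matches the vanishing of `coef` on arrays that are
not interlaced. -/
theorem phi_term (P : ℕ) {m : ℤ → ℤ → ℂ[X]} (h : IsPre M m) (c : ℂ⟦X⟧) [Decidable (Interlaced (ell M m))] :
    phi M P (term M c m) =
      Finsupp.single (ell M m) (if Interlaced (ell M m) then toK c * norm P (ell M m) else 0) := by
  unfold term
  by_cases hm : IsCPattern M m
  · rw [dif_pos hm, if_pos (h.isCPattern_iff.mp hm)]
    exact phi_single P ⟨m, hm⟩ c
  · rw [dif_neg hm, if_neg (fun hi => hm (h.isCPattern_iff.mpr hi)), map_zero, Finsupp.single_zero]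

end Intertwine

/-! ### Radicands of the given action as radicands of the model -/

section Brackets

theorem coe_intCast (z : ℤ) : ((z : ℂ[X]) : ℂ⟦X⟧) = z :=
  map_intCast (Polynomial.coeToPowerSeries.ringHom (R := ℂ)) z

theorem br_intCast (z : ℤ) : br (z : ℂ[X]) = bracket (z : ℂ⟦X⟧) := by
  rw [br, coe_intCast]

theorem toK_br (z : ℤ) : toK (br (z : ℂ[X])) = qInt qK z := by
  rw [br_intCast, toK_bracket_intCast]

theorem constantCoeff_br (z : ℤ) : PowerSeries.constantCoeff (br (z : ℂ[X])) = z := by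
  rw [br_intCast, constantCoeff_bracket, map_intCast]

/-- The columns of a row, as an embedding. -/
def colEmb (r : ℕ) : ℕ ↪ ℤ := ⟨col r, fun a b h => by simp only [col] at h; omega⟩

theorem Icc_eq_map {r : ℕ} {lo hi : ℤ} (hlo : lo = col r 0) (hhi : hi = col r r - 1) :
    Finset.Icc lo hi = (Finset.range r).map (colEmb r) := by
  ext k
  subst hlo hhi
  rw [Finset.mem_Icc, Finset.mem_map]
  change _ ↔ ∃ a ∈ Finset.range r, col r a = k
  simp only [Finset.mem_range]
  unfold col
  constructor
  · rintro ⟨h1, h2⟩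
    exact ⟨(k + (r / 2 : ℕ)).toNat, by omega, by omega⟩
  · rintro ⟨a, ha, rfl⟩
    omega

theorem Icc_erase_eq_map {r : ℕ} {lo hi : ℤ} (b : ℕ) (hlo : lo = col r 0) (hhi : hi = col r r - 1) :
    (Finset.Icc lo hi).erase (col r b) = ((Finset.range r).erase b).map (colEmb r) := by
  rw [Icc_eq_map hlo hhi, Finset.map_erase]
  rfl

theorem toK_prod_br {r : ℕ} {s : Finset ℕ} {F : ℤ → ℂ[X]} {u : ℕ → ℤ} {y : ℤ}
    (hF : ∀ a ∈ s, F (col r a) = ((u a - y : ℤ) : ℂ[X])) :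
    toK (∏ k ∈ s.map (colEmb r), br (F k)) = prodDiff qK s u y := by
  rw [Finset.prod_map, map_prod]
  refine Finset.prod_congr rfl fun a ha => ?_
  change toK (br (F (col r a))) = _
  rw [hF a ha, toK_br]

theorem isUnit_prod_br {r : ℕ} {s : Finset ℕ} {F : ℤ → ℂ[X]} {u : ℕ → ℤ} {y : ℤ}
    (hF : ∀ a ∈ s, F (col r a) = ((u a - y : ℤ) : ℂ[X])) (h : ∀ a ∈ s, u a ≠ y) :
    IsUnit (∏ k ∈ s.map (colEmb r), br (F k)) := by
  rw [PowerSeries.isUnit_iff_constantCoeff, isUnit_iff_ne_zero, Finset.prod_map, map_prod,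
    Finset.prod_ne_zero_iff]
  intro a ha
  change PowerSeries.constantCoeff (br (F (col r a))) ≠ 0
  rw [hF a ha, constantCoeff_br]
  exact_mod_cast sub_ne_zero.mpr (h a ha)

theorem toK_inv {f : ℂ⟦X⟧} (h : IsUnit f) : toK f⁻¹ = (toK f)⁻¹ := by
  have h0 : PowerSeries.constantCoeff f ≠ 0 := by
    rwa [PowerSeries.isUnit_iff_constantCoeff, isUnit_iff_ne_zero] at h
  refine eq_inv_of_mul_eq_one_left ?_
  rw [← map_mul, PowerSeries.inv_mul_cancel _ h0, map_one]

end Brackets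

section Radicand

variable {M : ℤ → ℂ[X]} {m : ℤ → ℤ → ℂ[X]}

/-- The choices of `e` and `f` and of the sign of the index; the generator raises the entries if
`δ = 0` and lowers them if `δ = 1`. -/
def Direction (μ ν : ℕ) (δ : ℤ) : Prop :=
  (μ = 1 ∧ ν = 0 ∧ δ = 0) ∨ (μ = 0 ∧ ν = 1 ∧ δ = 0) ∨ (μ = 0 ∧ ν = 0 ∧ δ = 1) ∨
    (μ = 1 ∧ ν = 1 ∧ δ = 1)

variable {μ ν s n a b : ℕ} {δ : ℤ}

/-- With `n = 2s + ν` the products run over the rows `n`, …, `n + 3`. Subtracting `δ` writes both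
directions in terms of the smaller of the two arrays joined by the move. -/
theorem toK_numer (hm : IsPre M m) (hd : Direction μ ν δ) (hn : n = 2 * s + ν) (ha : a < n + 1)
    (hb : b < n + 2) :
    toK (numer m μ ν (s + 1) (col (n + 1) a) (col (n + 2) b)) =
      prodDiff qK ((Finset.range (n + 2)).erase b) (ell M m (n + 2)) (ell M m (n + 1) a - δ) *
      prodDiff qK (Finset.range n) (ell M m n) (ell M m (n + 1) a - δ + 1) *
      (prodDiff qK (Finset.range (n + 3)) (ell M m (n + 3)) (ell M m (n + 2) b - δ) *
      prodDiff qK ((Finset.range (n + 1)).erase a) (ell M m (n + 1)) (ell M m (n + 2) b - δ + 1)) := by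
  have hν : ν = 0 ∨ ν = 1 := by unfold Direction at hd; omega
  have d0 : n / 2 = s := by omega
  have d1 : (n + 1) / 2 = s + ν := by omega
  have d2 : (n + 2) / 2 = s + 1 := by omega
  have d3 : (n + 3) / 2 = s + 1 + ν := by omega
  have r1 : 2 * ((s : ℤ) + 1) + ν - 1 = ((n + 1 : ℕ) : ℤ) := by omega
  have r0 : 2 * ((s : ℤ) + 1) + ν - 2 = ((n : ℕ) : ℤ) := by omega
  have r3 : 2 * ((s : ℤ) + 1) + ν + 1 = ((n + 3 : ℕ) : ℤ) := by omega
  have r2 : 2 * ((s : ℤ) + 1) + ν = ((n + 2 : ℕ) : ℤ) := by omega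
  rw [numer, r1, r0, r3, r2,
    Icc_erase_eq_map (r := n + 2) b (by unfold col; omega) (by unfold col; omega),
    Icc_erase_eq_map (r := n + 1) a (by unfold col; omega) (by unfold col; omega),
    Icc_eq_map (r := n) (by unfold col; omega) (by unfold col; omega),
    Icc_eq_map (r := n + 3) (by unfold col; omega) (by unfold col; omega), map_mul, map_mul, map_mul]
  congr 1
  · congr 1
    · refine toK_prod_br fun k hk => ?_
      rw [Finset.mem_erase, Finset.mem_range] at hk
      rw [hm.L_eq hk.2, hm.L_eq ha, d1, d2]
      rcases hd with ⟨rfl, rfl, rfl⟩ | ⟨rfl, rfl, rfl⟩ | ⟨rfl, rfl, rfl⟩ | ⟨rfl, rfl, rfl⟩ <;>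
        push_cast <;> ring
    · refine toK_prod_br fun k hk => ?_
      rw [Finset.mem_range] at hk
      rw [hm.L_eq hk, hm.L_eq ha, d1, d0]
      rcases hd with ⟨rfl, rfl, rfl⟩ | ⟨rfl, rfl, rfl⟩ | ⟨rfl, rfl, rfl⟩ | ⟨rfl, rfl, rfl⟩ <;>
        push_cast <;> ring
  · congr 1
    · refine toK_prod_br fun k hk => ?_
      rw [Finset.mem_range] at hk
      rw [hm.L_eq hk, hm.L_eq hb, d2, d3]
      rcases hd with ⟨rfl, rfl, rfl⟩ | ⟨rfl, rfl, rfl⟩ | ⟨rfl, rfl, rfl⟩ | ⟨rfl, rfl, rfl⟩ <;>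
        push_cast <;> ring
    · refine toK_prod_br fun k hk => ?_
      rw [Finset.mem_erase, Finset.mem_range] at hk
      rw [hm.L_eq hk.2, hm.L_eq hb, d1, d2]
      rcases hd with ⟨rfl, rfl, rfl⟩ | ⟨rfl, rfl, rfl⟩ | ⟨rfl, rfl, rfl⟩ | ⟨rfl, rfl, rfl⟩ <;>
        push_cast <;> ring

theorem denom_props (hm : IsPre M m) (hd : Direction μ ν δ) (hn : n = 2 * s + ν) (ha : a < n + 1)
    (hb : b < n + 2)
    (h1 : ∀ k < n + 1, k ≠ a → ell M m (n + 1) k ≠ ell M m (n + 1) a - δ)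
    (h1' : ∀ k < n + 1, k ≠ a → ell M m (n + 1) k ≠ ell M m (n + 1) a - δ + 1)
    (h2 : ∀ k < n + 2, k ≠ b → ell M m (n + 2) k ≠ ell M m (n + 2) b - δ)
    (h2' : ∀ k < n + 2, k ≠ b → ell M m (n + 2) k ≠ ell M m (n + 2) b - δ + 1) :
    IsUnit (denom m μ ν (s + 1) (col (n + 1) a) (col (n + 2) b)) ∧
    toK (denom m μ ν (s + 1) (col (n + 1) a) (col (n + 2) b)) =
      prodDiff qK ((Finset.range (n + 1)).erase a) (ell M m (n + 1)) (ell M m (n + 1) a - δ) *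
      prodDiff qK ((Finset.range (n + 1)).erase a) (ell M m (n + 1)) (ell M m (n + 1) a - δ + 1) *
      (prodDiff qK ((Finset.range (n + 2)).erase b) (ell M m (n + 2)) (ell M m (n + 2) b - δ) *
      prodDiff qK ((Finset.range (n + 2)).erase b) (ell M m (n + 2)) (ell M m (n + 2) b - δ + 1)) := by
  have hν : ν = 0 ∨ ν = 1 := by unfold Direction at hd; omega
  have d1 : (n + 1) / 2 = s + ν := by omega
  have d2 : (n + 2) / 2 = s + 1 := by omega
  have r1 : 2 * ((s : ℤ) + 1) + ν - 1 = ((n + 1 : ℕ) : ℤ) := by omega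
  have r2 : 2 * ((s : ℤ) + 1) + ν = ((n + 2 : ℕ) : ℤ) := by omega
  rw [denom, r1, r2,
    Icc_erase_eq_map (r := n + 2) b (by unfold col; omega) (by unfold col; omega),
    Icc_erase_eq_map (r := n + 1) a (by unfold col; omega) (by unfold col; omega),
    Finset.prod_mul_distrib, Finset.prod_mul_distrib]
  have key : ∀ r c, c < r → ∀ k ∈ (Finset.range r).erase c,
      L m (col r k) r - L m (col r c) r = ((ell M m r k - ell M m r c : ℤ) : ℂ[X]) := by
    intro r c hc k hk
    rw [Finset.mem_erase, Finset.mem_range] at hk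
    rw [hm.L_eq hk.2, hm.L_eq hc]
    push_cast
    ring
  have hε : ((-1 : ℂ[X]) ^ (μ + ν) = ((2 * δ - 1 : ℤ) : ℂ[X])) := by
    rcases hd with ⟨rfl, rfl, rfl⟩ | ⟨rfl, rfl, rfl⟩ | ⟨rfl, rfl, rfl⟩ | ⟨rfl, rfl, rfl⟩ <;>
      norm_num
  have key' : ∀ r c, c < r → ∀ k ∈ (Finset.range r).erase c,
      L m (col r k) r - L m (col r c) r + (-1) ^ (μ + ν) =
        ((ell M m r k - (ell M m r c - (2 * δ - 1)) : ℤ) : ℂ[X]) := by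
    intro r c hc k hk
    rw [key r c hc k hk, hε, ← Int.cast_add]
    congr 1
    ring
  have hδ : δ = 0 ∨ δ = 1 := by unfold Direction at hd; omega
  constructor
  · refine (((isUnit_prod_br (key _ _ ha) ?_).mul (isUnit_prod_br (key' _ _ ha) ?_)).mul
      ((isUnit_prod_br (key _ _ hb) ?_).mul (isUnit_prod_br (key' _ _ hb) ?_)))
    all_goals
      intro k hk
      rw [Finset.mem_erase, Finset.mem_range] at hk
      first
      | have q1 := h1 k hk.2 hk.1
        have q2 := h1' k hk.2 hk.1
        omega
      | have q1 := h2 k hk.2 hk.1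
        have q2 := h2' k hk.2 hk.1
        omega
  · rw [map_mul, map_mul, map_mul, toK_prod_br (key _ _ ha), toK_prod_br (key' _ _ ha),
      toK_prod_br (key _ _ hb), toK_prod_br (key' _ _ hb)]
    rcases hδ with rfl | rfl
    · norm_num
    · norm_num
      ring

/-- The products over the rows of the moved entries omit those entries, so they may be computed from
any array that agrees with `l` elsewhere. -/
theorem rad_eq {l e : Arr} (h1 : ∀ k, k ≠ a → l (n + 1) k = e (n + 1) k)
    (h2 : ∀ k, k ≠ b → l (n + 2) k = e (n + 2) k) (h0 : l n = e n) (h3 : l (n + 3) = e (n + 3)) :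
    rad n l a b =
      -(prodDiff qK ((Finset.range (n + 2)).erase b) (e (n + 2)) (l (n + 1) a) *
      prodDiff qK (Finset.range n) (e n) (l (n + 1) a + 1) *
      (prodDiff qK (Finset.range (n + 3)) (e (n + 3)) (l (n + 2) b) *
      prodDiff qK ((Finset.range (n + 1)).erase a) (e (n + 1)) (l (n + 2) b + 1)) *
      (prodDiff qK ((Finset.range (n + 1)).erase a) (e (n + 1)) (l (n + 1) a) *
      prodDiff qK ((Finset.range (n + 1)).erase a) (e (n + 1)) (l (n + 1) a + 1) *
      (prodDiff qK ((Finset.range (n + 2)).erase b) (e (n + 2)) (l (n + 2) b) *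
      prodDiff qK ((Finset.range (n + 2)).erase b) (e (n + 2)) (l (n + 2) b + 1)))⁻¹) := by
  have c1 : ∀ y, prodDiff qK ((Finset.range (n + 1)).erase a) (l (n + 1)) y =
      prodDiff qK ((Finset.range (n + 1)).erase a) (e (n + 1)) y := fun y =>
    prodDiff_congr qK y fun i hi => h1 i (Finset.ne_of_mem_erase hi)
  have c2 : ∀ y, prodDiff qK ((Finset.range (n + 2)).erase b) (l (n + 2)) y =
      prodDiff qK ((Finset.range (n + 2)).erase b) (e (n + 2)) y := fun y =>
    prodDiff_congr qK y fun i hi => h2 i (Finset.ne_of_mem_erase hi)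
  set f := l + (1 : ℤ) • cell (n + 1) a + (1 : ℤ) • cell (n + 2) b with hf
  have c1' : ∀ y, prodDiff qK ((Finset.range (n + 1)).erase a) (f (n + 1)) y =
      prodDiff qK ((Finset.range (n + 1)).erase a) (e (n + 1)) y := fun y =>
    prodDiff_congr qK y fun i hi => by
      rw [hf, add_cell_of_ne _ (by omega), add_cell_apply_of_ne _ _ (Finset.ne_of_mem_erase hi),
        h1 i (Finset.ne_of_mem_erase hi)]
  have c2' : ∀ y, prodDiff qK ((Finset.range (n + 2)).erase b) (f (n + 2)) y =
      prodDiff qK ((Finset.range (n + 2)).erase b) (e (n + 2)) y := fun y =>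
    prodDiff_congr qK y fun i hi => by
      rw [hf, add_cell_apply_of_ne _ _ (Finset.ne_of_mem_erase hi), add_cell_of_ne _ (by omega),
        h2 i (Finset.ne_of_mem_erase hi)]
  have fa : f (n + 1) a = l (n + 1) a + 1 := by
    rw [hf, add_cell_of_ne _ (by omega), add_cell_apply_self]
  have fb : f (n + 2) b = l (n + 2) b + 1 := by
    rw [hf, add_cell_apply_self, add_cell_of_ne _ (by omega)]
  have f0 : f n = e n := by
    rw [hf, add_cell_of_ne _ (by omega), add_cell_of_ne _ (by omega), h0]
  rw [rad, pathCoef, pathCoef, raw, raw, ← hf, c1, c1', c1', c2, c2, c2', fa, fb, f0, h3]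
  simp only [div_eq_mul_inv, mul_inv]
  ring

end Radicand

/-! ### The given action as normalized `q`-commutators -/

section Action

variable {M : ℤ → ℂ[X]} {m : ℤ → ℤ → ℂ[X]} {μ ν s n a b : ℕ} {δ : ℤ}

/-- The radicand belongs to the edge between two arrays, not to its direction: a lowering term has
the radicand of the raising term that undoes it. Strictly decreasing rows at both ends make the
denominators units. -/
theorem radicand_props (hm : IsPre M m) (hd : Direction μ ν δ) (hn : n = 2 * s + ν) (ha : a < n + 1)
    (hb : b < n + 2) (he : Interlaced (ell M m))
    (hf : Interlaced (ell M m + (1 - 2 * δ) • cell (n + 1) a + (1 - 2 * δ) • cell (n + 2) b)) :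
    IsUnit (denom m μ ν (s + 1) (col (n + 1) a) (col (n + 2) b)) ∧
    toK (radicand m μ ν (s + 1) (col (n + 1) a) (col (n + 2) b)) =
      rad n (ell M m + (-δ) • cell (n + 1) a + (-δ) • cell (n + 2) b) a b := by
  have hδ : δ = 0 ∨ δ = 1 := by unfold Direction at hd; omega
  have h1 : ∀ k < n + 1, k ≠ a → ell M m (n + 1) k ≠ ell M m (n + 1) a ∧
      ell M m (n + 1) k ≠ ell M m (n + 1) a + (1 - 2 * δ) := fun k hk hka => by
    refine ⟨he.ne hk ha hka, ?_⟩
    have := hf.ne hk ha hka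
    rwa [add_cell_of_ne _ (by omega), add_cell_apply_self, add_cell_apply_of_ne _ _ hka] at this
  have h2 : ∀ k < n + 2, k ≠ b → ell M m (n + 2) k ≠ ell M m (n + 2) b ∧
      ell M m (n + 2) k ≠ ell M m (n + 2) b + (1 - 2 * δ) := fun k hk hka => by
    refine ⟨he.ne hk hb hka, ?_⟩
    have := hf.ne hk hb hka
    rwa [add_cell_apply_of_ne _ _ hka, add_cell_apply_self, add_cell_of_ne _ (by omega)] at this
  obtain ⟨u1, u2⟩ := denom_props hm hd hn ha hb
    (fun k hk hka => by have := h1 k hk hka; omega) (fun k hk hka => by have := h1 k hk hka; omega)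
    (fun k hk hka => by have := h2 k hk hka; omega) (fun k hk hka => by have := h2 k hk hka; omega)
  refine ⟨u1, ?_⟩
  rw [radicand, map_neg, map_mul, toK_inv u1, u2, toK_numer hm hd hn ha hb,
    rad_eq (e := ell M m)]
  · rw [add_cell_of_ne _ (show n + 1 ≠ n + 2 by omega), add_cell_apply_self, add_cell_apply_self,
      add_cell_of_ne _ (show n + 2 ≠ n + 1 by omega)]
    rfl
  · intro k hk
    rw [add_cell_of_ne _ (by omega), add_cell_apply_of_ne _ _ hk]
  · intro k hk
    rw [add_cell_apply_of_ne _ _ hk, add_cell_of_ne _ (by omega)]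
  · rw [add_cell_of_ne _ (by omega), add_cell_of_ne _ (by omega)]
  · rw [add_cell_of_ne _ (by omega), add_cell_of_ne _ (by omega)]

theorem target_props (hm : IsPre M m) (hd : Direction μ ν δ) (hn : n = 2 * s + ν) (ha : a < n + 1)
    (hb : b < n + 2) :
    IsPre M (target m μ ν (s + 1) (col (n + 1) a) (col (n + 2) b)) ∧
    ell M (target m μ ν (s + 1) (col (n + 1) a) (col (n + 2) b)) =
      ell M m + (1 - 2 * δ) • cell (n + 1) a + (1 - 2 * δ) • cell (n + 2) b := by
  have r1 : 2 * ((s : ℤ) + 1) - 1 + ν = ((n + 1 : ℕ) : ℤ) := by omega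
  have r2 : 2 * ((s : ℤ) + 1) + ν = ((n + 2 : ℕ) : ℤ) := by omega
  have hε : -(-1 : ℤ) ^ (μ + ν) = 1 - 2 * δ := by
    rcases hd with ⟨rfl, rfl, rfl⟩ | ⟨rfl, rfl, rfl⟩ | ⟨rfl, rfl, rfl⟩ | ⟨rfl, rfl, rfl⟩ <;>
      norm_num
  rw [target, r1, r2, hε]
  exact ⟨(hm.shift ha _).shift hb _, by rw [(hm.shift ha _).ell_shift hb, hm.ell_shift ha]⟩

/-- The case `j = l` of the sign is an artefact of the centred columns: counted from the left, it is
the comparison of places for either parity of the row. -/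
theorem toK_S (hν : ν = 0 ∨ ν = 1) (hn : n = 2 * s + ν) :
    toK (S (col (n + 1) a) (col (n + 2) b) ν) = colSign a b := by
  unfold S colSign col
  rcases hν with rfl | rfl
  · rw [show (n + 1) / 2 = s by omega, show (n + 2) / 2 = s + 1 by omega]
    split_ifs <;> first | omega | simp
  · rw [show (n + 1) / 2 = s + 1 by omega, show (n + 2) / 2 = s + 1 by omega]
    split_ifs <;> first | omega | simp

theorem phi_act (m : CPattern M) (P : ℕ) (hn : n = 2 * s + ν) (hν : ν = 0 ∨ ν = 1) :
    phi M P (act M μ ν (s + 1) m) = -∑ a ∈ Finset.range (n + 1), ∑ b ∈ Finset.range (n + 2),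
      phi M P (term M (S (col (n + 1) a) (col (n + 2) b) ν *
        sqrtSeries (radicand m.1 μ ν (s + 1) (col (n + 1) a) (col (n + 2) b)))
        (target m.1 μ ν (s + 1) (col (n + 1) a) (col (n + 2) b))) := by
  rw [act, map_neg, map_sum, Icc_eq_map (r := n + 1) (by unfold col; omega) (by unfold col; omega),
    Icc_eq_map (r := n + 2) (by unfold col; omega) (by unfold col; omega), Finset.sum_map]
  congr 1
  refine Finset.sum_congr rfl fun a _ => ?_
  rw [map_sum, Finset.sum_map]
  rfl

/-- Term by term: the power of `q` and the path coefficient of the `q`-commutator combine with the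
norms to the signed square root in the action. -/
theorem phi_act_raise (hM : ∀ i j : ℤ, i < j → IsNonnegInt (M i - M j)) (m : CPattern M) {P : ℕ}
    (hP : n + 2 < P) (hd : Direction μ ν 0) (hn : n = 2 * s + ν) :
    phi M P (act M μ ν (s + 1) m) = norm P (ell M m.1) •
      qComm (alt qK (n + 1)) (moveOp qK (n + 1) (n + 2) 1) (moveOp qK (n + 2) (n + 3) 1)
        (Finsupp.single (ell M m.1) 1) := by
  classical
  have hν : ν = 0 ∨ ν = 1 := by unfold Direction at hd; omega
  have hm := m.2.isPre hM
  have he := hm.isCPattern_iff.mp m.2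
  rw [phi_act m P hn hν, qComm_moveOp_single generic_qK (by unfold alt; split_ifs <;> simp)
    (isStep_up (n + 1)) (isStep_up (n + 2)), Finset.smul_sum, ← Finset.sum_neg_distrib]
  refine Finset.sum_congr rfl fun a ha => ?_
  rw [Finset.smul_sum, ← Finset.sum_neg_distrib]
  refine Finset.sum_congr rfl fun b hb => ?_
  rw [Finset.mem_range] at ha hb
  obtain ⟨t1, t2⟩ := target_props hm hd hn ha hb
  rw [mul_zero, sub_zero] at t2
  rw [phi_term P t1, t2, Finsupp.smul_single, ← Finsupp.single_neg, smul_eq_mul]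
  congr 1
  by_cases hf : Interlaced (ell M m.1 + (1 : ℤ) • cell (n + 1) a + (1 : ℤ) • cell (n + 2) b)
  · rw [if_pos hf, if_pos ⟨he, hf⟩]
    obtain ⟨-, hr⟩ := radicand_props hm hd hn ha hb he (by simpa using hf)
    rw [neg_zero, zero_smul, zero_smul, add_zero, add_zero] at hr
    obtain ⟨w, hw, hw2⟩ := (isPos_rad he ha hb hf).exists_sqrt
    rw [map_mul, toK_S hν hn, hw.sqrtSeries (hw2.trans hr.symm)]
    have := norm_mul_raise he ha hb hf hP hw hw2
    rw [← neg_mul, ← this, Int.cast_one, one_mul, neg_one_mul]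
  · rw [if_neg hf, if_neg fun h => hf h.2, mul_zero, neg_zero]

theorem phi_act_lower (hM : ∀ i j : ℤ, i < j → IsNonnegInt (M i - M j)) (m : CPattern M) {P : ℕ}
    (hP : n + 2 < P) (hd : Direction μ ν 1) (hn : n = 2 * s + ν) :
    phi M P (act M μ ν (s + 1) m) = norm P (ell M m.1) •
      qComm (alt qK (n + 1))⁻¹ (moveOp qK (n + 2) (n + 1) (-1)) (moveOp qK (n + 1) n (-1))
        (Finsupp.single (ell M m.1) 1) := by
  classical
  have hν : ν = 0 ∨ ν = 1 := by unfold Direction at hd; omega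
  have hm := m.2.isPre hM
  have he := hm.isCPattern_iff.mp m.2
  rw [phi_act m P hn hν, qComm_moveOp_single generic_qK (by unfold alt; split_ifs <;> simp)
    (isStep_down (n + 1)) (isStep_down n), Finset.smul_sum, ← Finset.sum_neg_distrib]
  simp only [Finset.smul_sum, ← Finset.sum_neg_distrib]
  rw [Finset.sum_comm]
  refine Finset.sum_congr rfl fun b hb => Finset.sum_congr rfl fun a ha => ?_
  rw [Finset.mem_range] at ha hb
  obtain ⟨t1, t2⟩ := target_props hm hd hn ha hb
  rw [show (1 : ℤ) - 2 * 1 = -1 by norm_num, add_right_comm] at t2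
  rw [phi_term P t1, t2, Finsupp.smul_single, ← Finsupp.single_neg, smul_eq_mul]
  congr 1
  by_cases hf : Interlaced (ell M m.1 + (-1 : ℤ) • cell (n + 2) b + (-1 : ℤ) • cell (n + 1) a)
  · rw [if_pos hf, if_pos ⟨he, hf⟩]
    obtain ⟨-, hr⟩ := radicand_props hm hd hn ha hb he (by rw [add_right_comm]; simpa using hf)
    rw [add_right_comm] at hr
    -- The computation is done from the lower array `l`, from which the given array is reached by
    -- raising.
    set l := ell M m.1 + (-1 : ℤ) • cell (n + 2) b + (-1 : ℤ) • cell (n + 1) a with hl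
    have hle : l + (1 : ℤ) • cell (n + 1) a + (1 : ℤ) • cell (n + 2) b = ell M m.1 := by
      rw [hl]; simp
    have hf' : Interlaced (l + (1 : ℤ) • cell (n + 1) a + (1 : ℤ) • cell (n + 2) b) := by rwa [hle]
    obtain ⟨w, hw, hw2⟩ := (isPos_rad hf ha hb hf').exists_sqrt
    rw [map_mul, toK_S hν hn, hw.sqrtSeries (hw2.trans hr.symm)]
    have := norm_mul_lower hf ha hb hf' hP hw hw2
    rw [hle] at this
    have ea : l (n + 1) a = ell M m.1 (n + 1) a - 1 := by
      rw [hl, add_cell_apply_self, add_cell_of_ne _ (by omega)]; ring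
    have eb : l (n + 2) b = ell M m.1 (n + 2) b - 1 := by
      rw [hl, add_cell_of_ne _ (by omega), add_cell_apply_self]; ring
    rw [← this, ea, eb, inv_zpow', show -(-(-1) * (ell M m.1 (n + 1) a - ell M m.1 (n + 2) b)) =
      ell M m.1 (n + 2) b - 1 - (ell M m.1 (n + 1) a - 1) by ring]
    push_cast
    ring
  · rw [if_neg hf, if_neg fun h => hf h.2, mul_zero, neg_zero]

theorem norm_mul_raise_one {l : Arr} {P : ℕ} (hl : Interlaced l) (ha : a < n + 1)
    (hf : Interlaced (l + (1 : ℤ) • cell (n + 1) a)) (hP : n + 1 < P)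
    {w : FracK} (hw : IsPos w) (hw2 : w ^ 2 = -(raw qK (n + 1) (n + 2) l a *
      raw qK (n + 1) n (l + (1 : ℤ) • cell (n + 1) a) a)) :
    norm P l * (-raw qK (n + 1) (n + 2) l a * alt qK (n + 1) ^ l (n + 1) a) =
      w * norm P (l + (1 : ℤ) • cell (n + 1) a) ∧
    norm P (l + (1 : ℤ) • cell (n + 1) a) * (raw qK (n + 1) n (l + (1 : ℤ) • cell (n + 1) a) a *
      alt qK (n + 1) ^ (-l (n + 1) a)) = w * norm P l := by
  obtain ⟨h1, h2, h3⟩ := raw_gauge hl ha hf hP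
  have z1 := (isPos_sqrtGauge P l).ne_zero
  have z2 := (isPos_sqrtGauge P (l + (1 : ℤ) • cell (n + 1) a)).ne_zero
  have s1 := sqrtGauge_sq P l
  have s2 := sqrtGauge_sq P (l + (1 : ℤ) • cell (n + 1) a)
  have p1 := isPos_sqrtGauge P l
  have p2 := isPos_sqrtGauge P (l + (1 : ℤ) • cell (n + 1) a)
  rw [norm, norm, qGauge_add_cell l hP ha]
  generalize gauge P (l + (1 : ℤ) • cell (n + 1) a) = G2 at *
  generalize sqrtGauge P (l + (1 : ℤ) • cell (n + 1) a) = r2 at *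
  generalize sqrtGauge P l = r1 at *
  generalize raw qK (n + 1) (n + 2) l a = C at *
  generalize raw qK (n + 1) n _ a = R at *
  have k1 : w = -C * (r2 / r1) := by
    refine hw.eq_of_sq_eq (h1.mul (p2.div p1)) ?_
    rw [hw2]
    field_simp
    rw [s1, s2]
    linear_combination C * h3
  have k2 : w = R * (r1 / r2) := by
    refine hw.eq_of_sq_eq (h2.mul (p1.div p2)) ?_
    rw [hw2]
    field_simp
    rw [s1, s2]
    linear_combination R * h3
  constructor
  · rw [k1]
    field_simp
  · rw [k2, zpow_neg]
    have := zpow_ne_zero (l (n + 1) a) (alt_ne_zero qK_ne_zero (n + 1))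
    field_simp

end Action

section FirstRow

variable {M : ℤ → ℂ[X]} {m : ℤ → ℤ → ℂ[X]} {μ : ℕ} {δ : ℤ}

theorem toK_radicand₀ (hm : IsPre M m) (h : μ = 1 ∧ δ = 0 ∨ μ = 0 ∧ δ = 1) :
    toK (radicand₀ m μ) = -(raw qK 1 2 (ell M m + (-δ) • cell 1 0) 0 *
      raw qK 1 0 (ell M m + (-δ) • cell 1 0 + (1 : ℤ) • cell 1 0) 0) := by
  have e1 := hm.L_eq (r := 2) (a := 0) (by omega)
  have e2 := hm.L_eq (r := 1) (a := 0) (by omega)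
  have e3 := hm.L_eq (r := 2) (a := 1) (by omega)
  simp only [col] at e1 e2 e3
  norm_num at e1 e2 e3
  have hμ : (μ : ℂ[X]) = ((1 - δ : ℤ) : ℂ[X]) := by rcases h with ⟨rfl, rfl⟩ | ⟨rfl, rfl⟩ <;> simp
  have a1 : L m (-1) 2 - L m 0 1 - (μ : ℂ[X]) =
      ((ell M m 2 0 - (ell M m 1 0 - δ) : ℤ) : ℂ[X]) := by
    rw [e1, e2, hμ]; push_cast; ring
  have a2 : L m 0 1 - L m 0 2 + (μ : ℂ[X]) =
      ((-(ell M m 2 1 - (ell M m 1 0 - δ)) : ℤ) : ℂ[X]) := by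
    rw [e2, e3, hμ]; push_cast; ring
  rw [radicand₀, map_mul, a1, a2, toK_br, toK_br, qInt_neg]
  simp only [raw, prodDiff, Finset.prod_range_succ, Finset.range_zero, Finset.prod_empty]
  rw [add_cell_of_ne _ (show (2 : ℕ) ≠ 1 by omega), add_cell_apply_self]
  simp [← sub_eq_add_neg]

theorem target₀_props (hm : IsPre M m) (h : μ = 1 ∧ δ = 0 ∨ μ = 0 ∧ δ = 1) :
    IsPre M (target₀ m μ) ∧ ell M (target₀ m μ) = ell M m + (1 - 2 * δ) • cell 1 0 := by
  have e : target₀ m μ = shift m (col 1 0) (1 : ℕ) (1 - 2 * δ) := by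
    rcases h with ⟨rfl, rfl⟩ | ⟨rfl, rfl⟩ <;> simp [target₀, col]
  rw [e]
  exact ⟨hm.shift (by omega) _, hm.ell_shift (by omega) _⟩

theorem isPos_first {l : Arr} (hl : Interlaced l) (hf : Interlaced (l + (1 : ℤ) • cell 1 0)) :
    IsPos (-(raw qK 1 2 l 0 * raw qK 1 0 (l + (1 : ℤ) • cell 1 0) 0)) := by
  obtain ⟨h1, h2, -⟩ := raw_gauge (n := 0) (P := 2) hl (by omega) hf (by omega)
  rw [← neg_mul]
  exact h1.mul h2

/-- Moving the single entry of the first row changes `qGauge` by a power of `alt qK 1 = q⁻¹` with no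
second row to share it; the twist at the place `0` accounts for this power. -/
theorem phi_act₀_raise (hM : ∀ i j : ℤ, i < j → IsNonnegInt (M i - M j)) (m : CPattern M) {P : ℕ}
    (hP : 1 < P) : phi M P (act₀ M 1 m) = norm P (ell M m.1) •
      gen qK (raiseOp qK) (twistOp qK (-1)) 0 (Finsupp.single (ell M m.1) 1) := by
  classical
  have hm := m.2.isPre hM
  have he := hm.isCPattern_iff.mp m.2
  obtain ⟨t1, t2⟩ := target₀_props (δ := 0) hm (Or.inl ⟨rfl, rfl⟩)
  rw [act₀, phi_term P t1, t2, gen, Module.End.mul_apply, twistOp, diagOp_single, raiseOp,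
    LinearMap.smul_apply, moveOp, rowOp_single, Finset.sum_range_one, Finsupp.smul_single,
    Finsupp.smul_single]
  norm_num only
  congr 1
  by_cases hf : Interlaced (ell M m.1 + (1 : ℤ) • cell 1 0)
  · rw [if_pos hf, coef_of_interlaced _ he hf]
    have hr := toK_radicand₀ (δ := 0) hm (Or.inl ⟨rfl, rfl⟩)
    rw [neg_zero, zero_smul, add_zero] at hr
    obtain ⟨w, hw, hw2⟩ := (isPos_first he hf).exists_sqrt
    rw [hw.sqrtSeries (hw2.trans hr.symm)]
    have := (norm_mul_raise_one (n := 0) he (by omega) hf hP hw hw2).1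
    rw [← this, IsSystem.alt_one, inv_zpow', smul_eq_mul, smul_eq_mul]
    simp only [neg_mul, one_mul]
    ring
  · rw [if_neg hf, coef_of_not_right _ hf]
    simp

theorem phi_act₀_lower (hM : ∀ i j : ℤ, i < j → IsNonnegInt (M i - M j)) (m : CPattern M) {P : ℕ}
    (hP : 1 < P) : phi M P (act₀ M 0 m) = norm P (ell M m.1) •
      ((alt qK 0)⁻¹ • gen qK (lowerOp qK) (twistOp qK 1) 0) (Finsupp.single (ell M m.1) 1) := by
  classical
  have hm := m.2.isPre hM
  have he := hm.isCPattern_iff.mp m.2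
  obtain ⟨t1, t2⟩ := target₀_props (δ := 1) hm (Or.inr ⟨rfl, rfl⟩)
  rw [act₀, phi_term P t1, t2, gen, LinearMap.smul_apply, Module.End.mul_apply, twistOp,
    diagOp_single, lowerOp, moveOp, rowOp_single, Finset.sum_range_one, Finsupp.smul_single,
    Finsupp.smul_single]
  norm_num only
  congr 1
  by_cases hf : Interlaced (ell M m.1 + (-1 : ℤ) • cell 1 0)
  · rw [if_pos hf, coef_of_interlaced _ he hf]
    have hr := toK_radicand₀ (δ := 1) hm (Or.inr ⟨rfl, rfl⟩)
    set l := ell M m.1 + (-1 : ℤ) • cell 1 0 with hl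
    have hle : l + (1 : ℤ) • cell 1 0 = ell M m.1 := by rw [hl]; simp
    have hf' : Interlaced (l + (1 : ℤ) • cell 1 0) := by rwa [hle]
    obtain ⟨w, hw, hw2⟩ := (isPos_first hf hf').exists_sqrt
    rw [hw.sqrtSeries (hw2.trans hr.symm)]
    have := (norm_mul_raise_one (n := 0) hf (by omega) hf' hP hw hw2).2
    rw [hle, zero_add] at this
    have ea : l 1 0 = ell M m.1 1 0 - 1 := by rw [hl, add_cell_apply_self]; ring
    -- The normalization involves the entry after lowering and the twist the entry before it; the
    -- resulting extra factor `q⁻¹` is the scale `(alt qK 0)⁻¹`.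
    rw [← this, IsSystem.alt_one, inv_zpow', neg_neg, ea, zpow_sub_one₀ qK_ne_zero, smul_eq_mul, smul_eq_mul,
      show alt qK 0 = qK from if_pos (by decide), one_mul, one_mul]
    ring
  · rw [if_neg hf, coef_of_not_right _ hf]
    simp

theorem phi_act_gen_raise {ν s p : ℕ} (hM : ∀ i j : ℤ, i < j → IsNonnegInt (M i - M j))
    (m : CPattern M) {P : ℕ} (hP : p + 1 < P) (hd : Direction μ ν 0) (hp : p = 2 * s + ν + 1) :
    phi M P (act M μ ν (s + 1) m) = norm P (ell M m.1) •
      gen qK (raiseOp qK) (twistOp qK (-1)) p (Finsupp.single (ell M m.1) 1) := by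
  subst hp
  rw [phi_act_raise hM m hP hd rfl, gen, raiseOp, raiseOp]
  simp only [qComm, smul_mul_smul_comm, neg_mul_neg, one_mul, one_smul]

/-- The lowering action produces the `q`-commutator in reversed order with inverse parameter;
turning it into `gen` gives the scale `-(alt qK p)⁻¹`. -/
theorem phi_act_gen_lower {ν s p : ℕ} (hM : ∀ i j : ℤ, i < j → IsNonnegInt (M i - M j))
    (m : CPattern M) {P : ℕ} (hP : p + 1 < P) (hd : Direction μ ν 1) (hp : p = 2 * s + ν + 1) :
    phi M P (act M μ ν (s + 1) m) = norm P (ell M m.1) •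
      ((-(alt qK p)⁻¹) • gen qK (lowerOp qK) (twistOp qK 1) p) (Finsupp.single (ell M m.1) 1) := by
  subst hp
  have h0 := alt_ne_zero qK_ne_zero (2 * s + ν + 1)
  rw [phi_act_lower hM m hP hd rfl, gen, lowerOp, lowerOp, qComm_flip h0, smul_smul, neg_mul_neg,
    inv_mul_cancel₀ h0, one_smul]

theorem coefficientsWellDefined (hM : ∀ i j : ℤ, i < j → IsNonnegInt (M i - M j)) :
    CoefficientsWellDefined M := by
  intro m μ hμ
  have hm := m.2.isPre hM
  have he := hm.isCPattern_iff.mp m.2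
  refine ⟨fun ht => ?_, fun ν hν i hi j hj l hl ht => ?_⟩
  · obtain ⟨δ, hδ⟩ : ∃ δ : ℤ, μ = 1 ∧ δ = 0 ∨ μ = 0 ∧ δ = 1 := by
      rcases hμ with rfl | rfl
      · exact ⟨1, Or.inr ⟨rfl, rfl⟩⟩
      · exact ⟨0, Or.inl ⟨rfl, rfl⟩⟩
    obtain ⟨t1, t2⟩ := target₀_props hm hδ
    have hf := t1.isCPattern_iff.mp ht
    rw [t2] at hf
    refine exists_isPosSqrt (IsPos.hasPosConst ?_)
    rw [toK_radicand₀ hm hδ]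
    rcases hδ with ⟨-, rfl⟩ | ⟨-, rfl⟩
    · exact isPos_first (by simpa using he) (by simpa using hf)
    · exact isPos_first hf (by simpa using he)
  · obtain ⟨δ, hδ⟩ : ∃ δ : ℤ, Direction μ ν δ := by
      unfold Direction
      rcases hμ with rfl | rfl <;> rcases hν with rfl | rfl
      · exact ⟨1, by simp⟩
      · exact ⟨0, by simp⟩
      · exact ⟨0, by simp⟩
      · exact ⟨1, by simp⟩
    obtain ⟨s, rfl⟩ : ∃ s : ℕ, i = s + 1 := ⟨(i - 1).toNat, by omega⟩
    have hν' : ν = 0 ∨ ν = 1 := hν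
    obtain ⟨n, hn⟩ : ∃ n, n = 2 * s + ν := ⟨_, rfl⟩
    rw [Icc_eq_map (r := n + 1) (by unfold col; omega) (by unfold col; omega), Finset.mem_map] at hj
    rw [Icc_eq_map (r := n + 2) (by unfold col; omega) (by unfold col; omega), Finset.mem_map] at hl
    obtain ⟨a, ha, rfl⟩ := hj
    obtain ⟨b, hb, rfl⟩ := hl
    rw [Finset.mem_range] at ha hb
    obtain ⟨t1, t2⟩ := target_props hm hδ hn ha hb
    have hf := t1.isCPattern_iff.mp ht
    rw [t2] at hf
    obtain ⟨u1, u2⟩ := radicand_props hm hδ hn ha hb he hf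
    refine ⟨u1, exists_isPosSqrt (IsPos.hasPosConst ?_)⟩
    change IsPos (toK (radicand m.1 μ ν (s + 1) (col (n + 1) a) (col (n + 2) b)))
    rw [u2]
    have hδ' : δ = 0 ∨ δ = 1 := by unfold Direction at hδ; omega
    rcases hδ' with rfl | rfl
    · exact isPos_rad (by simpa using he) ha hb (by simpa using hf)
    · refine isPos_rad (by simpa using hf) ha hb ?_
      rw [add_right_comm _ ((-1 : ℤ) • cell (n + 2) b), add_assoc _ _ ((1 : ℤ) • cell (n + 1) a),
        add_assoc _ _ ((1 : ℤ) • cell (n + 2) b)]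
      simpa using he

end FirstRow

/-! ### Relations between directed generators of the chain -/

section Directed

instance : CharZero FracK :=
  haveI : CharZero ℂ⟦X⟧ := charZero_of_injective_ringHom (PowerSeries.C_injective (R := ℂ))
  charZero_of_injective_ringHom toK_injective

/-- The raising (`σ = true`) and lowering generators of the chain of rows. -/
noncomputable def chainGen (σ : Bool) (p : ℕ) : Module.End FracK (Arr →₀ FracK) :=
  if σ then gen qK (raiseOp qK) (twistOp qK (-1)) p else gen qK (lowerOp qK) (twistOp qK 1) p

/-- The three hypotheses exclude the cases of non-commutation: same direction at distance two,
opposite directions at the same place, and opposite directions at the places `0` and `1`. -/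
theorem commute_chainGen {σ τ : Bool} {p r : ℕ}
    (h1 : σ = τ → p % 2 = r % 2 → r ≠ p + 2 ∧ p ≠ r + 2)
    (h2 : σ ≠ τ → p % 2 = r % 2 → p ≠ r) (h3 : σ ≠ τ → p % 2 ≠ r % 2 → 1 < p ∨ 1 < r) :
    Commute (chainGen σ p) (chainGen τ r) := by
  have S := isSystem generic_qK
  by_cases hp : p % 2 = r % 2
  · cases σ <;> cases τ
    · exact S.swap.commute_gen_gen_same hp (h1 rfl hp).1 (h1 rfl hp).2
    · exact S.swap.commute_gen_gen'_same hp (h2 (by decide) hp)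
    · exact S.commute_gen_gen'_same hp (h2 (by decide) hp)
    · exact S.commute_gen_gen_same hp (h1 rfl hp).1 (h1 rfl hp).2
  · cases σ <;> cases τ
    · exact S.swap.commute_gen_gen hp
    · exact S.swap.commute_gen_gen' hp (h3 (by decide) hp)
    · exact S.commute_gen_gen' hp (h3 (by decide) hp)
    · exact S.commute_gen_gen hp

theorem serrePoly_chainGen {σ τ : Bool} {p r : ℕ}
    (h : σ = τ ∧ (r = p + 2 ∨ p = r + 2) ∨ σ ≠ τ ∧ (p = 0 ∧ r = 1 ∨ p = 1 ∧ r = 0)) :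
    serrePoly (qK + qK⁻¹) (chainGen σ p) (chainGen τ r) = 0 := by
  have S := isSystem generic_qK
  rcases h with ⟨rfl, rfl | rfl⟩ | ⟨h, ⟨rfl, rfl⟩ | ⟨rfl, rfl⟩⟩
  · cases σ
    · exact S.swap.serrePoly_gen_gen_add_two p
    · exact S.serrePoly_gen_gen_add_two p
  · cases σ
    · exact S.swap.serrePoly_gen_add_two_gen r
    · exact S.serrePoly_gen_add_two_gen r
  · cases σ <;> cases τ
    · exact absurd rfl h
    · exact S.swap.serrePoly_gen_zero_gen_one
    · exact S.serrePoly_gen_zero_gen_one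
    · exact absurd rfl h
  · cases σ <;> cases τ
    · exact absurd rfl h
    · exact S.swap.serrePoly_gen_one_gen_zero
    · exact S.serrePoly_gen_one_gen_zero
    · exact absurd rfl h

/-- The normalization of the raising (`σ = true`) and lowering generators. -/
noncomputable def chainScale (σ : Bool) (p : ℕ) : FracK :=
  if σ then 1 else if p = 0 then (alt qK p)⁻¹ else -(alt qK p)⁻¹

/-- The Cartan weight of the commutator of a raising with a lowering generator. -/
def chainWeight : ℕ → Arr → ℤ
  | 0, l => cartan 0 l
  | p + 1, l => cartan p l + cartan (p + 1) l

theorem chainGen_commutator_single (p : ℕ) {l : Arr} (hl : Interlaced l) :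
    (chainGen true p * (chainScale false p • chainGen false p) -
      (chainScale false p • chainGen false p) * chainGen true p) (Finsupp.single l 1) =
      Finsupp.single l (qInt qK (chainWeight p l)) := by
  have S := isSystem generic_qK
  have h0 := qK_ne_zero
  have h1 := qK_sub_inv_ne_zero
  refine smul_right_injective _ h1 ?_
  change (qK - qK⁻¹) • _ = (qK - qK⁻¹) • _
  rw [← LinearMap.smul_apply, Finsupp.smul_single, qInt, smul_eq_mul, mul_div_cancel₀ _ h1]
  cases p with
  | zero =>
    have := congrArg (fun U => U (Finsupp.single l 1)) S.gen_zero_mul_sub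
    refine this.trans ?_
    simp only [LinearMap.sub_apply, cartanOp, diagOp_single, if_pos hl, one_mul, chainWeight]
    rw [← Finsupp.single_sub, neg_one_mul]
  | succ p =>
    have := congrArg (fun U => -(U (Finsupp.single l 1))) (S.gen_succ_mul_sub p)
    simp only [LinearMap.neg_apply, LinearMap.sub_apply, Module.End.mul_apply, cartanOp,
      diagOp_single, if_pos hl, one_mul, chainWeight, LinearMap.smul_apply, map_smul] at this ⊢
    simp only [chainScale, chainGen, if_true, if_neg (Nat.succ_ne_zero p), Bool.false_eq_true,
      if_false, neg_smul]
    rw [← smul_neg, neg_sub, ← Finsupp.single_sub, ← zpow_add₀ h0, ← zpow_add₀ h0] at this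
    rw [neg_sub_neg, this, neg_neg, add_comm (cartan p l), neg_one_mul, neg_one_mul, ← neg_add]

end Directed

/-! ### The two-sided generators on finite combinations of patterns -/

section Base

variable {M : ℤ → ℂ[X]} {μ : ℕ} {n : ℤ}

/-- The generators on the module of finite combinations of patterns. -/
noncomputable def baseGen (M : ℤ → ℂ[X]) (μ : ℕ) (n : ℤ) : Module.End ℂ⟦X⟧ (VHat M) :=
  Finsupp.linearCombination ℂ⟦X⟧ (if n = -1 then act₀ M (1 - μ)
    else if 0 ≤ n then act M μ 0 (n + 1) else act M μ 1 (-n - 1))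

/-- The place in the chain of rows of the generators with index `n`. -/
def chainIndex (n : ℤ) : ℕ := if 0 ≤ n then (2 * n + 1).toNat else (-2 * n - 2).toNat

/-- Whether a generator raises or lowers. -/
def isRaising (μ : ℕ) (n : ℤ) : Bool := decide (μ = 1 ↔ 0 ≤ n)

/-- The folding of the diagram: indices `n ≥ 0` occupy the odd places with `e` raising, indices `n <
0` the even places with `e` lowering. -/
theorem corresponds_baseGen (hM : ∀ i j : ℤ, i < j → IsNonnegInt (M i - M j))
    (hμ : μ = 0 ∨ μ = 1) (n : ℤ) : Corresponds (baseGen M μ n)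
      (chainScale (isRaising μ n) (chainIndex n) • chainGen (isRaising μ n) (chainIndex n)) := by
  refine Corresponds.of_basis (P₀ := chainIndex n + 2) fun P hP m => ?_
  rw [baseGen, Finsupp.linearCombination_single, one_smul]
  have raise : isRaising μ n = true → ∀ v, (phi M P v = norm P (ell M m.1) •
      gen qK (raiseOp qK) (twistOp qK (-1)) (chainIndex n) (Finsupp.single (ell M m.1) 1)) →
      phi M P v = norm P (ell M m.1) • (chainScale (isRaising μ n) (chainIndex n) •
        chainGen (isRaising μ n) (chainIndex n)) (Finsupp.single (ell M m.1) 1) := by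
    intro h v hv
    rw [h, hv, chainScale, chainGen, if_pos rfl, if_pos rfl, one_smul]
  have lower : isRaising μ n = false → ∀ v, (phi M P v = norm P (ell M m.1) •
      ((if chainIndex n = 0 then (alt qK (chainIndex n))⁻¹ else -(alt qK (chainIndex n))⁻¹) •
      gen qK (lowerOp qK) (twistOp qK 1) (chainIndex n)) (Finsupp.single (ell M m.1) 1)) →
      phi M P v = norm P (ell M m.1) • (chainScale (isRaising μ n) (chainIndex n) •
        chainGen (isRaising μ n) (chainIndex n)) (Finsupp.single (ell M m.1) 1) := by
    intro h v hv
    rw [h, hv, chainScale, chainGen, if_neg Bool.false_ne_true, if_neg Bool.false_ne_true]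
  by_cases h1 : n = -1
  · subst h1
    rcases hμ with rfl | rfl
    · exact raise (by decide) _ (phi_act₀_raise hM m (by omega))
    · exact lower (by decide) _ (phi_act₀_lower hM m (by omega))
  rw [if_neg h1]
  have hc : chainIndex n ≠ 0 := by unfold chainIndex; split_ifs <;> omega
  rw [if_neg hc] at lower
  by_cases h2 : 0 ≤ n
  · rw [if_pos h2]
    obtain ⟨s, rfl⟩ := Int.eq_ofNat_of_zero_le h2
    have hi : chainIndex s = 2 * s + 0 + 1 := by unfold chainIndex; split_ifs; omega
    rcases hμ with rfl | rfl
    · exact lower (by simp [isRaising]) _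
        (phi_act_gen_lower hM m (by omega) (by simp [Direction]) hi)
    · exact raise (by simp [isRaising]) _
        (phi_act_gen_raise hM m (by omega) (by simp [Direction]) hi)
  · rw [if_neg h2]
    obtain ⟨s, hs⟩ : ∃ s : ℕ, -n - 1 = s + 1 := ⟨(-n - 2).toNat, by omega⟩
    have hi : chainIndex n = 2 * s + 1 + 1 := by unfold chainIndex; split_ifs; omega
    rw [hs]
    rcases hμ with rfl | rfl
    · exact raise (by simp [isRaising]; omega) _
        (phi_act_gen_raise hM m (by omega) (by simp [Direction]) hi)
    · exact lower (by simp [isRaising]; omega) _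
        (phi_act_gen_lower hM m (by omega) (by simp [Direction]) hi)

theorem commute_baseGen_of (hM : ∀ i j : ℤ, i < j → IsNonnegInt (M i - M j)) {μ' : ℕ}
    (hμ : μ = 0 ∨ μ = 1) (hμ' : μ' = 0 ∨ μ' = 1) {n n' : ℤ}
    (h : Commute (chainGen (isRaising μ n) (chainIndex n))
      (chainGen (isRaising μ' n') (chainIndex n'))) :
    Commute (baseGen M μ n) (baseGen M μ' n') := by
  have c1 := corresponds_baseGen hM hμ n
  have c2 := corresponds_baseGen hM hμ' n'
  refine Corresponds.eq_of_eq hM (c1.mul c2) (c2.mul c1) ?_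
  exact ((h.smul_left _).smul_right _).eq

/-- Under the folding, indices at distance one become either the places `0` and `1` with opposite
directions, or places of equal parity at distance two with equal directions. -/
theorem commute_baseGen (hM : ∀ i j : ℤ, i < j → IsNonnegInt (M i - M j)) (hμ : μ = 0 ∨ μ = 1)
    {i j : ℤ} (hij : |i - j| ≠ 1) : Commute (baseGen M μ i) (baseGen M μ j) := by
  have h1 : i - j ≠ 1 := fun h => hij (by rw [h]; rfl)
  have h2 : i - j ≠ -1 := fun h => hij (by rw [h]; rfl)
  refine commute_baseGen_of hM hμ hμ (commute_chainGen ?_ ?_ ?_) <;>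
    simp only [isRaising, chainIndex, ne_eq, decide_eq_decide] <;> split_ifs <;> omega

theorem commute_baseGen' (hM : ∀ i j : ℤ, i < j → IsNonnegInt (M i - M j)) {i j : ℤ}
    (hij : i ≠ j) : Commute (baseGen M 1 i) (baseGen M 0 j) := by
  refine commute_baseGen_of hM (Or.inr rfl) (Or.inl rfl) (commute_chainGen ?_ ?_ ?_) <;>
    simp only [isRaising, chainIndex, ne_eq, decide_eq_decide, true_iff, zero_ne_one, false_iff] <;>
    split_ifs <;> omega

theorem serrePoly_baseGen_of (hM : ∀ i j : ℤ, i < j → IsNonnegInt (M i - M j))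
    (hμ : μ = 0 ∨ μ = 1) {i j : ℤ} (hij : j = i + 1 ∨ i = j + 1) :
    baseGen M μ i ^ 2 * baseGen M μ j - (qPow 1 + qPow (-1)) •
      (baseGen M μ i * baseGen M μ j * baseGen M μ i) + baseGen M μ j * baseGen M μ i ^ 2 = 0 := by
  have c1 := corresponds_baseGen hM hμ i
  have c2 := corresponds_baseGen hM hμ j
  simp only [pow_two]
  have c3 := ((((c1.mul c1).mul c2).sub (((c1.mul c2).mul c1).smul (qPow 1 + qPow (-1)))).add
    (c2.mul (c1.mul c1)))
  rw [← pow_two, ← pow_two, map_add, qK_inv] at c3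
  have c0 : Corresponds (M := M) 0 0 := ⟨0, fun P _ v => by simp⟩
  refine Corresponds.eq_of_eq hM c3 c0 ?_
  refine (serrePoly_smul_smul (qK + qK⁻¹) _ _ (chainGen (isRaising μ i) (chainIndex i))
    (chainGen (isRaising μ j) (chainIndex j))).trans ?_
  rw [serrePoly_chainGen, smul_zero]
  simp only [isRaising, chainIndex, ne_eq, decide_eq_decide]
  split_ifs <;> omega

end Base

/-! ### Weights and the Cartan relations -/

section Weights

variable {M : ℤ → ℂ[X]} {m : ℤ → ℤ → ℂ[X]} {μ : ℕ} {n : ℤ}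

/-- The sum of the entries of a row. -/
noncomputable def rowSum (m : ℤ → ℤ → ℂ[X]) (r : ℕ) : ℂ[X] := ∑ a ∈ Finset.range r, m (col r a) r

theorem rowSum_shift (m : ℤ → ℤ → ℂ[X]) (r : ℕ) {s a : ℕ} (ha : a < s) (d : ℤ) :
    rowSum (shift m (col s a) s d) r = rowSum m r + ((if r = s then d else 0 : ℤ) : ℂ[X]) := by
  unfold rowSum shift
  split_ifs with h
  · subst h
    rw [← Finset.add_sum_erase _ _ (Finset.mem_range.mpr ha),
      ← Finset.add_sum_erase (a := a) _ (fun a => m (col r a) r) (Finset.mem_range.mpr ha),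
      if_pos ⟨rfl, rfl⟩, Finset.sum_congr rfl fun b hb => if_neg (c := col r b = col r a ∧ _) ?_]
    · ring
    · rintro ⟨h, -⟩
      simp only [col] at h
      exact (Finset.mem_erase.mp hb).1 (by omega)
  · rw [Int.cast_zero, add_zero]
    refine Finset.sum_congr rfl fun b _ => if_neg ?_
    rintro ⟨-, h'⟩
    exact h (by exact_mod_cast h')

theorem IsPre.rowSum_eq (h : IsPre M m) (r : ℕ) : rowSum m r =
    r * M 0 + ((∑ a ∈ Finset.range r, ell M m r a + ∑ a ∈ Finset.range r, (a : ℤ) : ℤ) : ℂ[X]) := by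
  rw [rowSum, Finset.sum_congr rfl fun a ha => h.eq (Finset.mem_range.mp ha),
    ← Finset.sum_add_distrib, Finset.sum_add_distrib, Finset.sum_const, Finset.card_range,
    nsmul_eq_mul, Int.cast_sum]

/-- The upper one of the two rows that enter the weight with index `i`. -/
def weightRow (i : ℤ) : ℕ := if 0 ≤ i then (2 * i + 1).toNat else (-2 * i).toNat

theorem weight_eq (ξ₀ ξ₁ : ℂ[X]) (m : ℤ → ℤ → ℂ[X]) (i : ℤ) : weight ξ₀ ξ₁ m i =
    rowSum m (weightRow i) - rowSum m (weightRow i - 1) + (ξ₁ - ξ₀) * (theta (-i) : ℂ[X]) - ξ₁ := by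
  have e1 : 2 * |i| + theta i = weightRow i := by
    unfold weightRow theta
    split_ifs with h
    · rw [abs_of_nonneg h]; omega
    · rw [abs_of_neg (by omega)]; omega
  have e2 : (weightRow i : ℤ) - 1 = (weightRow i - 1 : ℕ) := by
    unfold weightRow
    split_ifs <;> omega
  have e3 : |i| = (weightRow i / 2 : ℕ) ∧ theta i = (weightRow i % 2 : ℕ) := by
    unfold weightRow theta
    split_ifs with h
    · rw [abs_of_nonneg h]; omega
    · rw [abs_of_neg (by omega)]; omega
  have h1 : 1 ≤ weightRow i := by unfold weightRow; split_ifs <;> omega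
  rw [weight, e1, e2, e3.1, e3.2]
  generalize weightRow i = r at *
  rw [Icc_eq_map (r := r) (by unfold col; omega) (by unfold col; omega),
    Icc_eq_map (r := r - 1) (by unfold col; omega) (by unfold col; omega), Finset.sum_map,
    Finset.sum_map]
  rfl

/-- The weight of the generators `e_n` (`μ = 1`) and `f_n` (`μ = 0`). -/
def genWeight (μ : ℕ) (i n : ℤ) : ℤ :=
  (2 * μ - 1) * ((if i = n then 1 else 0) - (if i = n + 1 then 1 else 0))

/-- A weight is a difference of consecutive row sums, up to a constant, and a generator changes two
consecutive row sums by the same sign. The condition `r ≠ 0` accounts for the place `0`, where only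
the first row moves. -/
theorem weight_of_rowSum {m' : ℤ → ℤ → ℂ[X]} (hμ : μ = 0 ∨ μ = 1) (ξ₀ ξ₁ : ℂ[X])
    (h : ∀ r, rowSum m' r = rowSum m r +
      ((if r ≠ 0 ∧ (r = chainIndex n ∨ r = chainIndex n + 1) then
        (if isRaising μ n then 1 else -1) else 0 : ℤ) : ℂ[X])) (i : ℤ) :
    weight ξ₀ ξ₁ m' i = weight ξ₀ ξ₁ m i + (genWeight μ i n : ℂ[X]) := by
  have key : genWeight μ i n =
      (if weightRow i ≠ 0 ∧ (weightRow i = chainIndex n ∨ weightRow i = chainIndex n + 1) then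
        (if isRaising μ n then 1 else -1) else 0 : ℤ) -
      (if weightRow i - 1 ≠ 0 ∧ (weightRow i - 1 = chainIndex n ∨
        weightRow i - 1 = chainIndex n + 1) then (if isRaising μ n then 1 else -1) else 0 : ℤ) := by
    unfold genWeight weightRow chainIndex isRaising
    rcases hμ with rfl | rfl <;> simp only [zero_ne_one, false_iff, true_iff, decide_eq_true_eq] <;>
      push_cast <;> split_ifs <;> omega
  rw [weight_eq, weight_eq, h, h, key]
  push_cast
  ring

/-- The diagonal endomorphism with eigenvalues `w`. -/
noncomputable def baseDiag (w : CPattern M → ℂ⟦X⟧) : Module.End ℂ⟦X⟧ (VHat M) :=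
  Finsupp.linearCombination ℂ⟦X⟧ fun m => Finsupp.single m (w m)

theorem baseDiag_single (w : CPattern M → ℂ⟦X⟧) (m : CPattern M) (c : ℂ⟦X⟧) :
    baseDiag w (Finsupp.single m c) = Finsupp.single m (c * w m) := by
  simp [baseDiag]

theorem vHat_ext {T T' : Module.End ℂ⟦X⟧ (VHat M)}
    (h : ∀ m, T (Finsupp.single m 1) = T' (Finsupp.single m 1)) : T = T' :=
  Finsupp.lhom_ext' fun m => LinearMap.ext_ring (h m)

theorem baseDiag_mul (w w' : CPattern M → ℂ⟦X⟧) : baseDiag w * baseDiag w' =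
    baseDiag fun m => w m * w' m :=
  vHat_ext fun m => by
    simp only [Module.End.mul_apply, baseDiag_single, one_mul]
    rw [mul_comm]

theorem baseDiag_term {w : CPattern M → ℂ⟦X⟧} {x : ℂ⟦X⟧} (a : ℂ⟦X⟧)
    (h : ∀ hm : IsCPattern M m, w ⟨m, hm⟩ = x) : baseDiag w (term M a m) = x • term M a m := by
  unfold term
  split_ifs with hm
  · refine (baseDiag_single w ⟨m, hm⟩ a).trans ?_
    rw [h hm, mul_comm]
    exact (Finsupp.smul_single x _ a).symm
  · simp

/-- All terms of the action change the row sums in the same way, so a diagonal operator that depends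
on these changes alone acts on the image by one scalar. -/
theorem baseDiag_act {w : CPattern M → ℂ⟦X⟧} (hμ : μ = 0 ∨ μ = 1) (n : ℤ) (m : CPattern M)
    {x : ℂ⟦X⟧} (h : ∀ m' : CPattern M, (∀ r, rowSum m'.1 r = rowSum m.1 r +
      ((if r ≠ 0 ∧ (r = chainIndex n ∨ r = chainIndex n + 1) then
        (if isRaising μ n then 1 else -1) else 0 : ℤ) : ℂ[X])) → w m' = x) :
    baseDiag w (baseGen M μ n (Finsupp.single m 1)) = x • baseGen M μ n (Finsupp.single m 1) := by
  rw [baseGen, Finsupp.linearCombination_single, one_smul]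
  have hact : ∀ (ν s : ℕ), ν = 0 ∨ ν = 1 → chainIndex n = 2 * s + ν + 1 →
      -(-1 : ℤ) ^ (μ + ν) = (if isRaising μ n then 1 else -1) →
      baseDiag w (act M μ ν (s + 1) m) = x • act M μ ν (s + 1) m := by
    intro ν s hν hi hε
    rw [act, map_neg, smul_neg, map_sum, Finset.smul_sum]
    congr 1
    refine Finset.sum_congr rfl fun j hj => ?_
    rw [map_sum, Finset.smul_sum]
    refine Finset.sum_congr rfl fun l hl => ?_
    rw [Icc_eq_map (r := 2 * s + ν + 1) (by unfold col; omega) (by unfold col; omega),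
      Finset.mem_map] at hj
    rw [Icc_eq_map (r := 2 * s + ν + 2) (by unfold col; omega) (by unfold col; omega),
      Finset.mem_map] at hl
    obtain ⟨a, ha, rfl⟩ := hj
    obtain ⟨b, hb, rfl⟩ := hl
    rw [Finset.mem_range] at ha hb
    refine baseDiag_term _ fun hm => h _ fun r => ?_
    change rowSum (target m.1 μ ν (s + 1) (col (2 * s + ν + 1) a) (col (2 * s + ν + 2) b)) r = _
    rw [target, hε, show 2 * ((s : ℤ) + 1) - 1 + ν = ((2 * s + ν + 1 : ℕ) : ℤ) by omega,
      show 2 * ((s : ℤ) + 1) + ν = ((2 * s + ν + 2 : ℕ) : ℤ) by omega, rowSum_shift _ _ hb,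
      rowSum_shift _ _ ha, hi, add_assoc, ← Int.cast_add]
    congr 2
    split_ifs <;> omega
  by_cases h1 : n = -1
  · subst h1
    rw [if_pos rfl, act₀]
    refine baseDiag_term _ fun hm => h _ fun r => ?_
    change rowSum (target₀ m.1 (1 - μ)) r = _
    have e : target₀ m.1 (1 - μ) =
        shift m.1 (col 1 0) (1 : ℕ) (if isRaising μ (-1) then 1 else -1) := by
      rcases hμ with rfl | rfl <;> simp [target₀, col, isRaising]
    rw [e, rowSum_shift _ _ (by omega), show chainIndex (-1) = 0 by decide]
    congr 2
    split_ifs <;> omega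
  rw [if_neg h1]
  by_cases h2 : 0 ≤ n
  · rw [if_pos h2]
    obtain ⟨s, rfl⟩ := Int.eq_ofNat_of_zero_le h2
    refine hact 0 s (Or.inl rfl) (by unfold chainIndex; split_ifs; omega) ?_
    rcases hμ with rfl | rfl <;> simp [isRaising]
  · rw [if_neg h2]
    obtain ⟨s, hs⟩ : ∃ s : ℕ, -n - 1 = s + 1 := ⟨(-n - 2).toNat, by omega⟩
    rw [hs]
    refine hact 1 s (Or.inr rfl) (by unfold chainIndex; split_ifs; omega) ?_
    rcases hμ with rfl | rfl <;> simp [isRaising, h2]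

theorem baseDiag_mul_baseGen {w : CPattern M → ℂ⟦X⟧} {d : ℤ} (hμ : μ = 0 ∨ μ = 1) (n : ℤ)
    (h : ∀ m m' : CPattern M, (∀ r, rowSum m'.1 r = rowSum m.1 r +
      ((if r ≠ 0 ∧ (r = chainIndex n ∨ r = chainIndex n + 1) then
        (if isRaising μ n then 1 else -1) else 0 : ℤ) : ℂ[X])) → w m' = w m + d) :
    baseDiag w * baseGen M μ n - baseGen M μ n * baseDiag w = d • baseGen M μ n := by
  refine vHat_ext fun m => ?_
  rw [LinearMap.sub_apply, Module.End.mul_apply, Module.End.mul_apply, baseDiag_single, one_mul,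
    baseDiag_act hμ n m (h m), LinearMap.smul_apply, ← Int.cast_smul_eq_zsmul ℂ⟦X⟧ d, sub_eq_iff_eq_add,
    add_smul, add_comm, add_right_inj, ← map_smul, Finsupp.smul_single, smul_eq_mul, mul_one]

/-- The two consecutive Cartan exponents of a composite telescope to four row sums, those of the two
weights. Multiples of `M 0` cancel, the triangular sums cancel the constants in `cartan`, and the
central term cancels the jump of `theta`. -/
theorem weight_commutator (hm : IsPre M m) (ξ₀ ξ₁ : ℂ[X]) (n : ℤ) :
    weight ξ₀ ξ₁ m n - weight ξ₀ ξ₁ m (n + 1) +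
      ((theta (-n) - theta (-n - 1) : ℤ) : ℂ[X]) * (ξ₀ - ξ₁) =
      (((if 0 ≤ n then 1 else -1) * chainWeight (chainIndex n) (ell M m) : ℤ) : ℂ[X]) := by
  have T : ∀ r : ℕ, ∑ a ∈ Finset.range (r + 1), (a : ℤ) = ∑ a ∈ Finset.range r, (a : ℤ) + r :=
    fun r => Finset.sum_range_succ _ _
  rw [weight_eq, weight_eq]
  by_cases h1 : n = -1
  · subst h1
    rw [show chainIndex (-1) = 0 by decide, show weightRow (-1) = 2 by decide,
      show weightRow (-1 + 1) = 1 by decide, show theta (- -1) = 1 by decide,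
      show theta (-(-1 + 1)) = 1 by decide, show theta (- -1 - 1) = 1 by decide]
    simp only [hm.rowSum_eq, chainWeight, cartan, Finset.sum_range_succ, Finset.sum_range_zero]
    push_cast
    norm_num
    ring
  · have e1 : theta (-n) - theta (-n - 1) = theta (-n) - theta (-(n + 1)) := by
      rw [neg_add']
    rw [e1]
    by_cases h2 : 0 ≤ n
    · obtain ⟨s, rfl⟩ := Int.eq_ofNat_of_zero_le h2
      rw [show chainIndex s = 2 * s + 1 by unfold chainIndex; split_ifs; omega,
        show weightRow s = 2 * s + 1 by unfold weightRow; split_ifs; omega,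
        show weightRow (s + 1) = 2 * s + 3 by unfold weightRow; split_ifs <;> omega, if_pos h2]
      simp only [hm.rowSum_eq, chainWeight, cartan, Nat.add_sub_cancel,
        show 2 * s + 3 - 1 = 2 * s + 2 by omega, T]
      push_cast
      ring
    · obtain ⟨s, rfl⟩ : ∃ s : ℕ, n = -s - 2 := ⟨(-n - 2).toNat, by omega⟩
      rw [show chainIndex (-s - 2) = 2 * s + 1 + 1 by unfold chainIndex; split_ifs; omega,
        show weightRow (-s - 2) = 2 * s + 4 by unfold weightRow; split_ifs; omega,
        show weightRow (-s - 2 + 1) = 2 * s + 2 by unfold weightRow; split_ifs <;> omega, if_neg h2]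
      simp only [hm.rowSum_eq, chainWeight, cartan, show 2 * s + 2 - 1 = 2 * s + 1 by omega,
        show 2 * s + 4 - 1 = 2 * s + 3 by omega, T]
      push_cast
      ring

/-- For `n < 0` the roles of `e` and `f` are exchanged; the sign of the commutator is then absorbed
by the oddness of the bracket. -/
theorem baseGen_commutator (hM : ∀ i j : ℤ, i < j → IsNonnegInt (M i - M j)) (ξ₀ ξ₁ : ℂ[X]) (n : ℤ) :
    baseGen M 1 n * baseGen M 0 n - baseGen M 0 n * baseGen M 1 n =
      baseDiag fun m => bracket ((weight ξ₀ ξ₁ m.1 n - weight ξ₀ ξ₁ m.1 (n + 1) +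
        ((theta (-n) - theta (-n - 1) : ℤ) : ℂ[X]) * (ξ₀ - ξ₁) : ℂ[X]) : ℂ⟦X⟧) := by
  have c1 := corresponds_baseGen hM (Or.inr rfl) (μ := 1) n
  have c0 := corresponds_baseGen hM (Or.inl rfl) (μ := 0) n
  refine Corresponds.eq_of_eq hM ((c1.mul c0).sub (c0.mul c1))
    (Corresponds.of_basis (P₀ := 0) fun P _ m => ?_) rfl
  have hm := m.2.isPre hM
  have he := hm.isCPattern_iff.mp m.2
  have hc := chainGen_commutator_single (chainIndex n) he
  have ht : ∀ p, chainScale true p = 1 := fun p => rfl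
  rw [baseDiag_single, one_mul, phi_single, weight_commutator hm]
  change Finsupp.single _ (toK (br _) * _) = _
  rw [toK_br]
  by_cases h : 0 ≤ n
  · have e1 : isRaising 1 n = true := by simp [isRaising, h]
    have e0 : isRaising 0 n = false := by simp [isRaising, h]
    rw [e1, e0, ht, one_smul, hc, if_pos h, one_mul, Finsupp.smul_single, smul_eq_mul, mul_comm]
  · have e1 : isRaising 1 n = false := by simp [isRaising]; omega
    have e0 : isRaising 0 n = true := by simp [isRaising]; omega
    rw [e1, e0, ht, one_smul, if_neg h, neg_one_mul, qInt_neg]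
    rw [LinearMap.sub_apply] at hc ⊢
    rw [← neg_sub, hc, smul_neg, Finsupp.smul_single, smul_eq_mul, ← Finsupp.single_neg, mul_comm,
      mul_neg]

end Weights

/-! ### Truncations of the exponential and bracket series -/

section Series

theorem qPow_sub_dvd (x : ℂ⟦X⟧) (n : ℕ) :
    hh ^ (n + 1) ∣ qPow x - ∑ k ∈ Finset.range (n + 1), expCoeff k * x ^ k := by
  rw [PowerSeries.X_pow_dvd_iff]
  intro j hj
  have h : ∀ k, PowerSeries.coeff j (expCoeff k * x ^ k) =
      (1 / 2 : ℂ) ^ k / (k.factorial : ℂ) * PowerSeries.coeff j (hh ^ k * x ^ k) := fun k => by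
    rw [expCoeff, mul_assoc, PowerSeries.coeff_C_mul]
  rw [map_sub, map_sum, coeff_qPow, sub_eq_zero, Finset.sum_congr rfl fun k _ => h k]
  refine Finset.sum_subset (by simpa using hj) fun k _ hk => ?_
  have hk' : j < k := by simpa using hk
  rw [PowerSeries.coeff_X_pow_mul', if_neg (by omega), mul_zero]

/-- The error of the exponential is divisible by `h ^ (n + 1)`; one power is lost in dividing by `q
- q⁻¹`, which is `h` times a unit. -/
theorem bracket_sub_dvd (x : ℂ⟦X⟧) (n : ℕ) :
    hh ^ n ∣ bracket x - ∑ k ∈ Finset.range (n + 1), bracketCoeff k * x ^ k := by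
  have hu : IsUnit qUnit := by
    rw [PowerSeries.isUnit_iff_constantCoeff, constantCoeff_qUnit]
    exact isUnit_one
  have h1 := (qPow_sub_dvd x n).sub (qPow_sub_dvd (-x) n)
  have h2 : qPow x - ∑ k ∈ Finset.range (n + 1), expCoeff k * x ^ k -
      (qPow (-x) - ∑ k ∈ Finset.range (n + 1), expCoeff k * (-x) ^ k) =
      hh * ((bracket x - ∑ k ∈ Finset.range (n + 1), bracketCoeff k * x ^ k) * qUnit) := by
    have h3 : hh * ((bracket x - ∑ k ∈ Finset.range (n + 1), bracketCoeff k * x ^ k) * qUnit) =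
        (bracket x - ∑ k ∈ Finset.range (n + 1), bracketCoeff k * x ^ k) *
          (qPow 1 - qPow (-1)) := by
      rw [← hh_mul_qUnit]; ring
    rw [h3, sub_mul, bracket_mul, Finset.sum_mul]
    have h4 : ∀ k, bracketCoeff k * x ^ k * (qPow 1 - qPow (-1)) =
        expCoeff k * x ^ k - expCoeff k * (-x) ^ k := fun k => by
      rw [neg_pow]
      linear_combination x ^ k * bracketCoeff_mul k
    rw [Finset.sum_congr rfl fun k _ => h4 k, Finset.sum_sub_distrib]
    ring
  rw [h2, pow_succ', mul_dvd_mul_iff_left PowerSeries.X_ne_zero] at h1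
  exact hu.dvd_mul_right.mp h1

end Series

/-! ### Passage to the completed module -/

section Completion

variable {M : ℤ → ℂ[X]}

/-- The extension of endomorphisms to the completed module. -/
noncomputable def complete (M : ℤ → ℂ[X]) : Module.End ℂ⟦X⟧ (VHat M) →ₐ[ℂ⟦X⟧] EndV M :=
  AlgHom.ofLinearMap
    { toFun := fun T => (AdicCompletion.map hIdeal T).restrictScalars ℂ⟦X⟧
      map_add' := fun T T' => by
        refine AdicCompletion.map_ext'' (I := hIdeal) (LinearMap.ext fun a => ?_)
        exact (AdicCompletion.mk hIdeal (VHat M)).map_add (AdicCompletion.AdicCauchySequence.map _ T a)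
          (AdicCompletion.AdicCauchySequence.map _ T' a)
      map_smul' := fun c T => by
        refine AdicCompletion.map_ext'' (I := hIdeal) (LinearMap.ext fun a => ?_)
        exact (AdicCompletion.mk hIdeal (VHat M)).map_smul c
          (AdicCompletion.AdicCauchySequence.map _ T a) }
    (by
      refine LinearMap.ext fun v => ?_
      change AdicCompletion.map hIdeal LinearMap.id v = v
      rw [AdicCompletion.map_id]
      rfl)
    (fun T T' => by
      refine LinearMap.ext fun v => ?_
      exact (AdicCompletion.map_comp_apply hIdeal T' T v).symm)

theorem complete_sub (T T' : Module.End ℂ⟦X⟧ (VHat M)) :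
    complete M (T - T') = complete M T - complete M T' := map_sub (complete M) T T'

theorem rhoGen_eq (M : ℤ → ℂ[X]) (μ : ℕ) (n : ℤ) : rhoGen M μ n = complete M (baseGen M μ n) := by
  unfold rhoGen baseGen
  split_ifs <;> rfl

theorem baseDiag_pow (w : CPattern M → ℂ⟦X⟧) (k : ℕ) :
    baseDiag w ^ k = baseDiag fun m => w m ^ k := by
  induction k with
  | zero => exact vHat_ext fun m => by simp [baseDiag_single]
  | succ k ih =>
    rw [pow_succ, ih, baseDiag_mul]
    simp only [pow_succ]

/-- Modulo `h ^ n` the operator bracket is a polynomial in a diagonal operator. It differs from the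
diagonal operator of brackets by `h ^ n` times a diagonal operator, uniformly over the basis, and
the completion is Hausdorff. -/
theorem bracketOp_complete (w : CPattern M → ℂ⟦X⟧) :
    bracketOp (complete M (baseDiag w)) = complete M (baseDiag fun m => bracket (w m)) := by
  refine LinearMap.ext fun v => ?_
  rw [← sub_eq_zero]
  refine IsHausdorff.haus (I := hIdeal) inferInstance _ fun n => ?_
  rw [SModEq.zero, ← Submodule.Quotient.mk_eq_zero]
  rw [Submodule.Quotient.mk_sub, bracketOp, opSeries, IsAdicComplete.mk_lift, LinearMap.comp_apply,
    Submodule.mkQ_apply, ← Submodule.Quotient.mk_sub, Submodule.Quotient.mk_eq_zero,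
    ← neg_mem_iff, neg_sub]
  choose g hg using fun m => bracket_sub_dvd (w m) n
  have e : (baseDiag fun m => bracket (w m)) -
      ∑ k ∈ Finset.range (n + 1), bracketCoeff k • baseDiag w ^ k = hh ^ n • baseDiag g := by
    refine vHat_ext fun m => ?_
    simp only [LinearMap.sub_apply, LinearMap.sum_apply, LinearMap.smul_apply, baseDiag_pow,
      baseDiag_single, one_mul, Finsupp.smul_single, smul_eq_mul]
    rw [← Finsupp.single_finsetSum, ← Finsupp.single_sub, hg]
  have e2 := congrArg (complete M) e
  rw [complete_sub, map_sum] at e2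
  simp only [map_smul, map_pow] at e2
  rw [← LinearMap.sub_apply, e2, LinearMap.smul_apply]
  refine Submodule.smul_mem_smul ?_ trivial
  rw [Ideal.span_singleton_pow]
  exact Ideal.mem_span_singleton_self _

theorem commute_baseDiag (w w' : CPattern M → ℂ⟦X⟧) : Commute (baseDiag w) (baseDiag w') := by
  rw [Commute, SemiconjBy, baseDiag_mul, baseDiag_mul]
  simp only [mul_comm]

theorem lie_complete (T T' : Module.End ℂ⟦X⟧ (VHat M)) :
    ⁅complete M T, complete M T'⁆ = complete M (T * T' - T' * T) := by
  rw [Ring.lie_def, complete_sub, map_mul, map_mul]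

theorem lie_complete_eq_zero {T T' : Module.End ℂ⟦X⟧ (VHat M)} (h : Commute T T') :
    ⁅complete M T, complete M T'⁆ = 0 := by
  rw [lie_complete, complete_sub, h.eq, sub_self]

variable {μ : ℕ}

theorem commute_const_baseGen (hμ : μ = 0 ∨ μ = 1) (n : ℤ) (x : ℂ⟦X⟧) :
    Commute (baseDiag fun _ => x) (baseGen M μ n) := by
  have := baseDiag_mul_baseGen (M := M) (w := fun _ => x) (d := 0) hμ n (by simp)
  exact sub_eq_zero.mp (this.trans (zero_smul ℤ _))

theorem lie_weight_baseGen (hμ : μ = 0 ∨ μ = 1) (ξ₀ ξ₁ : ℂ[X]) (i n : ℤ) :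
    ⁅rhoH M ξ₀ ξ₁ i, complete M (baseGen M μ n)⁆ =
      genWeight μ i n • complete M (baseGen M μ n) := by
  have := baseDiag_mul_baseGen (M := M) (d := genWeight μ i n)
    (w := fun m => ((weight ξ₀ ξ₁ m.1 i : ℂ[X]) : ℂ⟦X⟧)) hμ n fun m m' h => by
      rw [weight_of_rowSum hμ ξ₀ ξ₁ h, Polynomial.coe_add, coe_intCast]
  change ⁅complete M (baseDiag _), _⁆ = _
  rw [lie_complete, this, map_zsmul]

theorem cartanRelations (hM : ∀ i j : ℤ, i < j → IsNonnegInt (M i - M j)) (ξ₀ ξ₁ : ℂ[X]) :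
    CartanRelations (rhoE M) (rhoF M) (rhoH M ξ₀ ξ₁) (rhoC M ξ₀ ξ₁) where
  c_h i := lie_complete_eq_zero (commute_baseDiag _ _)
  c_e i := by
    rw [rhoE, rhoGen_eq]
    exact lie_complete_eq_zero (commute_const_baseGen (Or.inr rfl) i _)
  c_f i := by
    rw [rhoF, rhoGen_eq]
    exact lie_complete_eq_zero (commute_const_baseGen (Or.inl rfl) i _)
  h_h i j := lie_complete_eq_zero (commute_baseDiag _ _)
  h_e i j := by
    rw [rhoE, rhoGen_eq, lie_weight_baseGen (Or.inr rfl), sub_eq_zero]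
    congr 1
    simp [genWeight]
  h_f i j := by
    rw [rhoF, rhoGen_eq, lie_weight_baseGen (Or.inl rfl), ← add_smul]
    convert zero_smul ℤ _
    simp [genWeight]
  e_f_same i := by
    have e : rhoH M ξ₀ ξ₁ i - rhoH M ξ₀ ξ₁ (i + 1) + (theta (-i) - theta (-i - 1)) • rhoC M ξ₀ ξ₁ =
        complete M (baseDiag fun m => ((weight ξ₀ ξ₁ m.1 i - weight ξ₀ ξ₁ m.1 (i + 1) +
          ((theta (-i) - theta (-i - 1) : ℤ) : ℂ[X]) * (ξ₀ - ξ₁) : ℂ[X]) : ℂ⟦X⟧)) := by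
      change complete M (baseDiag _) - complete M (baseDiag _) +
        (theta (-i) - theta (-i - 1)) • complete M (baseDiag _) = _
      rw [← complete_sub, ← map_zsmul, ← map_add]
      congr 1
      refine vHat_ext fun m => ?_
      simp only [LinearMap.sub_apply, LinearMap.add_apply, LinearMap.smul_apply, baseDiag_single,
        one_mul]
      rw [← Finsupp.single_sub, Finsupp.smul_single, ← Finsupp.single_add]
      congr 1
      rw [zsmul_eq_mul, Polynomial.coe_add, Polynomial.coe_mul, coe_intCast, Polynomial.coe_sub, Polynomial.coe_sub]
    rw [rhoE, rhoF, rhoGen_eq, rhoGen_eq, e, bracketOp_complete, lie_complete,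
      baseGen_commutator hM ξ₀ ξ₁, sub_self]
  e_f_ne i j hij := by
    rw [rhoE, rhoF, rhoGen_eq, rhoGen_eq]
    exact lie_complete_eq_zero (commute_baseGen' hM hij)

theorem serreRelations (hM : ∀ i j : ℤ, i < j → IsNonnegInt (M i - M j)) (hμ : μ = 0 ∨ μ = 1) :
    SerreRelations (rhoGen M μ) where
  comm i j hij := by
    rw [rhoGen_eq, rhoGen_eq]
    exact lie_complete_eq_zero (commute_baseGen hM hμ hij)
  serre i := by
    simp only [rhoGen_eq, ← map_mul, ← map_pow, ← map_smul, ← map_add, ← complete_sub]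
    rw [serrePoly_baseGen_of hM hμ (Or.inl rfl), map_zero]
  serre' i := by
    simp only [rhoGen_eq, ← map_mul, ← map_pow, ← map_smul, ← map_add, ← complete_sub]
    rw [serrePoly_baseGen_of hM hμ (Or.inr rfl), map_zero]

end Completion

end UhAInf

theorem proposition1 (M : ℤ → Polynomial ℂ) (ξ₀ ξ₁ : Polynomial ℂ)
    (hM : ∀ i j : ℤ, i < j → UhAInf.IsNonnegInt (M i - M j)) :
    UhAInf.CoefficientsWellDefined M ∧
    UhAInf.CartanRelations (UhAInf.rhoE M) (UhAInf.rhoF M) (UhAInf.rhoH M ξ₀ ξ₁)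
      (UhAInf.rhoC M ξ₀ ξ₁) ∧
    UhAInf.SerreRelations (UhAInf.rhoE M) ∧
    UhAInf.SerreRelations (UhAInf.rhoF M) :=
  ⟨UhAInf.coefficientsWellDefined hM, UhAInf.cartanRelations hM ξ₀ ξ₁,
    UhAInf.serreRelations hM (Or.inr rfl), UhAInf.serreRelations hM (Or.inl rfl)⟩
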